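/- **Setting.** Fix $C_0>0$. Let $N\ge 2$ and let $S=(S_{ij})$, $S_{ij}=\mathbb E|H_{ij}|^2$, be the variance matrix of an $N\times N$ generalized Wigner matrix: $S$ is real symmetric, $\frac{1}{C_0N}\le S_{ij}\le \frac{C_0}{N}$ for all $i,j$, and $\sum_j S_{ij}=1$ for all $i$. For $\operatorname{Im} z>0$ let $\mathfrak m(z)=(\mathfrak m_1(z),\dots,\mathfrak m_N(z))$ be the solution, with all $\operatorname{Im}\mathfrak m_i(z)>0$, of $$-\frac1{\mathfrak m_i(z)}=z+\sum_j S_{ij}\mathfrak m_j(z),$$ extended by $\mathfrak m(\bar z)=\overline{\mathfrak m(z)}$; also write $\mathfrak m(z)$ for the diagonal matrix with these entries and $\mathfrak m'(z)$ for its derivative. Put $$g(z,w)=\operatorname{Tr}\Big(\mathfrak m'(z)\mathfrak m(z)^{-1}(1-S\mathfrak m(z)\mathfrak m(w))^{-1}S\,\mathfrak m(z)\mathfrak m'(w)(1-S\mathfrak m(z)\mathfrak m(w))^{-1}\Big),$$ $$F(z,w)=|\mathfrak m(z)\mathfrak m(w)|^{1/2}S\,|\mathfrak m(z)\mathfrak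 m(w)|^{1/2}=\lambda_1(z,w)\,v(z,w)v(z,w)^T+A(z,w),$$ where $\lambda_1$ is the eigenvalue of $F$ of largest modulus and $v$ its $\ell^2$-normalized eigenvector with positive entries. Let $m_{sc}(z)=\int_{-2}^2\frac{\sqrt{4-x^2}}{2\pi(x-z)}\,dx$ and $m_{sc}(x)=\lim_{\eta\downarrow0}m_{sc}(x+i\eta)$ for real $x$. Let $\chi$ be a smooth real function with $\chi(y)=1$ for $|y|<1$ and $\chi(y)=0$ for $|y|>2$, and put $\tilde f(x+iy)=(f(x)+iyf'(x))\chi(y)$, $\bar\partial=\frac12(\partial_x+i\partial_y)$, and $\Omega_{\mathfrak a}=\{x+iy:|y|>N^{-1+\mathfrak a}\}$. **Proposition.** There is a constant $K>0$ depending only on $C_0$ such that, for every $N\ge2$ and every $S$ as above, the following holds. The limit $A=\lim_{(z,w)\to(x,y)}A(z,w)$, taken over non-real $z,w$, exists for all $x,y\in[-2,2]$ and is one and the same matrix. There is a measurable function $h_A:\mathbb R^2\to\mathbb R$, vanishing outside $[-2,2]^2$ and not depending on $f,\chi,\mathfrak a$, with $$|h_A(x,y)|\le K\qquad\text{and}\qquad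 |h_A(x,y)|\le K\sum_{i,j}A_{ij}^2 ,$$ such that for every $\chi$ as above, every $0<\mathfrak a<1$ and every compactly supported real $f\in C^2(\mathbb R)$ with $\log(N)\,N^{-1+\mathfrak a}\|f''\|_1\le 1$, the integral on the left below converges absolutely and $$\frac{2}{\pi^2}\int_{\Omega_{\mathfrak a}\times\Omega_{\mathfrak a}}\bar\partial\tilde f(w)\,\bar\partial\tilde f(z)\,g(z,w)\,dz\,dw=\frac1{\pi^2}\iint_{[-2,2]^2}\frac{f(x)-f(y)}{x-y}\,f'(y)\,\frac{\sqrt{4-y^2}}{\sqrt{4-x^2}}\,dx\,dy+\varepsilon(f)+r,$$ where $dz,dw$ denote Lebesgue measure on $\mathbb C$, $$\varepsilon(f)=\sum_{i=1}^NA_{ii}\left(-\frac1{\pi^2}\iint_{[-2,2]^2}(f(x)-f(y))f'(y)\operatorname{Re}m_{sc}(x)\frac{\sqrt{4-y^2}}{\sqrt{4-x^2}}\,dx\,dy\right)+\iint_{\mathbb R^2}(f(x)-f(y))f'(y)h_A(x,y)\,dx\,dy,$$ and the real number $r=r(f,\chi,\mathfrak a,S)$ satisfies $$|r|\le K\Big(\log(N)\,\big(N^{-1+\mathfrak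 a}\|f''\|_1\big)^2+\big(N^{-1+\mathfrak a}\|f''\|_1\big)^{3/2}\,\|f'\|_1^{1/2}\Big).$$ -/

import Mathlib

open MeasureTheory Filter Topology
open scoped ContDiff

namespace GenWigner

noncomputable section

/-- `S` is the variance profile `S i j = 𝔼 |H i j|²` of an `N × N` generalized Wigner matrix:
symmetric, `S i j ∼ 1 / N` with comparison constant `C₀`, and every row sums to one. -/
structure IsVarianceProfile {N : ℕ} (C₀ : ℝ) (S : Matrix (Fin N) (Fin N) ℝ) : Prop where
  symm : S.IsSymm
  lower : ∀ i j, 1 / (C₀ * N) ≤ S i j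
  upper : ∀ i j, S i j ≤ C₀ / N
  row_sum : ∀ i, ∑ j, S i j = 1

/-- `m` solves the quadratic vector equation at `z`, with all components in the upper half-plane. -/
def SolvesQVE {N : ℕ} (S : Matrix (Fin N) (Fin N) ℝ) (z : ℂ) (m : Fin N → ℂ) : Prop :=
  ∀ i, 0 < (m i).im ∧ -(1 / m i) = z + ∑ j, (S i j : ℂ) * m j

/-- The solution of the quadratic vector equation (it exists and is unique at every point of the
open upper half-plane), extended to the lower half-plane by reflection. -/
def qve {N : ℕ} (S : Matrix (Fin N) (Fin N) ℝ) (z : ℂ) : Fin N → ℂ :=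
  if 0 < z.im then Classical.epsilon (SolvesQVE S z)
  else fun i => starRingEnd ℂ (Classical.epsilon (SolvesQVE S (starRingEnd ℂ z)) i)

/-- The diagonal matrix `𝔪(z)`. -/
def qveDiag {N : ℕ} (S : Matrix (Fin N) (Fin N) ℝ) (z : ℂ) : Matrix (Fin N) (Fin N) ℂ :=
  Matrix.diagonal (qve S z)

/-- The diagonal matrix `𝔪'(z)`. -/
def qveDiagDeriv {N : ℕ} (S : Matrix (Fin N) (Fin N) ℝ) (z : ℂ) : Matrix (Fin N) (Fin N) ℂ :=
  Matrix.diagonal fun i => deriv (fun u => qve S u i) z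

/-- `g(z,w) = Tr(𝔪'(z) 𝔪(z)⁻¹ (1 - S 𝔪(z) 𝔪(w))⁻¹ S 𝔪(z) 𝔪'(w) (1 - S 𝔪(z) 𝔪(w))⁻¹)`. -/
def g {N : ℕ} (S : Matrix (Fin N) (Fin N) ℝ) (z w : ℂ) : ℂ :=
  let Sc : Matrix (Fin N) (Fin N) ℂ := S.map (fun t : ℝ => (t : ℂ))
  let R : Matrix (Fin N) (Fin N) ℂ := (1 - Sc * qveDiag S z * qveDiag S w)⁻¹
  (qveDiagDeriv S z * (qveDiag S z)⁻¹ * R * Sc * qveDiag S z * qveDiagDeriv S w * R).trace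

/-- `F(z,w) = |𝔪(z) 𝔪(w)|^{1/2} S |𝔪(z) 𝔪(w)|^{1/2}`. -/
def F {N : ℕ} (S : Matrix (Fin N) (Fin N) ℝ) (z w : ℂ) : Matrix (Fin N) (Fin N) ℝ :=
  Matrix.of fun i j =>
    √‖qve S z i * qve S w i‖ * S i j * √‖qve S z j * qve S w j‖

/-- `p = (λ₁, v)` where `λ₁` is the eigenvalue of `B` of largest modulus, and `v` is an eigenvector
for it with strictly positive entries and `ℓ²` norm one. -/
def IsPerronPair {N : ℕ} (B : Matrix (Fin N) (Fin N) ℝ) (p : ℝ × (Fin N → ℝ)) : Prop :=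
  B.mulVec p.2 = p.1 • p.2 ∧ (∀ i, 0 < p.2 i) ∧ ∑ i, p.2 i ^ 2 = 1 ∧
    ∀ μ : ℝ, Module.End.HasEigenvalue (Matrix.toLin' B) μ → |μ| ≤ p.1

/-- The Perron pair `(λ₁, v)`; it exists and is unique for symmetric matrices with positive
entries. -/
def perronPair {N : ℕ} (B : Matrix (Fin N) (Fin N) ℝ) : ℝ × (Fin N → ℝ) :=
  Classical.epsilon (IsPerronPair B)

/-- The part `A(z,w) = F(z,w) - λ₁(z,w) v(z,w) v(z,w)ᵀ` of `F(z,w)` below the spectral gap. -/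
def gapPart {N : ℕ} (S : Matrix (Fin N) (Fin N) ℝ) (z w : ℂ) : Matrix (Fin N) (Fin N) ℝ :=
  let p := perronPair (F S z w)
  F S z w - p.1 • Matrix.vecMulVec p.2 p.2

/-- The Stieltjes transform of the semicircle law. -/
def msc (z : ℂ) : ℂ :=
  ∫ x in Set.Icc (-2 : ℝ) 2, ((1 / (2 * Real.pi) * √(4 - x ^ 2) : ℝ) : ℂ) / ((x : ℂ) - z)

/-- The boundary value `m_sc(x + i0)`. -/
def mscBoundary (x : ℝ) : ℂ :=
  limUnder (𝓝[>] (0 : ℝ)) fun η : ℝ => msc ((x : ℂ) + (η : ℂ) * Complex.I)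

/-- A smooth cutoff equal to `1` for `|y| < 1` and to `0` for `|y| > 2`. -/
structure IsCutoff (χ : ℝ → ℝ) : Prop where
  smooth : ContDiff ℝ ∞ χ
  eq_one : ∀ y, |y| < 1 → χ y = 1
  eq_zero : ∀ y, 2 < |y| → χ y = 0

/-- The almost analytic extension `f̃(x + iy) = (f(x) + i y f'(x)) χ(y)`. -/
def almostAnalytic (χ f : ℝ → ℝ) (z : ℂ) : ℂ :=
  ((f z.re : ℂ) + Complex.I * (z.im : ℂ) * ((deriv f z.re : ℝ) : ℂ)) * (χ z.im : ℂ)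

/-- `∂̄ = (∂_x + i ∂_y) / 2`. -/
def dbar (u : ℂ → ℂ) (z : ℂ) : ℂ :=
  (1 / 2 : ℂ) * (fderiv ℝ u z 1 + Complex.I * fderiv ℝ u z Complex.I)

/-- The region `|y| > N^{-1+𝔞}`. -/
def Omega (N : ℕ) (𝔞 : ℝ) : Set ℂ := {z | (N : ℝ) ^ (-1 + 𝔞) < |z.im|}

/-- The `(z,w)`-integrand `∂̄f̃(w) ∂̄f̃(z) g(z,w)`. -/
def integrand {N : ℕ} (S : Matrix (Fin N) (Fin N) ℝ) (χ f : ℝ → ℝ) (p : ℂ × ℂ) : ℂ :=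
  dbar (almostAnalytic χ f) p.2 * dbar (almostAnalytic χ f) p.1 * g S p.1 p.2

/-- The square `[-2,2]²`. -/
def square : Set (ℝ × ℝ) := Set.Icc (-2 : ℝ) 2 ×ˢ Set.Icc (-2 : ℝ) 2

/-- The main term
`π⁻² ∬_{[-2,2]²} (f(x) - f(y)) / (x - y) f'(y) √(4 - y²) / √(4 - x²) dx dy`. -/
def mainTerm (f : ℝ → ℝ) : ℝ :=
  1 / Real.pi ^ 2 * ∫ p in square,
    (f p.1 - f p.2) / (p.1 - p.2) * deriv f p.2 * (√(4 - p.2 ^ 2) / √(4 - p.1 ^ 2))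

/-- The error functional `ε(f)` attached to a matrix `A` and a kernel `h`. -/
def errorTerm {N : ℕ} (A : Matrix (Fin N) (Fin N) ℝ) (h : ℝ → ℝ → ℝ) (f : ℝ → ℝ) : ℝ :=
  (∑ i, A i i) * (-(1 / Real.pi ^ 2) * ∫ p in square,
    (f p.1 - f p.2) * deriv f p.2 * (mscBoundary p.1).re * (√(4 - p.2 ^ 2) / √(4 - p.1 ^ 2)))
  + ∫ p : ℝ × ℝ, (f p.1 - f p.2) * deriv f p.2 * h p.1 p.2

end

end GenWigner

namespace GenWigner

/-! ### The semicircle Stieltjes transform on the closed upper half-plane -/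

/-! Since the rows of `S` sum to one, the constant vector m = m_sc solves the vector equation, and
the solution is unique because a Möbius inversion preserves hyperbolic distance while averaging and
shifting by z contract it (`solvesQVE_unique`). Hence F(z,w) = |m(z)m(w)| S, its Perron vector is
constant, and since |m| = 1 on [-2,2] the limit A is `centered S` = S - 1/N at every pair of points.

With μ_k the eigenvalues of A, the trace becomes m'(z)m'(w) times 1/(1 - m(z)m(w))² + ∑ μ_k/(1 - μ_k
m(z)m(w))² (`exists_eigenvalues_g_eq`). Expanding geometrically and writing T_n = ∑ μ_k^(n+1), this
is ∑ (1 + T_n)/(n+1) (m^(n+1))'(z) (m^(n+1))'(w), with the variables separated. Green's formula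
collapses each area integral to -Im Φ_n(η), where η = N^(-1+𝔞) and Φ_n(η) = ∫ (f' + iηf'')(x)
m(x+iη)^(n+1) dx (`setIntegral_dbarExt`). The left-hand side is therefore 2/π² ∑ (1 + T_n)/(n+1) (Im
Φ_n(η))².

At η = 0 write q_n = Im Φ_n(0) = ∫ f' sin((n+1)θ), where m = exp(iθ) on the spectrum. Then ∑
q_n²/(n+1) is the main term, by Abel summation of ∑ cos((n+1)θ_x) sin((n+1)θ_y) (`hasSum_mainTerm`).
The term T_0 q_0², with T_0 = Tr A, is the explicit part of ε(f). For n ≥ 1 the spectral gap |μ_k| ≤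
ρ = 1 - 1/C₀ gives |T_n| ≤ ρ^(n-1) ∑ A_ij², and each q_n²/(n+1) is represented by a kernel of size
O(n+1), so that the T_n-weighted kernels sum to a bounded h (`integral_mul_corrKernel`,
`hasSum_integral_momentKernel`).

The remainder comes from moving η to 0. With d_n the increment of Im Φ_n, the identity dΦ_n/dy = -y
∫ f'' (m^(n+1))' and the bound y|m'| ≤ (1 - |m|²)/2 give ∑ d_n²/(n+1) ≤ (η‖f''‖₁)²/4
(`sum_mul_stripMoment_sq_le`). The cross term ∑ q_n d_n/(n+1) is resummed: ∑ q_n m(w)^n is a Cauchy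
transform of f'√(4-t²), controlled through ∫ |f'(t)|/√|t-x| dt ≤ 5 (‖f''‖₁‖f'‖₁)^(1/2)
(`norm_cauchyTransform_le`, `exists_hasSum_cross`). -/

/-- A branch of `√(z² - 4)`, up to the factor `I`, which is regular on the closed upper
half-plane. -/
noncomputable def scRoot (z : ℂ) : ℂ :=
  (-Complex.I * (z - 2)) ^ ((2 : ℕ)⁻¹ : ℂ) * (-Complex.I * (z + 2)) ^ ((2 : ℕ)⁻¹ : ℂ)

/-- The root of `m² + z m + 1 = 0` of modulus less than one on the upper half-plane, as a function
that is continuous up to the real axis. -/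
noncomputable def sc (z : ℂ) : ℂ := (-z + Complex.I * scRoot z) / 2

lemma scRoot_sq (z : ℂ) : scRoot z ^ 2 = 4 - z ^ 2 := by
  unfold scRoot
  rw [mul_pow, Complex.cpow_nat_inv_pow _ two_ne_zero, Complex.cpow_nat_inv_pow _ two_ne_zero]
  linear_combination (z - 2) * (z + 2) * Complex.I_sq

lemma sc_quadratic (z : ℂ) : sc z ^ 2 + z * sc z + 1 = 0 := by
  unfold sc
  linear_combination (1 / 4 : ℂ) * Complex.I ^ 2 * scRoot_sq z + (4 - z ^ 2) / 4 * Complex.I_sq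

lemma sc_ne_zero (z : ℂ) : sc z ≠ 0 := by
  intro h
  simpa [h] using sc_quadratic z

lemma eq_neg_sc_sub_inv (z : ℂ) : z = -sc z - (sc z)⁻¹ := by
  have h := sc_ne_zero z
  field_simp
  linear_combination sc_quadratic z

lemma abs_arg_cpow_half {u : ℂ} (hu : 0 ≤ u.re) (h0 : u ≠ 0) :
    |(u ^ ((2 : ℕ)⁻¹ : ℂ)).arg| ≤ Real.pi / 4 ∧ (0 < u.re → |(u ^ ((2 : ℕ)⁻¹ : ℂ)).arg| < Real.pi / 4)
    := by
  have h1 : u ^ ((2 : ℕ)⁻¹ : ℂ) = Complex.exp (Complex.log u / 2) := by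
    rw [Complex.cpow_def_of_ne_zero h0]; congr 1
  have h2 : (Complex.log u / 2).im = u.arg / 2 := by
    rw [Complex.div_ofNat_im, Complex.log_im]
  have h3 : (u ^ ((2 : ℕ)⁻¹ : ℂ)).arg = u.arg / 2 := by
    rw [h1, Complex.arg_exp, h2]
    rw [toIocMod_eq_self]
    have := Complex.neg_pi_lt_arg u
    have := Complex.arg_le_pi u
    have := Real.pi_pos
    constructor <;> linarith
  rw [h3, abs_div, abs_two]
  refine ⟨?_, fun h => ?_⟩
  · have := Complex.abs_arg_le_pi_div_two_iff.2 hu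
    linarith
  · have := (Complex.abs_arg_lt_pi_div_two_iff (z := u)).2 (Or.inl h)
    linarith

/-- Both bases have real part Im z ≥ 0, so each square root has argument in [-π/4, π/4] and the
product stays in the closed right half-plane. -/
lemma scRoot_re_nonneg {z : ℂ} (hz : 0 ≤ z.im) : 0 ≤ (scRoot z).re := by
  unfold scRoot
  by_cases h1 : -Complex.I * (z - 2) = 0
  · simp [h1]
  by_cases h2 : -Complex.I * (z + 2) = 0
  · simp [h2]
  have a1 := (abs_arg_cpow_half (u := -Complex.I * (z - 2)) (by simpa using hz) h1).1
  have a2 := (abs_arg_cpow_half (u := -Complex.I * (z + 2)) (by simpa using hz) h2).1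
  have n1 : (-Complex.I * (z - 2)) ^ ((2 : ℕ)⁻¹ : ℂ) ≠ 0 :=
    fun h => h1 ((Complex.cpow_eq_zero_iff _ _).1 h).1
  have n2 : (-Complex.I * (z + 2)) ^ ((2 : ℕ)⁻¹ : ℂ) ≠ 0 :=
    fun h => h2 ((Complex.cpow_eq_zero_iff _ _).1 h).1
  rw [← Complex.abs_arg_le_pi_div_two_iff]
  have := Real.pi_pos
  rw [abs_le] at a1 a2
  rw [Complex.arg_mul n1 n2 ⟨by linarith, by linarith⟩]
  rw [abs_le]; constructor <;> linarith

lemma scRoot_re_pos {z : ℂ} (hz : 0 < z.im) : 0 < (scRoot z).re := by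
  refine lt_of_le_of_ne (scRoot_re_nonneg hz.le) fun h => ?_
  have h1 : -Complex.I * (z - 2) ≠ 0 := fun h => by
    have := congrArg Complex.re h; simp at this; linarith
  have h2 : -Complex.I * (z + 2) ≠ 0 := fun h => by
    have := congrArg Complex.re h; simp at this; linarith
  have a1 := (abs_arg_cpow_half (u := -Complex.I * (z - 2)) (by simpa using hz.le) h1).2
    (by simpa using hz)
  have a2 := (abs_arg_cpow_half (u := -Complex.I * (z + 2)) (by simpa using hz.le) h2).2
    (by simpa using hz)
  have n1 : (-Complex.I * (z - 2)) ^ ((2 : ℕ)⁻¹ : ℂ) ≠ 0 :=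
    fun h => h1 ((Complex.cpow_eq_zero_iff _ _).1 h).1
  have n2 : (-Complex.I * (z + 2)) ^ ((2 : ℕ)⁻¹ : ℂ) ≠ 0 :=
    fun h => h2 ((Complex.cpow_eq_zero_iff _ _).1 h).1
  have h3 : |(scRoot z).arg| < Real.pi / 2 := by
    unfold scRoot
    have := Real.pi_pos
    rw [abs_lt] at a1 a2
    rw [Complex.arg_mul n1 n2 ⟨by linarith, by linarith⟩]
    rw [abs_lt]; constructor <;> linarith
  rw [Complex.abs_arg_lt_pi_div_two_iff] at h3
  rcases h3 with h3 | h3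
  · linarith
  · exact mul_ne_zero n1 n2 h3

/-- The imaginary part of the defining equation `1 / m + m = -z`. -/
lemma sc_im_mul (z : ℂ) : (sc z).im * (1 - ‖sc z‖ ^ 2) = ‖sc z‖ ^ 2 * z.im := by
  have h := sc_quadratic z
  have h1 : sc z * (starRingEnd ℂ) (sc z) = (‖sc z‖ ^ 2 : ℝ) := by
    rw [Complex.mul_conj, Complex.normSq_eq_norm_sq]
  have h2 : (‖sc z‖ ^ 2 : ℝ) * sc z + z * (‖sc z‖ ^ 2 : ℝ) + (starRingEnd ℂ) (sc z) = 0 := by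
    rw [← h1]; linear_combination (starRingEnd ℂ) (sc z) * h
  have h3 := congrArg Complex.im h2
  simp only [Complex.add_im, Complex.im_ofReal_mul, Complex.conj_im, Complex.zero_im,
    Complex.im_mul_ofReal] at h3
  linarith

/-- The other root of the quadratic visibly has negative imaginary part, and the two roots multiply
to 1, so inversion flips the sign. -/
lemma sc_im_pos {z : ℂ} (hz : 0 < z.im) : 0 < (sc z).im := by
  have h1 : sc z * ((-z - Complex.I * scRoot z) / 2) = 1 := by
    unfold sc
    linear_combination (-1 / 4 : ℂ) * Complex.I ^ 2 * scRoot_sq z - (4 - z ^ 2) / 4 * Complex.I_sq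
  have h2 : ((-z - Complex.I * scRoot z) / 2).im < 0 := by
    have := scRoot_re_pos hz
    simp
    linarith
  rw [eq_inv_of_mul_eq_one_left h1, Complex.inv_im]
  apply div_pos (by linarith)
  rw [Complex.normSq_pos]
  intro h
  simp [h] at h1

lemma norm_sc_lt_one {z : ℂ} (hz : 0 < z.im) : ‖sc z‖ < 1 := by
  have h := sc_im_mul z
  have h1 := sc_im_pos hz
  have h2 : 0 < ‖sc z‖ := norm_pos_iff.2 (sc_ne_zero z)
  have h3 : 0 < (sc z).im * (1 - ‖sc z‖ ^ 2) := by rw [h]; positivity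
  have := (pos_iff_pos_of_mul_pos h3).1 h1
  nlinarith

/-- The origin is the only point of the closed right half-plane outside the slit plane, and there
the positive exponent gives continuity. -/
lemma continuousAt_cpow_half {u : ℂ} (hu : 0 ≤ u.re) :
    ContinuousAt (fun v : ℂ => v ^ ((2 : ℕ)⁻¹ : ℂ)) u := by
  by_cases h : u = 0
  · subst h
    exact (Complex.continuousAt_cpow_zero_of_re_pos (z := ((2 : ℕ)⁻¹ : ℂ)) (by norm_num)).comp
      (f := fun v : ℂ => (v, ((2 : ℕ)⁻¹ : ℂ))) (by fun_prop)
  · refine continuousAt_cpow_const ?_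
    rw [Complex.mem_slitPlane_iff]
    by_contra! h'
    exact h (Complex.ext (le_antisymm h'.1 hu) h'.2)

lemma continuousAt_sc {z : ℂ} (hz : 0 ≤ z.im) : ContinuousAt sc z := by
  unfold sc scRoot
  have h1 : ContinuousAt (fun z : ℂ => (-Complex.I * (z - 2)) ^ ((2 : ℕ)⁻¹ : ℂ)) z :=
    ContinuousAt.comp (f := fun z : ℂ => -Complex.I * (z - 2))
      (continuousAt_cpow_half (by simpa using hz)) (by fun_prop)
  have h2 : ContinuousAt (fun z : ℂ => (-Complex.I * (z + 2)) ^ ((2 : ℕ)⁻¹ : ℂ)) z :=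
    ContinuousAt.comp (f := fun z : ℂ => -Complex.I * (z + 2))
      (continuousAt_cpow_half (by simpa using hz)) (by fun_prop)
  fun_prop

lemma continuous_sc_comp {X : Type*} [TopologicalSpace X] {φ : X → ℂ} (hφ : Continuous φ)
    (h0 : ∀ x, 0 ≤ (φ x).im) : Continuous fun x => sc (φ x) :=
  continuous_iff_continuousAt.2 fun x =>
    ContinuousAt.comp (continuousAt_sc (h0 x)) hφ.continuousAt

lemma continuousAt_sc_vertical {z : ℂ} (hz : 0 ≤ z.im) :
    ContinuousAt (fun t : ℝ => sc (z + t * Complex.I)) 0 := by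
  have h : ContinuousAt sc (z + ((0 : ℝ) : ℂ) * Complex.I) := by simpa using continuousAt_sc hz
  exact ContinuousAt.comp (f := fun t : ℝ => z + t * Complex.I) h (by fun_prop)

lemma norm_sc_le_one {z : ℂ} (hz : 0 ≤ z.im) : ‖sc z‖ ≤ 1 := by
  have h1 : Tendsto (fun t : ℝ => ‖sc (z + t * Complex.I)‖) (𝓝[>] 0) (𝓝 ‖sc z‖) := by
    have h := (continuousAt_sc_vertical hz).norm
    simpa using h.tendsto.mono_left (nhdsWithin_le_nhds (s := Set.Ioi 0))
  refine le_of_tendsto h1 ?_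
  filter_upwards [self_mem_nhdsWithin] with t ht
  refine (norm_sc_lt_one ?_).le
  have : 0 < t := ht
  simp; linarith

lemma sc_im_nonneg {z : ℂ} (hz : 0 ≤ z.im) : 0 ≤ (sc z).im := by
  have h1 : Tendsto (fun t : ℝ => (sc (z + t * Complex.I)).im) (𝓝[>] 0) (𝓝 (sc z).im) := by
    have h := Complex.continuous_im.continuousAt.comp (continuousAt_sc_vertical hz)
    simpa [Function.comp_def] using h.tendsto.mono_left (nhdsWithin_le_nhds (s := Set.Ioi 0))
  refine ge_of_tendsto h1 ?_
  filter_upwards [self_mem_nhdsWithin] with t ht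
  refine (sc_im_pos ?_).le
  have : 0 < t := ht
  simp; linarith

/-- The derivative of `sc` in the upper half-plane. -/
noncomputable def scDeriv (z : ℂ) : ℂ := sc z ^ 2 / (1 - sc z ^ 2)

lemma one_sub_sc_sq_ne_zero {z : ℂ} (hz : 0 < z.im) : 1 - sc z ^ 2 ≠ 0 := by
  intro h
  have h1 : sc z ^ 2 = 1 := by linear_combination -h
  have h2 := congrArg norm h1
  rw [norm_pow, norm_one] at h2
  have := norm_sc_lt_one hz
  nlinarith [norm_nonneg (sc z)]

/-- Differentiability comes from the explicit branch; the value comes from differentiating the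
quadratic equation implicitly. -/
lemma hasDerivAt_sc {z : ℂ} (hz : 0 < z.im) : HasDerivAt sc (scDeriv z) z := by
  have hd : DifferentiableAt ℂ sc z := by
    unfold sc scRoot
    have h1 : DifferentiableAt ℂ (fun z : ℂ => (-Complex.I * (z - 2)) ^ ((2 : ℕ)⁻¹ : ℂ)) z := by
      refine DifferentiableAt.cpow (by fun_prop) (by fun_prop) (Or.inl (by simpa using hz))
    have h2 : DifferentiableAt ℂ (fun z : ℂ => (-Complex.I * (z + 2)) ^ ((2 : ℕ)⁻¹ : ℂ)) z := by
      refine DifferentiableAt.cpow (by fun_prop) (by fun_prop) (Or.inl (by simpa using hz))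
    fun_prop
  have h := hd.hasDerivAt
  have h1 : HasDerivAt (fun u => sc u ^ 2 + u * sc u + 1) (2 * sc z * deriv sc z +
      (1 * sc z + z * deriv sc z)) z := by
    have := ((h.pow 2).add ((hasDerivAt_id z).mul h)).add_const 1
    simpa using this
  have h2 : (2 * sc z * deriv sc z + (1 * sc z + z * deriv sc z)) = 0 := by
    refine h1.unique ?_
    simp only [sc_quadratic]
    exact hasDerivAt_const z (0 : ℂ)
  have h3 : deriv sc z = scDeriv z := by
    unfold scDeriv
    rw [eq_div_iff (one_sub_sc_sq_ne_zero hz)]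
    linear_combination (-(sc z)) * h2 + deriv sc z * sc_quadratic z
  rwa [h3] at h

/-- Factor 1 - m² = m(1/m - m) and keep only the imaginary part of the second factor: this leaves Im
m · (1/|m| + |m|), at least 2 Im m by AM-GM. -/
lemma norm_one_sub_sc_sq_ge {z : ℂ} (hz : 0 ≤ z.im) : 2 * (sc z).im ≤ ‖1 - sc z ^ 2‖ := by
  have h0 : 0 < ‖sc z‖ := norm_pos_iff.2 (sc_ne_zero z)
  have h1 : 1 - sc z ^ 2 = sc z * ((sc z)⁻¹ - sc z) := by
    have := sc_ne_zero z
    field_simp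
  have h2 : ((sc z)⁻¹ - sc z).im = -((sc z).im * (1 / ‖sc z‖ ^ 2 + 1)) := by
    rw [Complex.sub_im, Complex.inv_im, Complex.normSq_eq_norm_sq]; ring
  have h3 := Complex.abs_im_le_norm ((sc z)⁻¹ - sc z)
  have h4 := sc_im_nonneg hz
  rw [h2, abs_neg, abs_of_nonneg (by positivity)] at h3
  rw [h1, norm_mul]
  calc 2 * (sc z).im ≤ ‖sc z‖ * ((sc z).im * (1 / ‖sc z‖ ^ 2 + 1)) := by
        have : ‖sc z‖ * ((sc z).im * (1 / ‖sc z‖ ^ 2 + 1)) - 2 * (sc z).im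
          = (sc z).im * (1 - ‖sc z‖) ^ 2 / ‖sc z‖ := by field_simp; ring
        have : 0 ≤ (sc z).im * (1 - ‖sc z‖) ^ 2 / ‖sc z‖ := by positivity
        linarith
    _ ≤ _ := by gcongr

/-- A Schwarz-Pick type bound. The factor 1 - |m|² is what later cancels against ∑ (n+1)|m|^(2n) =
(1 - |m|²)⁻², so that the powers can be summed uniformly up to the spectrum. -/
lemma im_mul_norm_scDeriv_le {z : ℂ} (hz : 0 < z.im) :
    z.im * ‖scDeriv z‖ ≤ (1 - ‖sc z‖ ^ 2) / 2 := by
  have h1 := norm_one_sub_sc_sq_ge hz.le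
  have h2 := sc_im_pos hz
  have h3 := sc_im_mul z
  have h4 := norm_sc_lt_one hz
  unfold scDeriv
  rw [norm_div, norm_pow, ← mul_div_assoc, div_le_iff₀ (by linarith)]
  have : 0 ≤ 1 - ‖sc z‖ ^ 2 := by nlinarith [norm_nonneg (sc z)]
  nlinarith

lemma norm_scDeriv_sq_mul {z : ℂ} (hz : 0 < z.im) :
    ‖scDeriv z‖ ^ 2 * ‖z ^ 2 - 4‖ = ‖sc z‖ ^ 2 := by
  have h1 : scDeriv z ^ 2 * (z ^ 2 - 4) = sc z ^ 2 := by
    have := one_sub_sc_sq_ne_zero hz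
    have h2 : sc z ^ 2 * (z ^ 2 - 4) = (1 - sc z ^ 2) ^ 2 := by
      linear_combination (sc z * z - sc z ^ 2 - 1) * sc_quadratic z
    unfold scDeriv
    field_simp
    linear_combination sc z ^ 2 * h2
  have := congrArg norm h1
  rwa [norm_mul, norm_pow, norm_pow] at this

/-- In (z-2)(z+2) both factors are at least Im z, and the larger one is at least 2 because the two
distances add up to at least 4. -/
lemma two_mul_im_le_norm {z : ℂ} (hz : 0 ≤ z.im) : 2 * z.im ≤ ‖z ^ 2 - 4‖ := by
  have h1 : z ^ 2 - 4 = (z - 2) * (z + 2) := by ring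
  have h2 : z.im ≤ ‖z - 2‖ := by
    have := Complex.abs_im_le_norm (z - 2)
    rw [abs_of_nonneg (by simpa using hz)] at this
    simpa using this
  have h3 : z.im ≤ ‖z + 2‖ := by
    have := Complex.abs_im_le_norm (z + 2)
    rw [abs_of_nonneg (by simpa using hz)] at this
    simpa using this
  have h4 : 4 ≤ ‖z - 2‖ + ‖z + 2‖ := by
    have := norm_sub_le (z + 2) (z - 2)
    have h : z + 2 - (z - 2) = 4 := by ring
    rw [h] at this
    norm_num at this
    linarith
  rw [h1, norm_mul]
  rcases le_total ‖z - 2‖ ‖z + 2‖ with h | h <;> nlinarith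

lemma norm_scDeriv_le {z : ℂ} (hz : 0 < z.im) : ‖scDeriv z‖ ≤ 1 / √(2 * z.im) := by
  rw [le_div_iff₀ (by positivity)]
  have h1 := norm_scDeriv_sq_mul hz
  have h2 := two_mul_im_le_norm hz.le
  have h3 := norm_sc_lt_one hz
  refine le_of_sq_le_sq ?_ zero_le_one
  rw [mul_pow, Real.sq_sqrt (by positivity)]
  have h4 : ‖scDeriv z‖ ^ 2 * (2 * z.im) ≤ ‖scDeriv z‖ ^ 2 * ‖z ^ 2 - 4‖ := by gcongr
  nlinarith [norm_nonneg (sc z)]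

/-- Since Im m ≤ |m| < 1, `sc_im_mul` gives |m|² Im z ≤ 1 - |m|². This keeps |m| away from 1 at a
fixed height and provides geometric convergence there. -/
lemma norm_sc_sq_le {z : ℂ} (hz : 0 < z.im) : ‖sc z‖ ^ 2 ≤ 1 / (1 + z.im) := by
  have h1 := sc_im_mul z
  have h2 := norm_sc_lt_one hz
  have h3 := Complex.abs_im_le_norm (sc z)
  have h4 := le_abs_self (sc z).im
  rw [le_div_iff₀ (by linarith)]
  have : 0 ≤ 1 - ‖sc z‖ ^ 2 := by nlinarith [norm_nonneg (sc z)]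
  nlinarith

/-! ### Values on the real axis -/

/-- The imaginary part of the quadratic equation reads b(2a + x) = 0 for m = a + ib. The case b = 0
forces x² ≥ 4, where the real square root is 0 by convention, so no restriction on x is needed. -/
lemma sc_ofReal_im (x : ℝ) : (sc x).im = √(4 - x ^ 2) / 2 := by
  have h := sc_quadratic x
  have h1 := congrArg Complex.re h
  have h2 := congrArg Complex.im h
  have h3 := sc_im_nonneg (z := (x : ℂ)) (by simp)
  simp [pow_two] at h1 h2
  set a := (sc x).re
  set b := (sc x).im
  have h4 : b * (2 * a + x) = 0 := by linarith
  rcases mul_eq_zero.1 h4 with hb | ha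
  · have : √(4 - x ^ 2) = 0 := Real.sqrt_eq_zero_of_nonpos (by
      rw [hb] at h1; nlinarith [sq_nonneg (2 * a + x)])
    rw [hb, this, zero_div]
  · have hx : x = -2 * a := by linarith
    have h5 : 4 - x ^ 2 = (2 * b) ^ 2 := by rw [hx] at h1 ⊢; linarith
    rw [h5, Real.sqrt_sq (by linarith)]; ring

lemma sc_ofReal_re {x : ℝ} (hx : x ∈ Set.Icc (-2 : ℝ) 2) : (sc x).re = -x / 2 := by
  have h := sc_quadratic x
  have h1 := congrArg Complex.re h
  have h2 := congrArg Complex.im h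
  have h3 := sc_ofReal_im x
  simp [pow_two] at h1 h2
  have h5 : √(4 - x ^ 2) ^ 2 = 4 - x ^ 2 := Real.sq_sqrt (by nlinarith [hx.1, hx.2])
  have h6 : (2 * (sc x).re + x) ^ 2 = 0 := by
    have : (sc x).im ^ 2 = (4 - x ^ 2) / 4 := by rw [h3, div_pow, h5]; norm_num
    nlinarith
  have := pow_eq_zero_iff (two_ne_zero) |>.1 h6
  linarith

lemma norm_sc_ofReal {x : ℝ} (hx : x ∈ Set.Icc (-2 : ℝ) 2) : ‖sc x‖ = 1 := by
  have h5 : √(4 - x ^ 2) ^ 2 = 4 - x ^ 2 := Real.sq_sqrt (by nlinarith [hx.1, hx.2])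
  have : ‖sc x‖ ^ 2 = 1 := by
    rw [← Complex.normSq_eq_norm_sq, Complex.normSq_apply, sc_ofReal_im, sc_ofReal_re hx]
    nlinarith
  exact (pow_eq_one_iff_of_nonneg (norm_nonneg _) two_ne_zero).1 this

/-- On the open spectrum m = exp(iθ), and this says dθ/dx = 1/√(4 - x²). -/
lemma hasDerivAt_sc_ofReal {x : ℝ} (hx : x ∈ Set.Ioo (-2 : ℝ) 2) :
    HasDerivAt (fun t : ℝ => sc t) (Complex.I * sc x / (√(4 - x ^ 2) : ℝ)) x := by
  have h0 : 0 < 4 - x ^ 2 := by nlinarith [hx.1, hx.2]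
  have h1 : HasDerivAt (fun t : ℝ => √(4 - t ^ 2)) (-x / √(4 - x ^ 2)) x := by
    have := ((hasDerivAt_pow 2 x).const_sub 4).sqrt h0.ne'
    convert this using 1
    have : 0 < √(4 - x ^ 2) := Real.sqrt_pos.2 h0
    field_simp; norm_num; ring
  have h2 : HasDerivAt (fun t : ℝ => (-(t : ℂ) + Complex.I * (√(4 - t ^ 2) : ℝ)) / 2)
      ((-1 + Complex.I * ((-x / √(4 - x ^ 2) : ℝ) : ℂ)) / 2) x :=
    (((hasDerivAt_id x).ofReal_comp.neg.add (h1.ofReal_comp.const_mul Complex.I)).div_const 2)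
  have h3 : ∀ t ∈ Set.Ioo (-2 : ℝ) 2, sc t = (-(t : ℂ) + Complex.I * (√(4 - t ^ 2) : ℝ)) / 2 := by
    intro t ht
    apply Complex.ext
    · rw [sc_ofReal_re (Set.Ioo_subset_Icc_self ht)]; simp
    · rw [sc_ofReal_im]; simp
  have h4 := h2.congr_of_eventuallyEq (f₁ := fun t : ℝ => sc t)
    (Filter.eventuallyEq_of_mem (Ioo_mem_nhds hx.1 hx.2) h3)
  have h5 : (√(4 - x ^ 2) : ℂ) ≠ 0 := by exact_mod_cast (Real.sqrt_pos.2 h0).ne'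
  have h6 : Complex.I * sc x / (√(4 - x ^ 2) : ℝ)
      = (-1 + Complex.I * ((-x / √(4 - x ^ 2) : ℝ) : ℂ)) / 2 := by
    rw [h3 x hx]
    push_cast
    field_simp
    linear_combination (√(4 - x ^ 2) : ℂ) * Complex.I_sq
  rw [h6]
  exact h4

/-! ### Scalar solution of the quadratic vector equation -/

/-- The extension of `sc` to the lower half-plane by reflection. -/
noncomputable def scExt (z : ℂ) : ℂ :=
  if 0 < z.im then sc z else (starRingEnd ℂ) (sc ((starRingEnd ℂ) z))

/-- The derivative of `scExt` off the real axis. -/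
noncomputable def scExtDeriv (z : ℂ) : ℂ :=
  if 0 < z.im then scDeriv z else (starRingEnd ℂ) (scDeriv ((starRingEnd ℂ) z))

lemma hasDerivAt_scExt {z : ℂ} (hz : z.im ≠ 0) : HasDerivAt scExt (scExtDeriv z) z := by
  rcases lt_or_gt_of_ne hz with h | h
  · have h1 : HasDerivAt (fun u => (starRingEnd ℂ) (sc ((starRingEnd ℂ) u))) (scExtDeriv z) z := by
      have h2 := (hasDerivAt_sc (z := (starRingEnd ℂ) z) (by simpa using h)).conj_conj
      simpa [scExtDeriv, h.not_gt, Function.comp_def] using h2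
    refine h1.congr_of_eventuallyEq ?_
    filter_upwards [(isOpen_lt Complex.continuous_im continuous_const).mem_nhds h] with u hu
    have hu : u.im < 0 := hu
    simp [scExt, hu.not_gt]
  · have h1 : HasDerivAt sc (scExtDeriv z) z := by
      simpa [scExtDeriv, h] using hasDerivAt_sc h
    refine h1.congr_of_eventuallyEq ?_
    filter_upwards [(isOpen_lt continuous_const Complex.continuous_im).mem_nhds h] with u hu
    have hu : 0 < u.im := hu
    simp [scExt, hu]

lemma norm_scExt_lt_one {z : ℂ} (hz : z.im ≠ 0) : ‖scExt z‖ < 1 := by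
  rcases lt_or_gt_of_ne hz with h | h
  · simpa [scExt, h.not_gt] using norm_sc_lt_one (z := (starRingEnd ℂ) z) (by simpa using h)
  · simpa [scExt, h] using norm_sc_lt_one h

lemma norm_scExt_eq {z : ℂ} (hz : z.im ≠ 0) :
    ‖scExt z‖ = ‖sc (z.re + (|z.im| : ℝ) * Complex.I)‖ := by
  rcases lt_or_gt_of_ne hz with h | h
  · have : (starRingEnd ℂ) z = z.re + (|z.im| : ℝ) * Complex.I := by
      apply Complex.ext <;> simp [abs_of_neg h]
    simp [scExt, h.not_gt, this]
  · have : z = z.re + (|z.im| : ℝ) * Complex.I := by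
      apply Complex.ext <;> simp [abs_of_pos h]
    simp only [scExt, h, if_true]
    rw [← this]

lemma scExt_ne_zero (z : ℂ) : scExt z ≠ 0 := by
  unfold scExt
  split_ifs
  · exact sc_ne_zero z
  · simpa using sc_ne_zero _

section

variable {N : ℕ} {C₀ : ℝ} {S : Matrix (Fin N) (Fin N) ℝ}

lemma IsVarianceProfile.entry_nonneg (hC₀ : 0 < C₀) (hS : IsVarianceProfile C₀ S) (i j : Fin N) :
    0 ≤ S i j := le_trans (by positivity) (hS.lower i j)

lemma IsVarianceProfile.entry_pos (hN : 0 < N) (hC₀ : 0 < C₀) (hS : IsVarianceProfile C₀ S)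
    (i j : Fin N) : 0 < S i j := by
  have : (0 : ℝ) < N := by exact_mod_cast hN
  exact lt_of_lt_of_le (by positivity) (hS.lower i j)

lemma IsVarianceProfile.one_le (hN : 0 < N) (hS : IsVarianceProfile C₀ S) : 1 ≤ C₀ := by
  have h0 : (0 : ℝ) < N := by exact_mod_cast hN
  have h1 : ∑ j, S ⟨0, hN⟩ j ≤ ∑ _j : Fin N, C₀ / N :=
    Finset.sum_le_sum fun j _ => hS.upper _ j
  rw [hS.row_sum] at h1
  simpa [mul_div_cancel₀, h0.ne'] using h1

lemma solvesQVE_const (hS : IsVarianceProfile C₀ S) {z : ℂ} (hz : 0 < z.im) :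
    SolvesQVE S z fun _ => sc z := by
  intro i
  refine ⟨sc_im_pos hz, ?_⟩
  rw [← Finset.sum_mul]
  have : ∑ j, (S i j : ℂ) = 1 := by exact_mod_cast hS.row_sum i
  rw [this]
  have := eq_neg_sc_sub_inv z
  rw [one_div]
  linear_combination -this

/-- Uniqueness in the quadratic vector equation, by contraction of the hyperbolic metric. -/
lemma solvesQVE_unique (hC₀ : 0 < C₀) (hS : IsVarianceProfile C₀ S) {z : ℂ} (hz : 0 < z.im)
    {m : Fin N → ℂ} (hm : SolvesQVE S z m) : m = fun _ => sc z := by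
  by_contra hne
  obtain ⟨i₀, hi₀⟩ := Function.ne_iff.1 hne
  set q := sc z with hq
  have hq0 : 0 < q.im := sc_im_pos hz
  -- `D i` equals 2(cosh d - 1), where d is the hyperbolic distance between `m i` and `q`. The index
  -- maximizing it is examined.
  let D : Fin N → ℝ := fun i => ‖m i - q‖ ^ 2 / ((m i).im * q.im)
  obtain ⟨i, -, hi⟩ := Finset.exists_max_image Finset.univ D ⟨i₀, Finset.mem_univ _⟩
  have hpos : ∀ j, 0 < (m j).im := fun j => (hm j).1
  have hD : 0 < D i := by
    refine lt_of_lt_of_le ?_ (hi i₀ (Finset.mem_univ _))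
    have : 0 < ‖m i₀ - q‖ := norm_pos_iff.2 (sub_ne_zero.2 hi₀)
    have := hpos i₀
    positivity
  set t := D i
  have hle : ∀ j, ‖m j - q‖ ^ 2 ≤ t * ((m j).im * q.im) := fun j => by
    have := hi j (Finset.mem_univ _)
    rwa [div_le_iff₀ (mul_pos (hpos j) hq0)] at this
  set s : ℂ := ∑ j, (S i j : ℂ) * m j
  have hs : s.im = ∑ j, S i j * (m j).im := by simp [s]
  -- Averaging does not increase the distance to `q`: the numerator is handled by convexity of the
  -- square, while the imaginary part in the denominator is linear.
  have hsq : ‖s - q‖ ^ 2 ≤ t * (s.im * q.im) := by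
    have h1 : s - q = ∑ j, (S i j : ℂ) * (m j - q) := by
      simp only [mul_sub, Finset.sum_sub_distrib, ← Finset.sum_mul]
      have : ∑ j, (S i j : ℂ) = 1 := by exact_mod_cast hS.row_sum i
      rw [this, one_mul]
    have h2 : ‖s - q‖ ≤ ∑ j, S i j * ‖m j - q‖ := by
      rw [h1]
      refine (norm_sum_le _ _).trans (le_of_eq (Finset.sum_congr rfl fun j _ => ?_))
      rw [norm_mul, Complex.norm_real, Real.norm_of_nonneg (hS.entry_nonneg hC₀ i j)]
    calc ‖s - q‖ ^ 2 ≤ (∑ j, S i j * ‖m j - q‖) ^ 2 := by gcongr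
      _ ≤ ∑ j, S i j * ‖m j - q‖ ^ 2 :=
        Real.pow_arith_mean_le_arith_mean_pow _ _ _ (fun j _ => hS.entry_nonneg hC₀ i j)
          (hS.row_sum i) (fun j _ => norm_nonneg _) 2
      _ ≤ ∑ j, S i j * (t * ((m j).im * q.im)) := by
        gcongr with j
        · exact hS.entry_nonneg hC₀ i j
        · exact hle j
      _ = t * (s.im * q.im) := by
        rw [hs, Finset.sum_mul, Finset.mul_sum]
        exact Finset.sum_congr rfl fun j _ => by ring
  have hs0 : 0 ≤ s.im := by
    rw [hs]
    exact Finset.sum_nonneg fun j _ => mul_nonneg (hS.entry_nonneg hC₀ i j) (hpos j).le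
  have e1 : -(1 / m i) = z + s := (hm i).2
  have e2 : -(1 / q) = z + q := by
    have := eq_neg_sc_sub_inv z
    rw [one_div]; linear_combination -this
  have m0 : m i ≠ 0 := fun h => by have := hpos i; simp [h] at this
  have q0 : q ≠ 0 := sc_ne_zero z
  have e3 : m i - q = m i * q * (s - q) := by
    have e4 : s - q = 1 / q - 1 / m i := by linear_combination e2 - e1
    rw [e4]; field_simp
  have im_i : (m i).im = ‖m i‖ ^ 2 * (z.im + s.im) := by
    have := congrArg Complex.im e1
    rw [one_div, Complex.neg_im, Complex.inv_im, Complex.normSq_eq_norm_sq, Complex.add_im] at this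
    rw [← this]
    have : ‖m i‖ ≠ 0 := norm_ne_zero_iff.2 m0
    field_simp
  have im_q : q.im = ‖q‖ ^ 2 * (z.im + q.im) := by
    have := congrArg Complex.im e2
    rw [one_div, Complex.neg_im, Complex.inv_im, Complex.normSq_eq_norm_sq, Complex.add_im] at this
    rw [← this]
    have : ‖q‖ ≠ 0 := norm_ne_zero_iff.2 q0
    field_simp
  have key : ‖m i - q‖ ^ 2 = t * ((m i).im * q.im) := by
    have h := mul_pos (hpos i) hq0
    simp only [t, D]
    rw [div_mul_cancel₀ _ h.ne']
  have hmn : 0 < ‖m i‖ ^ 2 * ‖q‖ ^ 2 := by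
    have := norm_pos_iff.2 m0
    have := norm_pos_iff.2 q0
    positivity
  -- Invariance under u ↦ -1/u: the points z + s and z + q are at the same hyperbolic distance as `m
  -- i` and `q`.
  have h5 : ‖s - q‖ ^ 2 = t * ((z.im + s.im) * (z.im + q.im)) := by
    rw [e3, norm_mul, norm_mul, mul_pow, mul_pow] at key
    have h6 : (m i).im * q.im = ‖m i‖ ^ 2 * ‖q‖ ^ 2 * ((z.im + s.im) * (z.im + q.im)) := by
      calc (m i).im * q.im = (‖m i‖ ^ 2 * (z.im + s.im)) * (‖q‖ ^ 2 * (z.im + q.im)) := by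
            rw [← im_i, ← im_q]
        _ = _ := by ring
    rw [h6] at key
    have : ‖m i‖ ^ 2 * ‖q‖ ^ 2 * (‖s - q‖ ^ 2 - t * ((z.im + s.im) * (z.im + q.im))) = 0 := by
      linarith
    rcases mul_eq_zero.1 this with h | h
    · exact absurd h hmn.ne'
    · linarith
  -- The shift by z strictly enlarges both imaginary parts, so the contraction is strict and
  -- contradicts maximality.
  have h7 : t * (s.im * q.im) < t * ((z.im + s.im) * (z.im + q.im)) := by
    apply mul_lt_mul_of_pos_left _ hD
    nlinarith
  linarith

lemma qve_eq (hC₀ : 0 < C₀) (hS : IsVarianceProfile C₀ S) {z : ℂ} (hz : z.im ≠ 0) :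
    qve S z = fun _ => scExt z := by
  have key : ∀ w : ℂ, 0 < w.im → Classical.epsilon (SolvesQVE S w) = fun _ => sc w :=
    fun w hw => solvesQVE_unique hC₀ hS hw (Classical.epsilon_spec ⟨_, solvesQVE_const hS hw⟩)
  unfold qve scExt
  rcases lt_or_gt_of_ne hz with h | h
  · rw [if_neg h.not_gt, if_neg h.not_gt, key _ (by simpa using h)]
  · rw [if_pos h, if_pos h, key _ h]

lemma deriv_qve_eq (hC₀ : 0 < C₀) (hS : IsVarianceProfile C₀ S) {z : ℂ} (hz : z.im ≠ 0)
    (i : Fin N) : deriv (fun u => qve S u i) z = scExtDeriv z := by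
  refine ((hasDerivAt_scExt hz).congr_of_eventuallyEq ?_).deriv
  filter_upwards [(isOpen_ne.preimage Complex.continuous_im).mem_nhds hz] with u hu
  rw [qve_eq hC₀ hS hu]

/-! ### The spectral gap part -/

/-- `S` with the projection onto the constants removed. -/
noncomputable def centered (S : Matrix (Fin N) (Fin N) ℝ) : Matrix (Fin N) (Fin N) ℝ :=
  S - Matrix.of fun _ _ => (1 / N : ℝ)

lemma F_eq (hC₀ : 0 < C₀) (hS : IsVarianceProfile C₀ S) {z w : ℂ} (hz : z.im ≠ 0)
    (hw : w.im ≠ 0) : F S z w = (‖scExt z‖ * ‖scExt w‖) • S := by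
  ext i j
  simp only [F, qve_eq hC₀ hS hz, qve_eq hC₀ hS hw, Matrix.of_apply, Matrix.smul_apply, smul_eq_mul,
    norm_mul]
  rw [mul_right_comm, Real.mul_self_sqrt (by positivity)]

/-- The bound on other eigenvalues is a sup-norm estimate: evaluate the eigenvalue equation where
|v| is largest and use that the rows of `S` are nonnegative with sum 1. -/
lemma isPerronPair_smul (hN : 0 < N) (hC₀ : 0 < C₀) (hS : IsVarianceProfile C₀ S) {c : ℝ}
    (hc : 0 < c) : IsPerronPair (c • S) (c, fun _ => 1 / √N) := by
  have h0 : (0 : ℝ) < N := by exact_mod_cast hN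
  refine ⟨?_, fun i => by positivity, ?_, ?_⟩
  · ext i
    simp only [Matrix.mulVec, dotProduct, Matrix.smul_apply, smul_eq_mul, Pi.smul_apply]
    rw [← Finset.sum_mul, ← Finset.mul_sum, hS.row_sum, mul_one]
  · simp only [div_pow, one_pow, Real.sq_sqrt h0.le]
    simp [h0.ne']
  · intro μ hμ
    obtain ⟨v, hv⟩ := hμ.exists_hasEigenvector
    have hv1 := hv.apply_eq_smul
    have hv0 := hv.2
    obtain ⟨i₀, hi₀⟩ := Function.ne_iff.1 hv0
    obtain ⟨i, -, hi⟩ := Finset.exists_max_image Finset.univ (fun i => |v i|) ⟨i₀, Finset.mem_univ _⟩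
    have hvi : 0 < |v i| := lt_of_lt_of_le (abs_pos.2 hi₀) (hi i₀ (Finset.mem_univ _))
    have h1 : μ * v i = ∑ j, c * S i j * v j := by
      have := congrFun hv1 i
      simp [Matrix.mulVec, dotProduct] at this
      rw [← this, Finset.mul_sum]
      exact Finset.sum_congr rfl fun j _ => by ring
    have h2 : |μ| * |v i| ≤ c * |v i| := by
      rw [← abs_mul, h1]
      calc |∑ j, c * S i j * v j| ≤ ∑ j, |c * S i j * v j| := Finset.abs_sum_le_sum_abs _ _
        _ ≤ ∑ j, c * S i j * |v i| := by
          refine Finset.sum_le_sum fun j _ => ?_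
          have := hS.entry_nonneg hC₀ i j
          rw [abs_mul, abs_of_nonneg (by positivity)]
          exact mul_le_mul_of_nonneg_left (hi j (Finset.mem_univ _)) (by positivity)
        _ = c * |v i| := by rw [← Finset.sum_mul, ← Finset.mul_sum, hS.row_sum, mul_one]
    exact le_of_mul_le_mul_right h2 hvi

/-- Summing the eigenvalue equations, with column sums 1 by symmetry, identifies the eigenvalue
because ∑ v > 0. At a maximal entry of v the equation is then an average with strictly positive
weights, so v is constant. -/
lemma isPerronPair_smul_unique (hN : 0 < N) (hC₀ : 0 < C₀) (hS : IsVarianceProfile C₀ S) {c : ℝ}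
    (hc : 0 < c) {p : ℝ × (Fin N → ℝ)} (hp : IsPerronPair (c • S) p) :
    p = (c, fun _ => 1 / √N) := by
  obtain ⟨lam, v⟩ := p
  obtain ⟨h1, h2, h3, -⟩ := hp
  simp only at h1 h2 h3
  have h0 : (0 : ℝ) < N := by exact_mod_cast hN
  have hrow : ∀ i, ∑ j, c * S i j * v j = lam * v i := fun i => by
    have := congrFun h1 i
    simpa [Matrix.mulVec, dotProduct] using this
  have hlam : lam = c := by
    have h4 : ∑ i, ∑ j, c * S i j * v j = c * ∑ j, v j := by
      rw [Finset.sum_comm, Finset.mul_sum]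
      refine Finset.sum_congr rfl fun j _ => ?_
      rw [← Finset.sum_mul, ← Finset.mul_sum]
      have : ∑ i, S i j = 1 := by
        rw [← hS.row_sum j]
        exact Finset.sum_congr rfl fun i _ => by rw [← hS.symm.apply i j]
      rw [this, mul_one]
    simp only [hrow] at h4
    rw [← Finset.mul_sum] at h4
    refine mul_right_cancel₀ ?_ h4
    exact (Finset.sum_pos (fun i _ => h2 i) ⟨⟨0, hN⟩, Finset.mem_univ _⟩).ne'
  subst hlam
  obtain ⟨i, -, hi⟩ := Finset.exists_max_image Finset.univ v ⟨⟨0, hN⟩, Finset.mem_univ _⟩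
  have hconst : ∀ j, v j = v i := by
    have h5 : ∑ j, S i j * (v i - v j) = 0 := by
      have := hrow i
      simp only [mul_assoc, ← Finset.mul_sum] at this
      have := mul_left_cancel₀ hc.ne' this
      simp only [mul_sub, Finset.sum_sub_distrib, ← Finset.sum_mul, hS.row_sum, this]
      ring
    rw [Finset.sum_eq_zero_iff_of_nonneg fun j _ => mul_nonneg (hS.entry_nonneg hC₀ i j)
      (sub_nonneg.2 (hi j (Finset.mem_univ _)))] at h5
    intro j
    rcases mul_eq_zero.1 (h5 j (Finset.mem_univ _)) with h | h
    · exact absurd h (hS.entry_pos hN hC₀ i j).ne'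
    · linarith
  have h6 : v i = 1 / √N := by
    have h7 : (N : ℝ) * v i ^ 2 = 1 := by
      rw [← h3]; simp [hconst]
    rw [eq_div_iff (by positivity)]
    have h8 : (v i * √N) ^ 2 = 1 := by
      rw [mul_pow, Real.sq_sqrt h0.le]; linarith
    exact (pow_eq_one_iff_of_nonneg (mul_nonneg (h2 i).le (Real.sqrt_nonneg _)) two_ne_zero).1 h8
  ext j
  · rfl
  · simp only; rw [hconst j, h6]

lemma gapPart_eq (hN : 0 < N) (hC₀ : 0 < C₀) (hS : IsVarianceProfile C₀ S) {z w : ℂ}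
    (hz : z.im ≠ 0) (hw : w.im ≠ 0) :
    gapPart S z w = (‖scExt z‖ * ‖scExt w‖) • centered S := by
  have h0 : (0 : ℝ) < N := by exact_mod_cast hN
  have hc : 0 < ‖scExt z‖ * ‖scExt w‖ :=
    mul_pos (norm_pos_iff.2 (scExt_ne_zero z)) (norm_pos_iff.2 (scExt_ne_zero w))
  have hp : perronPair (F S z w) = (‖scExt z‖ * ‖scExt w‖, fun _ => 1 / √N) := by
    rw [F_eq hC₀ hS hz hw]
    exact isPerronPair_smul_unique hN hC₀ hS hc
      (Classical.epsilon_spec ⟨_, isPerronPair_smul hN hC₀ hS hc⟩)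
  unfold gapPart
  rw [hp, F_eq hC₀ hS hz hw]
  ext i j
  have : (1 / √(N : ℝ)) * (1 / √N) = 1 / N := by
    rw [div_mul_div_comm, Real.mul_self_sqrt h0.le, one_mul]
  simp only [centered, Matrix.sub_apply, Matrix.smul_apply, smul_eq_mul, Matrix.vecMulVec_apply,
    Matrix.of_apply, this, mul_sub]

/-- The prefactor |m(z)||m(w)| depends only on real parts and on |Im|, so it extends continuously
across the axis from all sides, with value 1 on the spectrum. -/
lemma tendsto_gapPart (hN : 0 < N) (hC₀ : 0 < C₀) (hS : IsVarianceProfile C₀ S) {x y : ℝ}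
    (hx : x ∈ Set.Icc (-2 : ℝ) 2) (hy : y ∈ Set.Icc (-2 : ℝ) 2) :
    Tendsto (fun p : ℂ × ℂ => gapPart S p.1 p.2)
      (𝓝[{p : ℂ × ℂ | p.1.im ≠ 0 ∧ p.2.im ≠ 0}] ((x : ℂ), (y : ℂ))) (𝓝 (centered S)) := by
  have hcont : Continuous fun z : ℂ => ‖sc (z.re + (|z.im| : ℝ) * Complex.I)‖ :=
    (continuous_sc_comp (by fun_prop) (by intro z; simp)).norm
  have h1 : Tendsto (fun p : ℂ × ℂ => (‖sc (p.1.re + (|p.1.im| : ℝ) * Complex.I)‖ *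
      ‖sc (p.2.re + (|p.2.im| : ℝ) * Complex.I)‖) • centered S) (𝓝 ((x : ℂ), (y : ℂ)))
      (𝓝 ((1 * 1 : ℝ) • centered S)) := by
    have h2 : Continuous fun p : ℂ × ℂ => (‖sc (p.1.re + (|p.1.im| : ℝ) * Complex.I)‖ *
      ‖sc (p.2.re + (|p.2.im| : ℝ) * Complex.I)‖) • centered S :=
      ((hcont.comp continuous_fst).mul (hcont.comp continuous_snd)).smul continuous_const
    have := h2.tendsto ((x : ℂ), (y : ℂ))
    simpa [norm_sc_ofReal hx, norm_sc_ofReal hy] using this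
  rw [one_mul, one_smul] at h1
  refine (h1.mono_left nhdsWithin_le_nhds).congr' ?_
  filter_upwards [self_mem_nhdsWithin] with p hp
  rw [gapPart_eq hN hC₀ hS hp.1 hp.2, norm_scExt_eq hp.1, norm_scExt_eq hp.2]

end

/-! ### Spectral decomposition of the kernel `g` -/

/-- The trace of `R (A + P) R`, for the resolvent `R` of a diagonalizable matrix `A` perturbed by a
complementary projection `P`. -/
lemma trace_resolvent {n : Type*} [Fintype n] [DecidableEq n] {A P V W : Matrix n n ℂ}
    {μ : n → ℂ} (hVW : V * W = 1) (hWV : W * V = 1) (hA : A = V * Matrix.diagonal μ * W)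
    (hAP : A * P = 0) (hPA : P * A = 0) (hPP : P * P = P) {u : ℂ} (hu : 1 - u ≠ 0)
    (huμ : ∀ k, 1 - u * μ k ≠ 0) :
    ((1 - u • (A + P))⁻¹ * (A + P) * (1 - u • (A + P))⁻¹).trace
      = P.trace / (1 - u) ^ 2 + ∑ k, μ k / (1 - u * μ k) ^ 2 := by
  set E : Matrix n n ℂ := Matrix.diagonal fun k => (1 - u * μ k)⁻¹ with hE
  set B : Matrix n n ℂ := V * E * W with hB
  have h1 : 1 - u • A = V * (1 - u • Matrix.diagonal μ) * W := by
    rw [hA, mul_sub, sub_mul, mul_one, hVW]; simp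
  have hD1 : (1 - u • Matrix.diagonal μ) * E = 1 := by
    rw [← Matrix.diagonal_one, ← Matrix.diagonal_smul, Matrix.diagonal_sub, hE,
      Matrix.diagonal_mul_diagonal]
    congr 1
    funext k
    exact mul_inv_cancel₀ (huμ k)
  have hD2 : E * (1 - u • Matrix.diagonal μ) = 1 := by
    rw [← Matrix.diagonal_one, ← Matrix.diagonal_smul, Matrix.diagonal_sub, hE,
      Matrix.diagonal_mul_diagonal]
    congr 1
    funext k
    exact inv_mul_cancel₀ (huμ k)
  have hAB : (1 - u • A) * B = 1 := by
    rw [h1, hB]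
    calc V * (1 - u • Matrix.diagonal μ) * W * (V * E * W)
        = V * ((1 - u • Matrix.diagonal μ) * ((W * V) * (E * W))) := by simp only [mul_assoc]
      _ = V * (((1 - u • Matrix.diagonal μ) * E) * W) := by rw [hWV]; simp only [mul_assoc, one_mul]
      _ = 1 := by rw [hD1, one_mul, hVW]
  have hBA : B * (1 - u • A) = 1 := by
    rw [h1, hB]
    calc V * E * W * (V * (1 - u • Matrix.diagonal μ) * W)
        = V * (E * ((W * V) * ((1 - u • Matrix.diagonal μ) * W))) := by simp only [mul_assoc]
      _ = V * ((E * (1 - u • Matrix.diagonal μ)) * W) := by rw [hWV]; simp only [mul_assoc, one_mul]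
      _ = 1 := by rw [hD2, one_mul, hVW]
  have hPB : P * B = P := by
    have : P * (1 - u • A) = P := by rw [mul_sub, mul_one, mul_smul_comm, hPA]; simp
    calc P * B = P * (1 - u • A) * B := by rw [this]
      _ = P := by rw [mul_assoc, hAB, mul_one]
  have hBP : B * P = P := by
    have : (1 - u • A) * P = P := by rw [sub_mul, one_mul, smul_mul_assoc, hAP]; simp
    calc B * P = B * ((1 - u • A) * P) := by rw [this]
      _ = P := by rw [← mul_assoc, hBA, one_mul]
  -- Chosen so that (1 - u)(1 + c) = 1: on the range of P the resolvent is 1 + c, and B already acts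
  -- there as the identity.
  set c : ℂ := u / (1 - u) with hc
  have hc1 : c - u - u * c = 0 := by rw [hc]; field_simp; ring
  have hc2 : 1 + c = 1 / (1 - u) := by rw [hc]; field_simp; ring
  have hR : (1 - u • (A + P))⁻¹ = B + c • P := by
    apply Matrix.inv_eq_right_inv
    have h2 : 1 - u • (A + P) = (1 - u • A) - u • P := by rw [smul_add]; abel
    rw [h2, sub_mul, mul_add, hAB]
    have h3 : (1 - u • A) * c • P = c • P := by
      rw [mul_smul_comm, sub_mul, one_mul, smul_mul_assoc, hAP]; simp
    have h4 : u • P * (B + c • P) = (u + u * c) • P := by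
      rw [smul_mul_assoc, mul_add, hPB, mul_smul_comm, hPP]
      module
    rw [h3, h4, add_sub_assoc, ← sub_smul]
    have : c - (u + u * c) = 0 := by linear_combination hc1
    rw [this, zero_smul, add_zero]
  have hprod : (B + c • P) * (A + P) * (B + c • P) = B * A * B + ((1 + c) ^ 2) • P := by
    have h5 : (B + c • P) * (A + P) = B * A + (1 + c) • P := by
      rw [add_mul, mul_add, mul_add, hBP, smul_mul_assoc, smul_mul_assoc, hPA, hPP, add_smul,
        one_smul]
      simp [add_assoc]
    have h6 : B * A * P = 0 := by rw [mul_assoc, hAP, mul_zero]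
    rw [h5, add_mul, mul_add, mul_smul_comm, h6, smul_mul_assoc, mul_add, hPB, mul_smul_comm, hPP]
    rw [smul_zero, add_zero]
    congr 1
    module
  have htr : (B * A * B).trace = ∑ k, μ k / (1 - u * μ k) ^ 2 := by
    have : B * A * B = V * (E * Matrix.diagonal μ * E) * W := by
      rw [hB, hA]
      calc V * E * W * (V * Matrix.diagonal μ * W) * (V * E * W)
          = V * (E * ((W * V) * (Matrix.diagonal μ * ((W * V) * (E * W))))) := by
            simp only [mul_assoc]
        _ = _ := by rw [hWV]; simp only [mul_assoc, one_mul]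
    rw [this, Matrix.trace_mul_cycle, hWV, one_mul, hE, Matrix.diagonal_mul_diagonal,
      Matrix.diagonal_mul_diagonal, Matrix.trace_diagonal]
    refine Finset.sum_congr rfl fun k _ => ?_
    have := huμ k
    field_simp
  rw [hR, hprod, Matrix.trace_add, htr, Matrix.trace_smul, hc2, smul_eq_mul, div_pow, one_pow,
    add_comm, div_mul_eq_mul_div, one_mul, add_comm]

/-! ### Size and spectral gap of the centered profile -/

section

variable {N : ℕ} {C₀ : ℝ} {S : Matrix (Fin N) (Fin N) ℝ}

lemma centered_symm (hS : IsVarianceProfile C₀ S) (i j : Fin N) :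
    centered S i j = centered S j i := by
  simp [centered, hS.symm.apply i j]

lemma centered_row_sum (hN : 0 < N) (hS : IsVarianceProfile C₀ S) (i : Fin N) :
    ∑ j, centered S i j = 0 := by
  have h0 : (N : ℝ) ≠ 0 := by exact_mod_cast hN.ne'
  simp [centered, Finset.sum_sub_distrib, hS.row_sum, h0]

lemma abs_centered_le (hN : 0 < N) (hC₀ : 0 < C₀) (hS : IsVarianceProfile C₀ S) (i j : Fin N) :
    |centered S i j| ≤ C₀ / N := by
  have h0 : (0 : ℝ) < N := by exact_mod_cast hN
  have h1 : (1 : ℝ) / N ≤ C₀ / N := by gcongr; exact hS.one_le hN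
  have h2 := hS.upper i j
  have h3 := hS.entry_nonneg hC₀ i j
  have h4 : (0 : ℝ) ≤ 1 / N := by positivity
  simp only [centered, Matrix.sub_apply, Matrix.of_apply]
  rw [abs_le]; constructor <;> linarith

lemma sum_centered_sq_le (hN : 0 < N) (hC₀ : 0 < C₀) (hS : IsVarianceProfile C₀ S) :
    ∑ i, ∑ j, centered S i j ^ 2 ≤ C₀ ^ 2 := by
  have h0 : (0 : ℝ) < N := by exact_mod_cast hN
  calc ∑ i, ∑ j, centered S i j ^ 2 ≤ ∑ _i : Fin N, ∑ _j : Fin N, (C₀ / N) ^ 2 := by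
        refine Finset.sum_le_sum fun i _ => Finset.sum_le_sum fun j _ => ?_
        rw [← sq_abs]
        exact pow_le_pow_left₀ (abs_nonneg _) (abs_centered_le hN hC₀ hS i j) 2
    _ = C₀ ^ 2 := by simp; field_simp

lemma abs_trace_centered_le (hN : 0 < N) (hC₀ : 0 < C₀) (hS : IsVarianceProfile C₀ S) :
    |∑ i, centered S i i| ≤ C₀ := by
  have h0 : (0 : ℝ) < N := by exact_mod_cast hN
  calc |∑ i, centered S i i| ≤ ∑ i, |centered S i i| := Finset.abs_sum_le_sum_abs _ _
    _ ≤ ∑ _i : Fin N, C₀ / N := Finset.sum_le_sum fun i _ => abs_centered_le hN hC₀ hS i i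
    _ = C₀ := by simp; field_simp

/-- An eigenvector for a nonzero eigenvalue has entries summing to zero, so constant matrices may be
added freely. Replacing A by S - 1/(C₀N), which is entrywise nonnegative with row sums 1 - 1/C₀, the
sup-norm bound gives the gap. -/
lemma abs_eigenvalue_centered_le (hN : 0 < N) (hC₀ : 0 < C₀) (hS : IsVarianceProfile C₀ S)
    {lam : ℝ} {v : Fin N → ℂ} (hv : v ≠ 0)
    (h : ∀ i, ∑ j, (centered S i j : ℂ) * v j = lam * v i) : |lam| ≤ 1 - 1 / C₀ := by
  have h0 : (0 : ℝ) < N := by exact_mod_cast hN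
  have hC1 := hS.one_le hN
  have hgap : 0 ≤ 1 - 1 / C₀ := by
    rw [sub_nonneg, div_le_one hC₀]; exact hC1
  by_cases hl : lam = 0
  · simpa [hl] using hgap
  have hsum : ∑ j, v j = 0 := by
    have h1 : ∑ i, ∑ j, (centered S i j : ℂ) * v j = 0 := by
      rw [Finset.sum_comm]
      refine Finset.sum_eq_zero fun j _ => ?_
      rw [← Finset.sum_mul]
      have : ∑ i, (centered S i j : ℂ) = 0 := by
        have := centered_row_sum hN hS j
        simp only [centered_symm hS j] at this
        exact_mod_cast this
      rw [this, zero_mul]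
    simp only [h, ← Finset.mul_sum] at h1
    exact (mul_eq_zero.1 h1).resolve_left (by exact_mod_cast hl)
  obtain ⟨i₀, hi₀⟩ := Function.ne_iff.1 hv
  obtain ⟨i, -, hi⟩ := Finset.exists_max_image Finset.univ (fun i => ‖v i‖) ⟨i₀, Finset.mem_univ _⟩
  have hvi : 0 < ‖v i‖ := lt_of_lt_of_le (norm_pos_iff.2 hi₀) (hi i₀ (Finset.mem_univ _))
  -- Adding the constant 1/N - 1/(C₀N) to every entry changes nothing, since ∑ v = 0.
  have h2 : (lam : ℂ) * v i = ∑ j, ((S i j - 1 / (C₀ * N) : ℝ) : ℂ) * v j := by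
    rw [← h i]
    have : ∀ j, ((S i j - 1 / (C₀ * N) : ℝ) : ℂ) * v j
        = (centered S i j : ℂ) * v j + ((1 / N - 1 / (C₀ * N) : ℝ) : ℂ) * v j := by
      intro j
      simp only [centered, Matrix.sub_apply, Matrix.of_apply]
      push_cast; ring
    simp only [this, Finset.sum_add_distrib, ← Finset.mul_sum, hsum, mul_zero, add_zero]
  have h3 : |lam| * ‖v i‖ ≤ (1 - 1 / C₀) * ‖v i‖ := by
    have h4 : |lam| * ‖v i‖ = ‖(lam : ℂ) * v i‖ := by rw [norm_mul, Complex.norm_real]; rfl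
    rw [h4, h2]
    calc ‖∑ j, ((S i j - 1 / (C₀ * N) : ℝ) : ℂ) * v j‖
        ≤ ∑ j, (S i j - 1 / (C₀ * N)) * ‖v i‖ := by
          refine (norm_sum_le _ _).trans (Finset.sum_le_sum fun j _ => ?_)
          have := sub_nonneg.2 (hS.lower i j)
          rw [norm_mul, Complex.norm_real, Real.norm_of_nonneg this]
          exact mul_le_mul_of_nonneg_left (hi j (Finset.mem_univ _)) this
      _ = (1 - 1 / C₀) * ‖v i‖ := by
          rw [← Finset.sum_mul, Finset.sum_sub_distrib, hS.row_sum]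
          congr 2
          simp; field_simp
  exact le_of_mul_le_mul_right h3 hvi

/-- The kernel `g` in terms of the eigenvalues `μ` of the centered variance profile. -/
lemma exists_eigenvalues_g_eq (hN : 0 < N) (hC₀ : 0 < C₀) (hS : IsVarianceProfile C₀ S) :
    ∃ μ : Fin N → ℝ, (∀ k, |μ k| ≤ 1 - 1 / C₀) ∧ ∑ k, μ k = ∑ i, centered S i i ∧
      ∑ k, μ k ^ 2 = ∑ i, ∑ j, centered S i j ^ 2 ∧
      ∀ z w : ℂ, z.im ≠ 0 → w.im ≠ 0 → g S z w = scExtDeriv z * scExtDeriv w *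
        (1 / (1 - scExt z * scExt w) ^ 2
          + ∑ k, (μ k : ℂ) / (1 - scExt z * scExt w * μ k) ^ 2) := by
  have h0 : (N : ℂ) ≠ 0 := by exact_mod_cast hN.ne'
  set A : Matrix (Fin N) (Fin N) ℂ := (centered S).map (fun t : ℝ => (t : ℂ)) with hA
  set P : Matrix (Fin N) (Fin N) ℂ := Matrix.of fun _ _ => (1 / N : ℂ) with hP
  have hH : A.IsHermitian := by
    ext i j
    simp [hA, Matrix.conjTranspose_apply, centered_symm hS j i]
  set V : Matrix (Fin N) (Fin N) ℂ := hH.eigenvectorUnitary.1 with hV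
  set W : Matrix (Fin N) (Fin N) ℂ := star V with hW
  have hVW : V * W = 1 := Unitary.coe_mul_star_self hH.eigenvectorUnitary
  have hWV : W * V = 1 := Unitary.coe_star_mul_self hH.eigenvectorUnitary
  have hAd : A = V * Matrix.diagonal (fun k => (hH.eigenvalues k : ℂ)) * W := by
    conv_lhs => rw [hH.spectral_theorem, Unitary.conjStarAlgAut_apply]
    rfl
  have hrowA : ∀ i, ∑ j, A i j = 0 := fun i => by
    have := centered_row_sum hN hS i
    simp only [hA, Matrix.map_apply]
    exact_mod_cast this
  have hcolA : ∀ j, ∑ i, A i j = 0 := fun j => by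
    rw [← hrowA j]
    refine Finset.sum_congr rfl fun i _ => ?_
    simp only [hA, Matrix.map_apply]
    rw [centered_symm hS]
  have hAP : A * P = 0 := by
    ext i j
    simp only [Matrix.mul_apply, hP, Matrix.of_apply, ← Finset.sum_mul, hrowA]; simp
  have hPA : P * A = 0 := by
    ext i j
    simp only [Matrix.mul_apply, hP, Matrix.of_apply, ← Finset.mul_sum, hcolA]; simp
  have hPP : P * P = P := by
    ext i j
    simp [Matrix.mul_apply, hP]; field_simp
  have htrP : P.trace = 1 := by simp [Matrix.trace, hP, h0]
  have hSc : S.map (fun t : ℝ => (t : ℂ)) = A + P := by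
    ext i j
    simp [hA, hP, centered]
  refine ⟨hH.eigenvalues, fun k => ?_, ?_, ?_, fun z w hz hw => ?_⟩
  · refine abs_eigenvalue_centered_le hN hC₀ hS (v := ⇑(hH.eigenvectorBasis k)) ?_ fun i => ?_
    · intro h
      have h1 := hH.eigenvectorBasis.orthonormal.ne_zero k
      apply h1
      ext i
      exact congrFun h i
    · have := congrFun (hH.mulVec_eigenvectorBasis k) i
      simpa [Matrix.mulVec, dotProduct, hA] using this
  · have h1 := hH.trace_eq_sum_eigenvalues
    have h2 : A.trace = ((∑ i, centered S i i : ℝ) : ℂ) := by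
      simp [Matrix.trace, hA]
    rw [h2] at h1
    apply Complex.ofReal_injective
    rw [h1]
    push_cast
    rfl
  · have h1 : (A * A).trace = ((∑ i, ∑ j, centered S i j ^ 2 : ℝ) : ℂ) := by
      simp only [Matrix.trace, Matrix.diag_apply, Matrix.mul_apply, hA, Matrix.map_apply]
      push_cast
      refine Finset.sum_congr rfl fun i _ => Finset.sum_congr rfl fun j _ => ?_
      rw [centered_symm hS j i, pow_two]
    have h2 : (A * A).trace = ((∑ k, hH.eigenvalues k ^ 2 : ℝ) : ℂ) := by
      have : A * A = V * (Matrix.diagonal (fun k => (hH.eigenvalues k : ℂ)) *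
          Matrix.diagonal (fun k => (hH.eigenvalues k : ℂ))) * W := by
        conv_lhs => rw [hAd]
        calc V * Matrix.diagonal (fun k => (hH.eigenvalues k : ℂ)) * W *
              (V * Matrix.diagonal (fun k => (hH.eigenvalues k : ℂ)) * W)
            = V * (Matrix.diagonal (fun k => (hH.eigenvalues k : ℂ)) * ((W * V) *
              (Matrix.diagonal (fun k => (hH.eigenvalues k : ℂ)) * W))) := by
                simp only [mul_assoc]
          _ = _ := by rw [hWV]; simp only [mul_assoc, one_mul]
      rw [this, Matrix.trace_mul_cycle, hWV, one_mul, Matrix.diagonal_mul_diagonal,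
        Matrix.trace_diagonal]
      push_cast
      exact Finset.sum_congr rfl fun k _ => by ring
    rw [h1] at h2
    exact_mod_cast h2.symm
  · have hgap : ∀ k, |hH.eigenvalues k| ≤ 1 := fun k => by
      have : |hH.eigenvalues k| ≤ 1 - 1 / C₀ := by
        refine abs_eigenvalue_centered_le hN hC₀ hS (v := ⇑(hH.eigenvectorBasis k)) ?_ fun i => ?_
        · intro h
          have h1 := hH.eigenvectorBasis.orthonormal.ne_zero k
          apply h1
          ext i
          exact congrFun h i
        · have := congrFun (hH.mulVec_eigenvectorBasis k) i
          simpa [Matrix.mulVec, dotProduct, hA] using this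
      have : 0 ≤ 1 / C₀ := by positivity
      linarith
    set u : ℂ := scExt z * scExt w with hu
    have hu1 : ‖u‖ < 1 := by
      rw [hu, norm_mul]
      have := norm_scExt_lt_one hz
      have := norm_scExt_lt_one hw
      nlinarith [norm_nonneg (scExt z), norm_nonneg (scExt w)]
    have hne : ∀ a : ℂ, ‖a‖ ≤ 1 → 1 - u * a ≠ 0 := fun a ha h => by
      have h1 : u * a = 1 := by linear_combination -h
      have h2 := congrArg norm h1
      rw [norm_mul, norm_one] at h2
      nlinarith [norm_nonneg a, norm_nonneg u]
    -- Off the real axis |u| < 1 and all |μ_k| ≤ 1, so no denominator vanishes.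
    have htr := trace_resolvent hVW hWV hAd hAP hPA hPP (u := u) (by simpa using hne 1 (by simp))
      (fun k => hne _ (by rw [Complex.norm_real]; exact hgap k))
    rw [htrP] at htr
    rw [← htr]
    have hd : ∀ a : ℂ, (Matrix.diagonal fun _ => a : Matrix (Fin N) (Fin N) ℂ) = a • 1 :=
      fun a => (Matrix.smul_one_eq_diagonal a).symm
    have hinv : ((Matrix.diagonal fun _ => scExt z : Matrix (Fin N) (Fin N) ℂ))⁻¹
        = (scExt z)⁻¹ • 1 := by
      apply Matrix.inv_eq_right_inv
      rw [hd, smul_mul_smul_comm, mul_inv_cancel₀ (scExt_ne_zero z)]; simp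
    unfold g qveDiag qveDiagDeriv
    simp only [deriv_qve_eq hC₀ hS hz, deriv_qve_eq hC₀ hS hw, qve_eq hC₀ hS hz, qve_eq hC₀ hS hw,
      hSc, hinv]
    simp only [hd]
    have hR : (1 : Matrix (Fin N) (Fin N) ℂ) - (A + P) * scExt z • 1 * scExt w • 1
        = 1 - u • (A + P) := by
      simp [hu, smul_smul, mul_comm]
    rw [hR]
    simp only [smul_mul_assoc, mul_smul_comm, one_mul, mul_one, Matrix.trace_smul, smul_eq_mul]
    have := scExt_ne_zero z
    field_simp

end

/-! ### Powers of `sc` -/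

/-- The positive power `m(z)^(n+1)`. -/
noncomputable def scPow (n : ℕ) (z : ℂ) : ℂ := sc z ^ (n + 1)

/-- The derivative of `m(z)^(n+1)` in the upper half-plane. -/
noncomputable def scPowDeriv (n : ℕ) (z : ℂ) : ℂ := (n + 1) * sc z ^ n * scDeriv z

lemma hasDerivAt_scPow (n : ℕ) {z : ℂ} (hz : 0 < z.im) :
    HasDerivAt (scPow n) (scPowDeriv n z) z := by
  have : HasDerivAt (fun u => sc u ^ (n + 1)) (((n + 1 : ℕ) : ℂ) * sc z ^ n * scDeriv z) z :=
    (hasDerivAt_sc hz).pow (n + 1)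
  exact this.congr_deriv (by simp [scPowDeriv])

lemma norm_scPow_le (n : ℕ) {z : ℂ} (hz : 0 ≤ z.im) : ‖scPow n z‖ ≤ 1 := by
  rw [scPow, norm_pow]
  exact pow_le_one₀ (norm_nonneg _) (norm_sc_le_one hz)

lemma norm_scPowDeriv (n : ℕ) (z : ℂ) :
    ‖scPowDeriv n z‖ = (n + 1) * ‖sc z‖ ^ n * ‖scDeriv z‖ := by
  rw [scPowDeriv, norm_mul, norm_mul, norm_pow]
  congr 2
  exact_mod_cast Complex.norm_natCast (n + 1)

lemma norm_scPowDeriv_le (n : ℕ) {z : ℂ} (hz : 0 < z.im) :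
    ‖scPowDeriv n z‖ ≤ (n + 1) * (1 / √(2 * z.im)) := by
  rw [norm_scPowDeriv]
  have h1 := norm_scDeriv_le hz
  have h2 : ‖sc z‖ ^ n ≤ 1 := pow_le_one₀ (norm_nonneg _) (norm_sc_lt_one hz).le
  calc (n + 1 : ℝ) * ‖sc z‖ ^ n * ‖scDeriv z‖ ≤ (n + 1) * 1 * (1 / √(2 * z.im)) := by gcongr
    _ = _ := by ring

lemma continuous_scDeriv_comp {X : Type*} [TopologicalSpace X] {φ : X → ℂ} (hφ : Continuous φ)
    (h0 : ∀ x, 0 < (φ x).im) : Continuous fun x => scDeriv (φ x) := by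
  unfold scDeriv
  have := continuous_sc_comp hφ fun x => (h0 x).le
  exact (this.pow 2).div (continuous_const.sub (this.pow 2)) fun x => one_sub_sc_sq_ne_zero (h0 x)

lemma continuous_scPow_comp (n : ℕ) {X : Type*} [TopologicalSpace X] {φ : X → ℂ}
    (hφ : Continuous φ) (h0 : ∀ x, 0 ≤ (φ x).im) : Continuous fun x => scPow n (φ x) :=
  (continuous_sc_comp hφ h0).pow _

lemma continuous_scPowDeriv_comp (n : ℕ) {X : Type*} [TopologicalSpace X] {φ : X → ℂ}
    (hφ : Continuous φ) (h0 : ∀ x, 0 < (φ x).im) : Continuous fun x => scPowDeriv n (φ x) :=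
  ((continuous_const.mul ((continuous_sc_comp hφ fun x => (h0 x).le).pow n))).mul
    (continuous_scDeriv_comp hφ h0)

lemma continuousOn_scPowDeriv (n : ℕ) : ContinuousOn (scPowDeriv n) {z | 0 < z.im} := by
  rw [continuousOn_iff_continuous_domRestrict]
  exact continuous_scPowDeriv_comp n continuous_subtype_val fun z => z.2

/-- The point `x + i y`. -/
noncomputable def pt (x y : ℝ) : ℂ := x + y * Complex.I

@[simp] lemma pt_re (x y : ℝ) : (pt x y).re = x := by simp [pt]

@[simp] lemma pt_im (x y : ℝ) : (pt x y).im = y := by simp [pt]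

@[simp] lemma pt_zero (x : ℝ) : pt x 0 = x := by simp [pt]

@[fun_prop] lemma continuous_pt {X : Type*} [TopologicalSpace X] {a b : X → ℝ} (ha : Continuous a)
    (hb : Continuous b) : Continuous fun t => pt (a t) (b t) := by
  unfold pt; fun_prop

lemma hasDerivAt_pt_left (x y : ℝ) : HasDerivAt (fun t => pt t y) 1 x := by
  unfold pt
  exact (hasDerivAt_id x).ofReal_comp.add_const _

lemma hasDerivAt_pt_right (x y : ℝ) : HasDerivAt (fun t => pt x t) Complex.I y := by
  unfold pt
  have := ((hasDerivAt_id y).ofReal_comp.mul_const Complex.I).const_add (x : ℂ)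
  simpa using this

lemma hasDerivAt_scPow_left (n : ℕ) (x : ℝ) {y : ℝ} (hy : 0 < y) :
    HasDerivAt (fun t => scPow n (pt t y)) (scPowDeriv n (pt x y)) x := by
  have := (hasDerivAt_scPow n (z := pt x y) (by simpa using hy)).comp_of_eq x
    (hasDerivAt_pt_left x y) rfl
  rw [mul_one] at this
  exact this

lemma hasDerivAt_scPow_right (n : ℕ) (x : ℝ) {y : ℝ} (hy : 0 < y) :
    HasDerivAt (fun t => scPow n (pt x t)) (scPowDeriv n (pt x y) * Complex.I) y := by
  have := (hasDerivAt_scPow n (z := pt x y) (by simpa using hy)).comp_of_eq y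
    (hasDerivAt_pt_right x y) rfl
  exact this

/-! ### Horizontal integrals against powers of `sc` -/

/-- `∫ a(x) m(x + i y)^(n+1) dx`. -/
noncomputable def horiz (a : ℝ → ℝ) (n : ℕ) (y : ℝ) : ℂ := ∫ x, (a x : ℂ) * scPow n (pt x y)

/-- `∫ a(x) (m^(n+1))'(x + i y) dx`. -/
noncomputable def horizDeriv (a : ℝ → ℝ) (n : ℕ) (y : ℝ) : ℂ :=
  ∫ x, (a x : ℂ) * scPowDeriv n (pt x y)

lemma integrable_mul_scPow {a : ℝ → ℝ} (ha : Integrable a) (n : ℕ) {y : ℝ} (hy : 0 ≤ y) :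
    Integrable fun x => (a x : ℂ) * scPow n (pt x y) :=
  ha.ofReal.mul_bdd (c := 1)
    (continuous_scPow_comp n (by fun_prop) fun x => by simpa using hy).aestronglyMeasurable
    (ae_of_all _ fun x => norm_scPow_le n (by simpa using hy))

lemma integrable_mul_scPowDeriv {a : ℝ → ℝ} (ha : Integrable a) (n : ℕ) {y : ℝ} (hy : 0 < y) :
    Integrable fun x => (a x : ℂ) * scPowDeriv n (pt x y) :=
  ha.ofReal.mul_bdd (c := (n + 1) * (1 / √(2 * y)))
    (continuous_scPowDeriv_comp n (by fun_prop) fun x => by simpa using hy).aestronglyMeasurable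
    (ae_of_all _ fun x => by
      simpa using norm_scPowDeriv_le n (z := pt x y) (by simpa using hy))

lemma continuousOn_horiz {a : ℝ → ℝ} (ha : Integrable a) (n : ℕ) :
    ContinuousOn (horiz a n) (Set.Ici 0) := by
  -- Replacing y by |y| keeps the point in the closed upper half-plane for every real y, so
  -- dominated convergence applies on the whole line.
  have h : Continuous fun y : ℝ => horiz a n |y| := by
    refine continuous_of_dominated (bound := fun x => ‖a x‖) ?_ ?_ ha.norm ?_
    · exact fun y => (integrable_mul_scPow ha n (abs_nonneg y)).aestronglyMeasurable
    · refine fun y => ae_of_all _ fun x => ?_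
      rw [norm_mul, Complex.norm_real]
      exact mul_le_of_le_one_right (norm_nonneg _) (norm_scPow_le n (by simp))
    · refine ae_of_all _ fun x => continuous_const.mul (continuous_scPow_comp n (by fun_prop) ?_)
      simp
  refine h.continuousOn.congr fun y hy => ?_
  simp only [abs_of_nonneg (show (0 : ℝ) ≤ y from hy)]

/-- Differentiation under the integral, on the neighbourhood t > y/2, where the derivative of the
power is at most (n+1)/√y. -/
lemma hasDerivAt_horiz {a : ℝ → ℝ} (ha : Integrable a) (n : ℕ) {y : ℝ} (hy : 0 < y) :
    HasDerivAt (horiz a n) (Complex.I * horizDeriv a n y) y := by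
  have h := hasDerivAt_integral_of_dominated_loc_of_deriv_le (μ := volume)
    (F := fun (y : ℝ) (x : ℝ) => (a x : ℂ) * scPow n (pt x y))
    (F' := fun (y : ℝ) (x : ℝ) => (a x : ℂ) * (scPowDeriv n (pt x y) * Complex.I))
    (bound := fun x => ‖a x‖ * ((n + 1) * (1 / √y))) (x₀ := y) (s := Set.Ioi (y / 2))
    (Ioi_mem_nhds (by linarith)) ?_ (integrable_mul_scPow ha n hy.le) ?_ ?_ ?_ ?_
  · have h2 := h.2
    rw [show (∫ x, (a x : ℂ) * (scPowDeriv n (pt x y) * Complex.I))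
      = Complex.I * horizDeriv a n y from ?_] at h2
    · exact h2
    · rw [horizDeriv, ← integral_const_mul]
      congr 1; funext x; ring
  · filter_upwards [Ioi_mem_nhds hy] with t ht
    exact (integrable_mul_scPow ha n (le_of_lt ht)).aestronglyMeasurable
  · simp only [← mul_assoc]
    exact (integrable_mul_scPowDeriv ha n hy).aestronglyMeasurable.mul_const _
  · refine ae_of_all _ fun x t ht => ?_
    have ht : y / 2 < t := ht
    have ht0 : 0 < t := by linarith
    rw [norm_mul, norm_mul, Complex.norm_I, mul_one, Complex.norm_real]
    have h3 := norm_scPowDeriv_le n (z := pt x t) (by simpa using ht0)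
    rw [pt_im] at h3
    have : √y ≤ √(2 * t) := Real.sqrt_le_sqrt (by linarith)
    have hy' : 0 < √y := Real.sqrt_pos.2 hy
    have : (n + 1 : ℝ) * (1 / √(2 * t)) ≤ (n + 1) * (1 / √y) := by gcongr
    gcongr
    linarith
  · exact ha.norm.mul_const _
  · refine ae_of_all _ fun x t ht => ?_
    have ht : y / 2 < t := ht
    exact (hasDerivAt_scPow_right n x (by linarith)).const_mul _

/-- Integration by parts on the whole line; integrability of the product and of both terms makes the
boundary contributions vanish. -/
lemma horizDeriv_eq_neg_horiz {a b : ℝ → ℝ} (hab : ∀ x, HasDerivAt a (b x) x) (ha : Integrable a)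
    (hb : Integrable b) (n : ℕ) {y : ℝ} (hy : 0 < y) : horizDeriv a n y = -horiz b n y :=
  integral_mul_deriv_eq_deriv_mul_of_integrable
    (u := fun x => (a x : ℂ)) (u' := fun x => (b x : ℂ)) (v := fun x => scPow n (pt x y))
    (v' := fun x => scPowDeriv n (pt x y))
    (fun x _ => (hab x).ofReal_comp) (fun x _ => hasDerivAt_scPow_left n x hy)
    (integrable_mul_scPowDeriv ha n hy) (integrable_mul_scPow hb n hy.le)
    (integrable_mul_scPow ha n hy.le)

/-! ### Compactly supported test functions -/

section

variable {f : ℝ → ℝ}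

lemma hasDerivAt_test (hf : ContDiff ℝ 2 f) (x : ℝ) : HasDerivAt f (deriv f x) x :=
  (hf.differentiable (by norm_num) x).hasDerivAt

lemma contDiff_deriv_test (hf : ContDiff ℝ 2 f) : ContDiff ℝ 1 (deriv f) :=
  (contDiff_succ_iff_deriv (n := 1).1 hf).2.2

lemma hasDerivAt_deriv_test (hf : ContDiff ℝ 2 f) (x : ℝ) :
    HasDerivAt (deriv f) (deriv (deriv f) x) x :=
  ((contDiff_deriv_test hf).differentiable (by norm_num) x).hasDerivAt

lemma continuous_deriv_test (hf : ContDiff ℝ 2 f) : Continuous (deriv f) :=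
  (contDiff_deriv_test hf).continuous

lemma continuous_deriv_deriv_test (hf : ContDiff ℝ 2 f) : Continuous (deriv (deriv f)) :=
  (contDiff_deriv_test hf).continuous_deriv le_rfl

lemma integrable_test (hf : ContDiff ℝ 2 f) (hc : HasCompactSupport f) : Integrable f :=
  hf.continuous.integrable_of_hasCompactSupport hc

lemma integrable_deriv_test (hf : ContDiff ℝ 2 f) (hc : HasCompactSupport f) :
    Integrable (deriv f) :=
  (continuous_deriv_test hf).integrable_of_hasCompactSupport hc.deriv

lemma integrable_deriv_deriv_test (hf : ContDiff ℝ 2 f) (hc : HasCompactSupport f) :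
    Integrable (deriv (deriv f)) :=
  (continuous_deriv_deriv_test hf).integrable_of_hasCompactSupport hc.deriv.deriv

/-- By compact support f' vanishes at -∞, so it is the integral of f'' from there. -/
lemma abs_deriv_le_integral (hf : ContDiff ℝ 2 f) (hc : HasCompactSupport f) (x : ℝ) :
    |deriv f x| ≤ ∫ t, |deriv (deriv f) t| := by
  have h0 : Tendsto (deriv f) atBot (𝓝 0) :=
    (hc.deriv.is_zero_at_infty).mono_left atBot_le_cocompact
  have h1 : ∫ t in Set.Iic x, deriv (deriv f) t = deriv f x - 0 :=
    integral_Iic_of_hasDerivAt_of_tendsto' (fun t _ => hasDerivAt_deriv_test hf t)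
      (integrable_deriv_deriv_test hf hc).integrableOn h0
  rw [sub_zero] at h1
  rw [← h1]
  calc |∫ t in Set.Iic x, deriv (deriv f) t| ≤ ∫ t in Set.Iic x, |deriv (deriv f) t| :=
        abs_integral_le_integral_abs
    _ ≤ _ := setIntegral_le_integral (integrable_deriv_deriv_test hf hc).abs
        (ae_of_all _ fun t => abs_nonneg _)

/-- `∫ (f'(x) + i y f''(x)) m(x + i y)^(n+1) dx`. -/
noncomputable def Phi (f : ℝ → ℝ) (n : ℕ) (y : ℝ) : ℂ :=
  horiz (deriv f) n y + Complex.I * y * horiz (deriv (deriv f)) n y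

lemma continuousOn_Phi (hf : ContDiff ℝ 2 f) (hc : HasCompactSupport f) (n : ℕ) :
    ContinuousOn (Phi f n) (Set.Ici 0) := by
  have h1 := continuousOn_horiz (integrable_deriv_test hf hc) n
  have h2 := continuousOn_horiz (integrable_deriv_deriv_test hf hc) n
  unfold Phi
  fun_prop

/-- After integration by parts the derivative of the first term cancels the contribution of
differentiating the factor iy. This is the analytic gain of the almost analytic extension: only a
term with an explicit factor y survives. -/
lemma hasDerivAt_Phi (hf : ContDiff ℝ 2 f) (hc : HasCompactSupport f) (n : ℕ) {y : ℝ}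
    (hy : 0 < y) : HasDerivAt (Phi f n) (-(y * horizDeriv (deriv (deriv f)) n y)) y := by
  have h1 := hasDerivAt_horiz (integrable_deriv_test hf hc) n hy
  have h2 := hasDerivAt_horiz (integrable_deriv_deriv_test hf hc) n hy
  have h3 := horizDeriv_eq_neg_horiz (hasDerivAt_deriv_test hf) (integrable_deriv_test hf hc)
    (integrable_deriv_deriv_test hf hc) n hy
  have h4 := h1.add ((((hasDerivAt_id y).ofReal_comp).const_mul Complex.I).mul h2)
  refine h4.congr_deriv ?_
  rw [h3]
  simp only [id, Complex.ofReal_one]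
  linear_combination (y * horizDeriv (deriv (deriv f)) n y) * Complex.I_sq

end

/-! ### Area integrals of the almost analytic extension -/

section

variable {f χ : ℝ → ℝ}

lemma hasFDerivAt_comp_re {u : ℝ → ℝ} {u' : ℝ} {z : ℂ} (h : HasDerivAt u u' z.re) :
    HasFDerivAt (fun z : ℂ => ((u z.re : ℝ) : ℂ)) (Complex.ofRealCLM ∘L (u' • Complex.reCLM)) z :=
  Complex.ofRealCLM.hasFDerivAt.comp z (h.comp_hasFDerivAt z Complex.reCLM.hasFDerivAt)

lemma hasFDerivAt_comp_im {u : ℝ → ℝ} {u' : ℝ} {z : ℂ} (h : HasDerivAt u u' z.im) :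
    HasFDerivAt (fun z : ℂ => ((u z.im : ℝ) : ℂ)) (Complex.ofRealCLM ∘L (u' • Complex.imCLM)) z :=
  Complex.ofRealCLM.hasFDerivAt.comp z (h.comp_hasFDerivAt z Complex.imCLM.hasFDerivAt)

/-- The value of `∂̄ f̃` at `x + i y`. -/
noncomputable def dbarExt (χ f : ℝ → ℝ) (x y : ℝ) : ℂ :=
  Complex.I / 2 * (y * deriv (deriv f) x * χ y + (f x + Complex.I * y * deriv f x) * deriv χ y)

/-- The terms in f'χ from the two partial derivatives cancel, leaving yf''χ and the terms with χ'.
-/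
lemma dbar_almostAnalytic (hf : ContDiff ℝ 2 f) (hχ : Differentiable ℝ χ) (z : ℂ) :
    dbar (almostAnalytic χ f) z = dbarExt χ f z.re z.im := by
  have h1 := hasFDerivAt_comp_re (hasDerivAt_test hf z.re)
  have h2 := hasFDerivAt_comp_re (hasDerivAt_deriv_test hf z.re)
  have h3 := hasFDerivAt_comp_im (hχ z.im).hasDerivAt
  have h4 := hasFDerivAt_comp_im (z := z) (hasDerivAt_id z.im)
  have h5 := (h1.add ((h4.const_mul Complex.I).mul h2)).mul h3
  have h6 : fderiv ℝ (almostAnalytic χ f) z = _ := h5.fderiv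
  unfold dbar
  rw [h6]
  simp [dbarExt]
  linear_combination ((deriv f z.re) * χ z.im / 2 : ℂ) * Complex.I_sq

lemma continuous_dbarExt (hf : ContDiff ℝ 2 f) (hχ : IsCutoff χ) :
    Continuous fun z : ℂ => dbarExt χ f z.re z.im := by
  have h1 := hf.continuous
  have h2 := continuous_deriv_test hf
  have h3 := continuous_deriv_deriv_test hf
  have h4 := hχ.smooth.continuous
  have h5 : Continuous (deriv χ) := hχ.smooth.continuous_deriv (by norm_num)
  unfold dbarExt
  fun_prop

lemma IsCutoff.deriv_eq_zero (hχ : IsCutoff χ) {y : ℝ} (hy : 2 < |y|) : deriv χ y = 0 := by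
  have h : χ =ᶠ[𝓝 y] fun _ => 0 := by
    filter_upwards [(isOpen_lt continuous_const continuous_abs).mem_nhds hy] with t ht
    exact hχ.eq_zero t ht
  rw [h.deriv_eq]; simp

lemma hasCompactSupport_dbarExt (hc : HasCompactSupport f) (hχ : IsCutoff χ) :
    HasCompactSupport fun z : ℂ => dbarExt χ f z.re z.im := by
  refine HasCompactSupport.intro (hc.isCompact.reProdIm (isCompact_Icc (a := (-2 : ℝ)) (b := 2)))
    fun z hz => ?_
  by_cases hy : 2 < |z.im|
  · simp [dbarExt, hχ.eq_zero _ hy, hχ.deriv_eq_zero hy]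
  · have hy' : z.im ∈ Set.Icc (-2 : ℝ) 2 := abs_le.1 (not_lt.1 hy)
    have hx : z.re ∉ tsupport f := fun h => hz (Complex.mem_reProdIm.2 ⟨h, hy'⟩)
    have h0 : f z.re = 0 := image_eq_zero_of_notMem_tsupport hx
    have h1 : z.re ∉ tsupport (deriv f) := fun h => hx (tsupport_deriv_subset h)
    have h2 : z.re ∉ tsupport (deriv (deriv f)) := fun h => h1 (tsupport_deriv_subset h)
    simp [dbarExt, h0, image_eq_zero_of_notMem_tsupport h1, image_eq_zero_of_notMem_tsupport h2]

lemma integrable_dbarExt (hf : ContDiff ℝ 2 f) (hc : HasCompactSupport f) (hχ : IsCutoff χ) :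
    Integrable fun z : ℂ => dbarExt χ f z.re z.im :=
  (continuous_dbarExt hf hχ).integrable_of_hasCompactSupport (hasCompactSupport_dbarExt hc hχ)

lemma integral_linear_comb_three {u v w : ℝ → ℂ} (hu : Integrable u) (hv : Integrable v)
    (hw : Integrable w) (a b c : ℂ) :
    ∫ x, (a * u x + (b * v x + c * w x)) = a * (∫ x, u x) + (b * (∫ x, v x) + c * ∫ x, w x) := by
  have h2 : Integrable fun x => b * v x + c * w x := (hv.const_mul b).add (hw.const_mul c)
  rw [integral_add (hu.const_mul a) h2, integral_add (hv.const_mul b) (hw.const_mul c),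
    integral_const_mul, integral_const_mul, integral_const_mul]

lemma measurableSet_upper (η : ℝ) : MeasurableSet {z : ℂ | η < z.im} :=
  measurableSet_lt measurable_const Complex.measurable_im

lemma integrableOn_dbarExt_mul_upper (hf : ContDiff ℝ 2 f) (hc : HasCompactSupport f)
    (hχ : IsCutoff χ) (n : ℕ) {η : ℝ} (hη : 0 < η) :
    IntegrableOn (fun z : ℂ => dbarExt χ f z.re z.im * scPowDeriv n z) {z | η < z.im} := by
  refine (integrable_dbarExt hf hc hχ).integrableOn.mul_bdd (c := (n + 1) * (1 / √(2 * η))) ?_ ?_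
  · exact ((continuousOn_scPowDeriv n).mono fun z hz => hη.trans hz).aestronglyMeasurable
      (measurableSet_upper η)
  · filter_upwards [ae_restrict_mem (measurableSet_upper η)] with z hz
    have hz : η < z.im := hz
    refine (norm_scPowDeriv_le n (hη.trans hz)).trans ?_
    gcongr

/-- The area integral over a half-plane collapses to its boundary. -/
lemma setIntegral_dbarExt_upper (hf : ContDiff ℝ 2 f) (hc : HasCompactSupport f)
    (hχ : IsCutoff χ) (n : ℕ) {η : ℝ} (hη : 0 < η) :
    ∫ z in {z : ℂ | η < z.im}, dbarExt χ f z.re z.im * scPowDeriv n z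
      = Complex.I / 2 * (χ η * Phi f n η) := by
  set e := Complex.measurableEquivRealProd with he
  have hpre : {z : ℂ | η < z.im} = e ⁻¹' (Set.univ ×ˢ Set.Ioi η) := by
    ext z; simp [he, Complex.measurableEquivRealProd_apply]
  have hfun : (fun z : ℂ => dbarExt χ f z.re z.im * scPowDeriv n z)
      = fun z => (fun p : ℝ × ℝ => dbarExt χ f p.1 p.2 * scPowDeriv n (pt p.1 p.2)) (e z) := by
    funext z
    have : pt z.re z.im = z := by simp [pt]
    simp [he, Complex.measurableEquivRealProd_apply, this]
  have hint := integrableOn_dbarExt_mul_upper hf hc hχ n hη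
  have hmp : MeasurePreserving e volume volume := Complex.volume_preserving_equiv_real_prod
  rw [hfun, hpre] at hint
  rw [hfun, hpre]
  rw [hmp.setIntegral_preimage_emb e.measurableEmbedding
    (fun p : ℝ × ℝ => dbarExt χ f p.1 p.2 * scPowDeriv n (pt p.1 p.2))]
  have hint2 := (hmp.integrableOn_comp_preimage e.measurableEmbedding
    (f := fun p : ℝ × ℝ => dbarExt χ f p.1 p.2 * scPowDeriv n (pt p.1 p.2))).1 hint
  rw [IntegrableOn, Measure.volume_eq_prod, ← Measure.prod_restrict, Measure.restrict_univ] at hint2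
  rw [Measure.volume_eq_prod, ← Measure.prod_restrict, Measure.restrict_univ,
    integral_prod_symm _ hint2]
  -- Green's formula in one variable: after the x-integration the integrand is an exact
  -- y-derivative, so only the value at height η remains. At infinity the cutoff makes the primitive
  -- vanish.
  have hder : ∀ y ∈ Set.Ici η, HasDerivAt (fun y => -(Complex.I / 2 * (χ y * Phi f n y)))
      (∫ x, dbarExt χ f x y * scPowDeriv n (pt x y)) y := by
    intro y hy
    have hy0 : 0 < y := hη.trans_le hy
    have h1 : HasDerivAt (fun t : ℝ => (χ t : ℂ)) ((deriv χ y : ℝ) : ℂ) y :=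
      ((hχ.smooth.differentiable (by norm_num)) y).hasDerivAt.ofReal_comp
    have h2 := ((h1.mul (hasDerivAt_Phi hf hc n hy0)).const_mul (Complex.I / 2)).neg
    refine h2.congr_deriv ?_
    have i0 := integrable_mul_scPowDeriv (integrable_test hf hc) n hy0
    have i1 := integrable_mul_scPowDeriv (integrable_deriv_test hf hc) n hy0
    have i2 := integrable_mul_scPowDeriv (integrable_deriv_deriv_test hf hc) n hy0
    have h3 : ∀ x, dbarExt χ f x y * scPowDeriv n (pt x y)
        = Complex.I / 2 * y * χ y * (deriv (deriv f) x * scPowDeriv n (pt x y))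
          + (Complex.I / 2 * deriv χ y * (f x * scPowDeriv n (pt x y))
          + Complex.I / 2 * Complex.I * y * deriv χ y * (deriv f x * scPowDeriv n (pt x y))) := by
      intro x; unfold dbarExt; ring
    simp only [h3]
    rw [integral_linear_comb_three i2 i0 i1]
    change _ = Complex.I / 2 * y * χ y * horizDeriv (deriv (deriv f)) n y
      + (Complex.I / 2 * deriv χ y * horizDeriv f n y
      + Complex.I / 2 * Complex.I * y * deriv χ y * horizDeriv (deriv f) n y)
    rw [horizDeriv_eq_neg_horiz (hasDerivAt_test hf) (integrable_test hf hc)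
        (integrable_deriv_test hf hc) n hy0,
      horizDeriv_eq_neg_horiz (hasDerivAt_deriv_test hf) (integrable_deriv_test hf hc)
        (integrable_deriv_deriv_test hf hc) n hy0, Phi]
    ring
  rw [integral_Ioi_of_hasDerivAt_of_tendsto' (m := 0) hder hint2.integral_prod_right]
  · ring
  · refine tendsto_const_nhds.congr' ?_
    filter_upwards [eventually_gt_atTop 2] with y hy
    rw [hχ.eq_zero y (hy.trans_le (le_abs_self y))]
    simp

/-! ### Reflection to the lower half-plane -/

/-- The derivative of the power `scExt z ^ (n + 1)` off the real axis. -/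
noncomputable def extPowDeriv (n : ℕ) (z : ℂ) : ℂ := (n + 1) * scExt z ^ n * scExtDeriv z

lemma extPowDeriv_of_pos (n : ℕ) {z : ℂ} (hz : 0 < z.im) : extPowDeriv n z = scPowDeriv n z := by
  simp [extPowDeriv, scPowDeriv, scExt, scExtDeriv, hz]

lemma extPowDeriv_conj (n : ℕ) {z : ℂ} (hz : 0 < z.im) :
    extPowDeriv n ((starRingEnd ℂ) z) = (starRingEnd ℂ) (scPowDeriv n z) := by
  have : ¬ z.im < 0 := hz.not_gt
  simp [extPowDeriv, scPowDeriv, scExt, scExtDeriv, this]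

/-- The cutoff need not be even, so reflecting the lower half-plane upwards changes it into this
one. -/
lemma IsCutoff.comp_neg (hχ : IsCutoff χ) : IsCutoff fun y => χ (-y) :=
  ⟨hχ.smooth.comp contDiff_neg, fun y hy => hχ.eq_one _ (by rwa [abs_neg]),
    fun y hy => hχ.eq_zero _ (by rwa [abs_neg])⟩

lemma dbarExt_conj (χ f : ℝ → ℝ) (x y : ℝ) :
    dbarExt χ f x (-y) = (starRingEnd ℂ) (dbarExt (fun y => χ (-y)) f x y) := by
  have h2 : (starRingEnd ℂ) 2 = 2 := map_ofNat (starRingEnd ℂ) 2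
  simp [dbarExt, deriv_comp_neg, h2]
  ring

lemma Omega_eq (N : ℕ) (𝔞 : ℝ) : Omega N 𝔞 = {z | (N : ℝ) ^ (-1 + 𝔞) < z.im} ∪
    (starRingEnd ℂ) ⁻¹' {z | (N : ℝ) ^ (-1 + 𝔞) < z.im} := by
  ext z
  simp [Omega, lt_abs]

lemma measurePreserving_conj : MeasurePreserving (starRingEnd ℂ : ℂ → ℂ) :=
  Complex.conjLIE.measurePreserving

lemma measurableEmbedding_conj : MeasurableEmbedding (starRingEnd ℂ : ℂ → ℂ) :=
  Complex.conjLIE.toHomeomorph.measurableEmbedding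

lemma lower_integrand_eq (χ f : ℝ → ℝ) (n : ℕ) {η : ℝ} (hη : 0 < η) :
    Set.EqOn (fun z : ℂ => dbarExt χ f z.re z.im * extPowDeriv n z)
      (fun z => (fun w : ℂ => (starRingEnd ℂ)
        (dbarExt (fun y => χ (-y)) f w.re w.im * scPowDeriv n w)) ((starRingEnd ℂ) z))
      ((starRingEnd ℂ) ⁻¹' {z : ℂ | η < z.im}) := by
  intro z hz
  have hz : η < ((starRingEnd ℂ) z).im := hz
  have h1 := extPowDeriv_conj n (hη.trans hz)
  have h2 := dbarExt_conj χ f z.re ((starRingEnd ℂ) z).im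
  simp only [Complex.conj_conj] at h1
  simp only [map_mul, h1, Complex.conj_re, ← h2]
  simp

lemma integrableOn_dbarExt_mul (hf : ContDiff ℝ 2 f) (hc : HasCompactSupport f)
    (hχ : IsCutoff χ) (n : ℕ) {N : ℕ} {𝔞 : ℝ} (hN : 0 < N) :
    IntegrableOn (fun z : ℂ => dbarExt χ f z.re z.im * extPowDeriv n z) (Omega N 𝔞) := by
  have hη : 0 < (N : ℝ) ^ (-1 + 𝔞) := by positivity
  rw [Omega_eq]
  refine IntegrableOn.union ?_ ?_
  · refine (integrableOn_dbarExt_mul_upper hf hc hχ n hη).congr_fun (fun z hz => ?_)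
      (measurableSet_upper _)
    simp only [extPowDeriv_of_pos n (hη.trans hz)]
  · refine IntegrableOn.congr_fun ?_ (lower_integrand_eq χ f n hη).symm
      (measurableEmbedding_conj.measurable (measurableSet_upper _))
    have h : Integrable (fun w : ℂ => dbarExt (fun y => χ (-y)) f w.re w.im * scPowDeriv n w)
        (volume.restrict {z : ℂ | (N : ℝ) ^ (-1 + 𝔞) < z.im}) :=
      integrableOn_dbarExt_mul_upper hf hc hχ.comp_neg n hη
    exact (measurePreserving_conj.integrableOn_comp_preimage measurableEmbedding_conj
      (f := fun w : ℂ => (starRingEnd ℂ) (dbarExt (fun y => χ (-y)) f w.re w.im * scPowDeriv n w))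
      (s := {z : ℂ | (N : ℝ) ^ (-1 + 𝔞) < z.im})).2
      ((Complex.conjCLE : ℂ →L[ℝ] ℂ).integrable_comp h)

/-- The lower half-plane contributes the complex conjugate of the upper one, and 2 Re(iΦ/2) = -Im Φ.
The hypothesis η < 1 places the boundary line where the cutoff equals 1, so the result does not
depend on χ. -/
lemma setIntegral_dbarExt (hf : ContDiff ℝ 2 f) (hc : HasCompactSupport f)
    (hχ : IsCutoff χ) (n : ℕ) {N : ℕ} {𝔞 : ℝ} (hN : 0 < N) (h1 : (N : ℝ) ^ (-1 + 𝔞) < 1) :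
    ∫ z in Omega N 𝔞, dbarExt χ f z.re z.im * extPowDeriv n z
      = ((-(Phi f n ((N : ℝ) ^ (-1 + 𝔞))).im : ℝ) : ℂ) := by
  have hη : 0 < (N : ℝ) ^ (-1 + 𝔞) := by positivity
  have hint := integrableOn_dbarExt_mul hf hc hχ n (𝔞 := 𝔞) hN
  set η := (N : ℝ) ^ (-1 + 𝔞) with hη'
  rw [Omega_eq, ← hη'] at hint ⊢
  have hms : MeasurableSet ((starRingEnd ℂ) ⁻¹' {z : ℂ | η < z.im}) :=
    measurableEmbedding_conj.measurable (measurableSet_upper _)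
  rw [setIntegral_union ?_ hms (hint.mono_set Set.subset_union_left)
    (hint.mono_set Set.subset_union_right)]
  · have e1 : ∫ z in {z : ℂ | η < z.im}, dbarExt χ f z.re z.im * extPowDeriv n z
        = Complex.I / 2 * Phi f n η := by
      rw [setIntegral_congr_fun (measurableSet_upper η)
        (g := fun z : ℂ => dbarExt χ f z.re z.im * scPowDeriv n z),
        setIntegral_dbarExt_upper hf hc hχ n hη, hχ.eq_one η (by rwa [abs_of_pos hη])]
      · simp
      · intro z hz
        simp only [extPowDeriv_of_pos n (hη.trans hz)]
    have e2 : ∫ z in (starRingEnd ℂ) ⁻¹' {z : ℂ | η < z.im},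
        dbarExt χ f z.re z.im * extPowDeriv n z
        = (starRingEnd ℂ) (Complex.I / 2 * Phi f n η) := by
      rw [setIntegral_congr_fun hms (lower_integrand_eq χ f n hη),
        measurePreserving_conj.setIntegral_preimage_emb measurableEmbedding_conj
          (fun w : ℂ => (starRingEnd ℂ)
            (dbarExt (fun y => χ (-y)) f w.re w.im * scPowDeriv n w)), integral_conj,
        setIntegral_dbarExt_upper hf hc hχ.comp_neg n hη, hχ.comp_neg.eq_one η
          (by rwa [abs_of_pos hη])]
      simp
    rw [e1, e2, Complex.add_conj]
    congr 1
    simp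
  · rw [Set.disjoint_left]
    intro z hz hz'
    have h1 : η < z.im := hz
    have h2 : η < ((starRingEnd ℂ) z).im := hz'
    rw [Complex.conj_im] at h2
    linarith

end

/-! ### Termwise integration -/

lemma tsum_lintegral_enorm_ne_top {α E : Type*} [MeasurableSpace α] {ν : Measure α}
    [NormedAddCommGroup E] {F : ℕ → α → E} (hF : ∀ n, Integrable (F n) ν)
    (hs : Summable fun n => ∫ a, ‖F n a‖ ∂ν) : ∑' n, ∫⁻ a, ‖F n a‖ₑ ∂ν ≠ ⊤ := by
  have h : ∀ n, ∫⁻ a, ‖F n a‖ₑ ∂ν = ENNReal.ofReal (∫ a, ‖F n a‖ ∂ν) := fun n =>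
    (ofReal_integral_norm_eq_lintegral_enorm (hF n)).symm
  simp only [h]
  exact hs.tsum_ofReal_ne_top

/-- Fubini for series. Measurability and integrability of the sum are conclusions: it is an a.e.
limit of partial sums and is dominated by the series of norms. -/
lemma integrable_and_hasSum_integral {α E : Type*} [MeasurableSpace α] {ν : Measure α}
    [NormedAddCommGroup E] [NormedSpace ℝ E] {F : ℕ → α → E} {G : α → E}
    (hF : ∀ n, Integrable (F n) ν) (hs : Summable fun n => ∫ a, ‖F n a‖ ∂ν)
    (hG : ∀ᵐ a ∂ν, HasSum (fun n => F n a) (G a)) :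
    Integrable G ν ∧ HasSum (fun n => ∫ a, F n a ∂ν) (∫ a, G a ∂ν) := by
  have hne := tsum_lintegral_enorm_ne_top hF hs
  have hGt : G =ᵐ[ν] fun a => ∑' n, F n a := by
    filter_upwards [hG] with a ha using ha.tsum_eq.symm
  refine ⟨⟨?_, ?_⟩, ?_⟩
  · refine aestronglyMeasurable_of_tendsto_ae atTop
      (f := fun (k : ℕ) a => ∑ n ∈ Finset.range k, F n a) (fun k => ?_) ?_
    · exact Finset.aestronglyMeasurable_fun_sum _ fun n _ => (hF n).1
    · filter_upwards [hG] with a ha using ha.tendsto_sum_nat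
  · refine lt_of_le_of_lt ?_ hne.lt_top
    rw [← lintegral_tsum fun n => (hF n).1.enorm]
    refine lintegral_mono_ae ?_
    filter_upwards [hG] with a ha
    rw [← ha.tsum_eq]
    exact enorm_tsum_le_tsum_enorm
  · rw [integral_congr_ae hGt]
    exact hasSum_integral_of_summable_integral_norm hF hs

/-! ### The left-hand side as a series -/

/-- The power sum `∑ μ k ^ (n + 1)`. -/
noncomputable def powerSum {N : ℕ} (μ : Fin N → ℝ) (n : ℕ) : ℝ := ∑ k, μ k ^ (n + 1)

lemma hasSum_geometric_deriv {a u : ℂ} (h : ‖u * a‖ < 1) :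
    HasSum (fun n : ℕ => (n + 1 : ℂ) * a ^ (n + 1) * u ^ n) (a / (1 - u * a) ^ 2) := by
  have h1 := (hasSum_choose_mul_geometric_of_norm_lt_one 1 h).mul_left a
  simp only [Nat.choose_one_right] at h1
  convert! h1 using 1
  · funext n; push_cast; ring
  · ring

/-- Expanding a/(1 - ua)² = ∑ (n+1) a^(n+1) u^n with u = m(z)m(w) separates the variables; the entry
a = 1 produces the summand 1 beside the power sum. Two derivatives of powers carry (n+1)², hence the
division by n + 1. -/
lemma hasSum_g_series {N : ℕ} {μ : Fin N → ℝ} (hμ : ∀ k, |μ k| ≤ 1) {z w : ℂ} (hz : z.im ≠ 0)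
    (hw : w.im ≠ 0) :
    HasSum (fun n : ℕ => (((1 + powerSum μ n) / (n + 1) : ℝ) : ℂ) *
        (extPowDeriv n z * extPowDeriv n w))
      (scExtDeriv z * scExtDeriv w * (1 / (1 - scExt z * scExt w) ^ 2
          + ∑ k, (μ k : ℂ) / (1 - scExt z * scExt w * μ k) ^ 2)) := by
  set u := scExt z * scExt w with hu
  have hu1 : ‖u‖ < 1 := by
    rw [hu, norm_mul]
    have := norm_scExt_lt_one hz
    have := norm_scExt_lt_one hw
    nlinarith [norm_nonneg (scExt z), norm_nonneg (scExt w)]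
  have h1 := hasSum_geometric_deriv (a := 1) (u := u) (by simpa using hu1)
  have h2 : ∀ k ∈ Finset.univ, HasSum (fun n : ℕ => (n + 1 : ℂ) * (μ k : ℂ) ^ (n + 1) * u ^ n)
      ((μ k : ℂ) / (1 - u * μ k) ^ 2) := fun k _ => by
    refine hasSum_geometric_deriv ?_
    rw [norm_mul, Complex.norm_real]
    have := hμ k
    have h3 : ‖μ k‖ ≤ 1 := this
    nlinarith [norm_nonneg u, norm_nonneg (μ k)]
  have h3 := (h1.add (hasSum_sum h2)).mul_left (scExtDeriv z * scExtDeriv w)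
  rw [mul_one] at h3
  convert! h3 using 1
  funext n
  have hn : (n + 1 : ℂ) ≠ 0 := by exact_mod_cast n.succ_ne_zero
  simp only [extPowDeriv, powerSum]
  push_cast
  rw [one_pow, ← Finset.sum_mul, ← Finset.mul_sum, hu, mul_pow]
  field_simp

lemma abs_powerSum_le_card {N : ℕ} {μ : Fin N → ℝ} (hμ : ∀ k, |μ k| ≤ 1) (n : ℕ) :
    |powerSum μ n| ≤ N := by
  unfold powerSum
  refine (Finset.abs_sum_le_sum_abs _ _).trans ?_
  calc ∑ k, |μ k ^ (n + 1)| ≤ ∑ _k : Fin N, (1 : ℝ) := by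
        refine Finset.sum_le_sum fun k _ => ?_
        rw [abs_pow]; exact pow_le_one₀ (abs_nonneg _) (hμ k)
    _ = N := by simp

lemma norm_extPowDeriv_le (n : ℕ) {z : ℂ} {η : ℝ} (hη : 0 < η) (hz : η < |z.im|) :
    ‖extPowDeriv n z‖ ≤ (n + 1) * √(1 / (1 + η)) ^ n * (1 / √(2 * η)) := by
  have key : ∀ w : ℂ, η < w.im → ‖scPowDeriv n w‖ ≤ (n + 1) * √(1 / (1 + η)) ^ n * (1 / √(2 * η)) := by
    intro w hw
    have hw0 := hη.trans hw
    rw [norm_scPowDeriv]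
    have h1 : ‖sc w‖ ≤ √(1 / (1 + η)) := by
      refine Real.le_sqrt_of_sq_le ((norm_sc_sq_le hw0).trans ?_)
      gcongr
    have h2 : ‖scDeriv w‖ ≤ 1 / √(2 * η) := (norm_scDeriv_le hw0).trans (by gcongr)
    gcongr
  rcases lt_abs.1 hz with h | h
  · rw [extPowDeriv_of_pos n (hη.trans h)]
    exact key z h
  · have h' : η < ((starRingEnd ℂ) z).im := by simpa using h
    have h1 := extPowDeriv_conj n (hη.trans h')
    rw [Complex.conj_conj] at h1
    rw [h1, Complex.norm_conj]
    exact key _ h'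

lemma measurableSet_Omega (N : ℕ) (𝔞 : ℝ) : MeasurableSet (Omega N 𝔞) :=
  measurableSet_lt measurable_const Complex.measurable_im.abs

/-- The area integral of the integrand, as an absolutely convergent series of squares. -/
lemma integrableOn_integrand_and_hasSum {f χ : ℝ → ℝ} (hf : ContDiff ℝ 2 f)
    (hc : HasCompactSupport f) (hχ : IsCutoff χ) {N : ℕ} {𝔞 : ℝ} (hN : 0 < N)
    (h1 : (N : ℝ) ^ (-1 + 𝔞) < 1) {S : Matrix (Fin N) (Fin N) ℝ} {μ : Fin N → ℝ}
    (hμ : ∀ k, |μ k| ≤ 1)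
    (hg : ∀ z w : ℂ, z.im ≠ 0 → w.im ≠ 0 → g S z w = scExtDeriv z * scExtDeriv w *
        (1 / (1 - scExt z * scExt w) ^ 2
          + ∑ k, (μ k : ℂ) / (1 - scExt z * scExt w * μ k) ^ 2)) :
    IntegrableOn (integrand S χ f) (Omega N 𝔞 ×ˢ Omega N 𝔞) ∧
    HasSum (fun n : ℕ => (((1 + powerSum μ n) / (n + 1) *
        (Phi f n ((N : ℝ) ^ (-1 + 𝔞))).im ^ 2 : ℝ) : ℂ))
      (∫ p in Omega N 𝔞 ×ˢ Omega N 𝔞, integrand S χ f p) := by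
  set η := (N : ℝ) ^ (-1 + 𝔞) with hηdef
  have hη : 0 < η := by positivity
  set ν : Measure ℂ := volume.restrict (Omega N 𝔞) with hν
  have hprod : (volume : Measure (ℂ × ℂ)).restrict (Omega N 𝔞 ×ˢ Omega N 𝔞) = ν.prod ν := by
    rw [Measure.volume_eq_prod, Measure.prod_restrict]
  have hχd : Differentiable ℝ χ := hχ.smooth.differentiable (by norm_num)
  set E : ℕ → ℂ → ℂ := fun n z => dbarExt χ f z.re z.im * extPowDeriv n z with hE
  have hEint : ∀ n, Integrable (E n) ν := fun n => integrableOn_dbarExt_mul hf hc hχ n hN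
  set c : ℕ → ℝ := fun n => (1 + powerSum μ n) / (n + 1) with hcdef
  set ρ := √(1 / (1 + η)) with hρ
  have hρ1 : ρ < 1 := by
    rw [hρ, Real.sqrt_lt' one_pos, one_pow, div_lt_one (by positivity)]; linarith
  have hρ0 : 0 ≤ ρ := Real.sqrt_nonneg _
  set B := (∫ z : ℂ, ‖dbarExt χ f z.re z.im‖) * (1 / √(2 * η)) with hB
  have hB0 : 0 ≤ B := by positivity
  have hEnorm : ∀ n, ∫ z, ‖E n z‖ ∂ν ≤ (n + 1) * ρ ^ n * B := by
    intro n
    have hD := (integrable_dbarExt hf hc hχ).norm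
    calc ∫ z, ‖E n z‖ ∂ν
        ≤ ∫ z, ‖dbarExt χ f z.re z.im‖ * ((n + 1) * ρ ^ n * (1 / √(2 * η))) ∂ν := by
          refine integral_mono_ae (hEint n).norm (hD.integrableOn.mul_const _) ?_
          filter_upwards [ae_restrict_mem (measurableSet_Omega N 𝔞)] with z hz
          simp only [hE, norm_mul]
          gcongr
          exact norm_extPowDeriv_le n hη hz
      _ = (∫ z, ‖dbarExt χ f z.re z.im‖ ∂ν) * ((n + 1) * ρ ^ n * (1 / √(2 * η))) :=
          integral_mul_const _ _
      _ ≤ (∫ z : ℂ, ‖dbarExt χ f z.re z.im‖) * ((n + 1) * ρ ^ n * (1 / √(2 * η))) := by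
          exact mul_le_mul_of_nonneg_right
            (setIntegral_le_integral hD (ae_of_all _ fun z => norm_nonneg _)) (by positivity)
      _ = _ := by rw [hB]; ring
  have hF : ∀ n, Integrable (fun p : ℂ × ℂ => (c n : ℂ) * (E n p.1 * E n p.2)) (ν.prod ν) :=
    fun n => ((hEint n).mul_prod (hEint n)).const_mul _
  -- The two area integrals each grow at most like (n+1)ρ^n, and the coefficient is at most
  -- (1+N)/(n+1), which leaves the summable series ∑ (n+1)ρ^(2n). Dependence on N and η is harmless
  -- here.
  have hs : Summable fun n => ∫ p : ℂ × ℂ, ‖(c n : ℂ) * (E n p.1 * E n p.2)‖ ∂(ν.prod ν) := by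
    have hgeo : Summable fun n : ℕ => ((n + 1 : ℕ) : ℝ) * (ρ ^ 2) ^ n := by
      have := summable_choose_mul_geometric_of_norm_lt_one 1 (r := ρ ^ 2) (by
        rw [Real.norm_of_nonneg (by positivity)]; nlinarith)
      simpa using this
    refine Summable.of_nonneg_of_le (fun n => integral_nonneg fun p => norm_nonneg _) (fun n => ?_)
      (hgeo.mul_left ((1 + N) * B ^ 2))
    simp only [norm_mul]
    rw [integral_const_mul, integral_prod_mul (fun z => ‖E n z‖) (fun z => ‖E n z‖)]
    have h2 : ‖(c n : ℂ)‖ ≤ (1 + N) / (n + 1) := by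
      rw [Complex.norm_real, hcdef, Real.norm_eq_abs, abs_div, abs_of_pos (by positivity : (0 : ℝ) < n + 1)]
      gcongr
      refine (abs_add_le _ _).trans ?_
      rw [abs_one]
      gcongr
      exact abs_powerSum_le_card hμ n
    have h3 := hEnorm n
    have h0 : 0 ≤ ∫ z, ‖E n z‖ ∂ν := integral_nonneg fun z => norm_nonneg _
    calc ‖(c n : ℂ)‖ * ((∫ z, ‖E n z‖ ∂ν) * ∫ z, ‖E n z‖ ∂ν)
        ≤ (1 + N) / (n + 1) * (((n + 1) * ρ ^ n * B) * ((n + 1) * ρ ^ n * B)) := by gcongr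
      _ = (1 + N) * B ^ 2 * (((n + 1 : ℕ) : ℝ) * (ρ ^ 2) ^ n) := by
          push_cast
          field_simp
          ring
  have hsum : ∀ᵐ p : ℂ × ℂ ∂(ν.prod ν),
      HasSum (fun n => (c n : ℂ) * (E n p.1 * E n p.2)) (integrand S χ f p) := by
    rw [← hprod]
    filter_upwards [ae_restrict_mem ((measurableSet_Omega N 𝔞).prod (measurableSet_Omega N 𝔞))]
      with p hp
    have hne : ∀ z ∈ Omega N 𝔞, z.im ≠ 0 := fun z hz h => by
      have hz : η < |z.im| := hz
      rw [h, abs_zero] at hz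
      linarith
    have h2 := hne p.1 hp.1
    have h3 := hne p.2 hp.2
    have h4 := (hasSum_g_series hμ h2 h3).mul_left
      (dbar (almostAnalytic χ f) p.2 * dbar (almostAnalytic χ f) p.1)
    rw [← hg p.1 p.2 h2 h3] at h4
    refine h4.congr_fun ?_
    intro n
    simp only [hE, dbar_almostAnalytic hf hχd, hcdef]
    ring
  have hfin := integrable_and_hasSum_integral hF hs hsum
  refine ⟨?_, ?_⟩
  · rw [IntegrableOn, hprod]; exact hfin.1
  · rw [hprod]
    refine hfin.2.congr_fun fun n => ?_
    rw [integral_const_mul, integral_prod_mul (E n) (E n)]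
    have h5 : ∫ z, E n z ∂ν = ((-(Phi f n η).im : ℝ) : ℂ) :=
      setIntegral_dbarExt hf hc hχ n hN h1
    rw [h5]
    simp only [hcdef]
    push_cast
    ring

/-! ### Powers of `sc` on the spectrum -/

/-- `Im m(x)^(n+1)` on the real axis. -/
noncomputable def sinPow (n : ℕ) (x : ℝ) : ℝ := (scPow n x).im

/-- `Re m(x)^(n+1)` on the real axis. -/
noncomputable def cosPow (n : ℕ) (x : ℝ) : ℝ := (scPow n x).re

lemma continuous_sinPow (n : ℕ) : Continuous (sinPow n) :=
  Complex.continuous_im.comp (continuous_scPow_comp n Complex.continuous_ofReal fun x => by simp)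

lemma continuous_cosPow (n : ℕ) : Continuous (cosPow n) :=
  Complex.continuous_re.comp (continuous_scPow_comp n Complex.continuous_ofReal fun x => by simp)

lemma abs_sinPow_le_one (n : ℕ) (x : ℝ) : |sinPow n x| ≤ 1 :=
  (Complex.abs_im_le_norm _).trans (norm_scPow_le n (by simp))

lemma abs_cosPow_le_one (n : ℕ) (x : ℝ) : |cosPow n x| ≤ 1 :=
  (Complex.abs_re_le_norm _).trans (norm_scPow_le n (by simp))

/-- The inequality |sin kθ| ≤ k|sin θ|, by induction from the addition formula, valid on the closed
unit disc. -/
lemma abs_im_pow_le {z : ℂ} (hz : ‖z‖ ≤ 1) (k : ℕ) : |(z ^ k).im| ≤ k * |z.im| := by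
  induction k with
  | zero => simp
  | succ k ih =>
    rw [pow_succ, Complex.mul_im]
    have h1 : |(z ^ k).re| ≤ 1 :=
      (Complex.abs_re_le_norm _).trans (by rw [norm_pow]; exact pow_le_one₀ (norm_nonneg _) hz)
    have h2 : |z.re| ≤ 1 := (Complex.abs_re_le_norm _).trans hz
    calc |(z ^ k).re * z.im + (z ^ k).im * z.re|
        ≤ |(z ^ k).re| * |z.im| + |(z ^ k).im| * |z.re| := by
          rw [← abs_mul, ← abs_mul]; exact abs_add_le _ _
      _ ≤ 1 * |z.im| + (k * |z.im|) * 1 := by gcongr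
      _ = _ := by push_cast; ring

lemma abs_sinPow_le (n : ℕ) (x : ℝ) : |sinPow n x| ≤ (n + 1) * (√(4 - x ^ 2) / 2) := by
  have := abs_im_pow_le (norm_sc_le_one (z := (x : ℂ)) (by simp)) (n + 1)
  rw [sc_ofReal_im, abs_of_nonneg (show 0 ≤ √(4 - x ^ 2) / 2 by positivity)] at this
  simpa [sinPow, scPow] using this

lemma sinPow_eq_zero {n : ℕ} {x : ℝ} (hx : 4 ≤ x ^ 2) : sinPow n x = 0 := by
  have := abs_sinPow_le n x
  rw [Real.sqrt_eq_zero_of_nonpos (by linarith)] at this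
  simpa using this

lemma hasDerivAt_scPow_ofReal (n : ℕ) {x : ℝ} (hx : x ∈ Set.Ioo (-2 : ℝ) 2) :
    HasDerivAt (fun t : ℝ => scPow n t)
      ((n + 1) * Complex.I * scPow n x / (√(4 - x ^ 2) : ℝ)) x := by
  have h : HasDerivAt (fun t : ℝ => sc t ^ (n + 1)) (((n + 1 : ℕ) : ℂ) * sc x ^ n *
      (Complex.I * sc x / (√(4 - x ^ 2) : ℝ))) x := (hasDerivAt_sc_ofReal hx).pow (n + 1)
  refine h.congr_deriv ?_
  simp only [scPow]
  push_cast
  ring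

lemma hasDerivAt_sinPow (n : ℕ) {x : ℝ} (hx : x ∈ Set.Ioo (-2 : ℝ) 2) :
    HasDerivAt (sinPow n) ((n + 1) * cosPow n x / √(4 - x ^ 2)) x := by
  have h := Complex.imCLM.hasFDerivAt.comp_hasDerivAt x (hasDerivAt_scPow_ofReal n hx)
  refine h.congr_deriv ?_
  have : ((n : ℂ) + 1) * Complex.I * scPow n x / (√(4 - x ^ 2) : ℝ)
      = (((n + 1) / √(4 - x ^ 2) : ℝ) : ℂ) * (Complex.I * scPow n x) := by push_cast; ring
  rw [this]
  simp only [Complex.imCLM_apply, Complex.im_ofReal_mul, Complex.I_mul_im, cosPow]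
  ring

/-- The weight is the nonnegative derivative of arcsin(x/2), which is continuous up to the
endpoints. -/
lemma integrableOn_inv_sqrt : IntegrableOn (fun x : ℝ => 1 / √(4 - x ^ 2)) (Set.Icc (-2) 2) := by
  have h : IntervalIntegrable (fun x : ℝ => 1 / √(4 - x ^ 2)) volume (-2) 2 := by
    refine intervalIntegral.intervalIntegrable_deriv_of_nonneg (g := fun x => Real.arcsin (x / 2))
      (Real.continuous_arcsin.comp (continuous_id.div_const 2)).continuousOn (fun x hx => ?_)
      (fun x _ => by positivity)
    norm_num at hx
    have h1 := (Real.hasDerivAt_arcsin (x := x / 2) (by linarith [hx.1]) (by linarith [hx.2])).comp x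
      ((hasDerivAt_id x).div_const 2)
    refine h1.congr_deriv ?_
    have h2 : √(1 - (x / 2) ^ 2) = √(4 - x ^ 2) / 2 := by
      rw [show 1 - (x / 2) ^ 2 = (4 - x ^ 2) / 2 ^ 2 by ring, Real.sqrt_div' _ (by norm_num),
        Real.sqrt_sq (by norm_num)]
    rw [h2]
    have : 0 < √(4 - x ^ 2) := Real.sqrt_pos.2 (by nlinarith [hx.1, hx.2])
    field_simp
  rw [intervalIntegrable_iff_integrableOn_Icc_of_le (by norm_num)] at h
  exact h

lemma intervalIntegrable_mul_inv_sqrt {u : ℝ → ℝ} (hu : Continuous u) :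
    IntervalIntegrable (fun x => u x / √(4 - x ^ 2)) volume (-2) 2 := by
  rw [intervalIntegrable_iff_integrableOn_Icc_of_le (by norm_num)]
  have := integrableOn_inv_sqrt.continuousOn_mul hu.continuousOn isCompact_Icc
  refine this.congr_fun (fun x _ => ?_) measurableSet_Icc
  simp only; ring

/-- Integration by parts against `sinPow`. -/
lemma integral_deriv_mul_sinPow {u u' : ℝ → ℝ} (hu : ∀ x, HasDerivAt u (u' x) x)
    (hu' : Continuous u') (n : ℕ) :
    ∫ x in (-2 : ℝ)..2, u' x * sinPow n x
      = -((n + 1) * ∫ x in (-2 : ℝ)..2, u x * cosPow n x / √(4 - x ^ 2)) := by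
  have huc : Continuous u := continuous_iff_continuousAt.2 fun x => (hu x).continuousAt
  have h := intervalIntegral.integral_mul_deriv_eq_deriv_mul_of_hasDerivAt (a := -2) (b := 2)
    (u := u) (v := sinPow n) (u' := u') (v' := fun x => (n + 1) * cosPow n x / √(4 - x ^ 2))
    huc.continuousOn (continuous_sinPow n).continuousOn (fun x _ => hu x)
    (fun x hx => hasDerivAt_sinPow n (by simpa using hx))
    (hu'.intervalIntegrable _ _)
    (intervalIntegrable_mul_inv_sqrt (continuous_const.mul (continuous_cosPow n)))
  have h2 : sinPow n 2 = 0 := sinPow_eq_zero (by norm_num)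
  have h3 : sinPow n (-2) = 0 := sinPow_eq_zero (by norm_num)
  rw [h2, h3] at h
  have h4 : ∫ x in (-2 : ℝ)..2, u x * ((n + 1) * cosPow n x / √(4 - x ^ 2))
      = (n + 1) * ∫ x in (-2 : ℝ)..2, u x * cosPow n x / √(4 - x ^ 2) := by
    rw [← intervalIntegral.integral_const_mul]
    congr 1; funext x; ring
  rw [h4] at h
  linarith

/-! ### The generating series of `sinPow` and the semicircle law -/

/-- The generating function of Chebyshev polynomials of the second kind: for p = m(t) on the unit
circle and q = m(w), subtract the geometric series in p and its conjugate and use (1 - pq)(1 - p̄q)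
= q(t - w). -/
lemma hasSum_sinPow {t : ℝ} (ht : t ∈ Set.Icc (-2 : ℝ) 2) {w : ℂ} (hw : 0 < w.im) :
    HasSum (fun n : ℕ => (sinPow n t : ℂ) * sc w ^ n)
      (((√(4 - t ^ 2) / 2 : ℝ) : ℂ) / (sc w * (t - w))) := by
  set p := sc t with hp
  set q := sc w with hq
  have hp1 : ‖p‖ = 1 := norm_sc_ofReal ht
  have hq1 : ‖q‖ < 1 := norm_sc_lt_one hw
  have hpp : p * (starRingEnd ℂ) p = 1 := by
    rw [Complex.mul_conj, Complex.normSq_eq_norm_sq, hp1]; norm_num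
  have hsum : p + (starRingEnd ℂ) p = -t := by
    rw [Complex.add_conj, hp, sc_ofReal_re ht]; push_cast; ring
  have hdiff : p - (starRingEnd ℂ) p = 2 * Complex.I * ((√(4 - t ^ 2) / 2 : ℝ) : ℂ) := by
    rw [Complex.sub_conj, hp, sc_ofReal_im]; push_cast; ring
  have hn1 : ‖p * q‖ < 1 := by rw [norm_mul, hp1, one_mul]; exact hq1
  have hn2 : ‖(starRingEnd ℂ) p * q‖ < 1 := by
    rw [norm_mul, Complex.norm_conj, hp1, one_mul]; exact hq1
  have h1 := (hasSum_geometric_of_norm_lt_one hn1).mul_left p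
  have h2 := (hasSum_geometric_of_norm_lt_one hn2).mul_left ((starRingEnd ℂ) p)
  have h3 := (h1.sub h2).mul_left (1 / (2 * Complex.I))
  have ne1 : 1 - p * q ≠ 0 := fun h => by
    rw [← sub_eq_zero.1 h, norm_one] at hn1; exact lt_irrefl _ hn1
  have ne2 : 1 - (starRingEnd ℂ) p * q ≠ 0 := fun h => by
    rw [← sub_eq_zero.1 h, norm_one] at hn2; exact lt_irrefl _ hn2
  have hprod : (1 - p * q) * (1 - (starRingEnd ℂ) p * q) = q * (t - w) := by
    linear_combination q ^ 2 * hpp - q * hsum + sc_quadratic w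
  have hval : 1 / (2 * Complex.I) * (p * (1 - p * q)⁻¹ - (starRingEnd ℂ) p *
      (1 - (starRingEnd ℂ) p * q)⁻¹) = ((√(4 - t ^ 2) / 2 : ℝ) : ℂ) / (q * (t - w)) := by
    have hI : Complex.I ≠ 0 := Complex.I_ne_zero
    have hsub : p * (1 - p * q)⁻¹ - (starRingEnd ℂ) p * (1 - (starRingEnd ℂ) p * q)⁻¹
        = (p - (starRingEnd ℂ) p) / ((1 - p * q) * (1 - (starRingEnd ℂ) p * q)) := by
      rw [← div_eq_mul_inv, ← div_eq_mul_inv, div_sub_div _ _ ne1 ne2]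
      congr 1; ring
    rw [hsub, hprod, hdiff, ← mul_div_assoc]
    congr 1
    field_simp
  rw [hval] at h3
  refine h3.congr_fun fun n => ?_
  have h4 : (sinPow n t : ℂ) = (p ^ (n + 1) - (starRingEnd ℂ) p ^ (n + 1)) / (2 * Complex.I) := by
    rw [← map_pow, Complex.sub_conj]
    have hI : Complex.I ≠ 0 := Complex.I_ne_zero
    rw [sinPow, scPow, hp]
    field_simp
    push_cast
    ring
  rw [h4]
  ring

lemma integral_sinPow_zero : ∫ x in (-2 : ℝ)..2, sinPow 0 x = Real.pi := by
  have h1 : ∀ x : ℝ, sinPow 0 x = √(1 - (x / 2) ^ 2) := by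
    intro x
    simp only [sinPow, scPow, zero_add, pow_one, sc_ofReal_im]
    rw [show 1 - (x / 2) ^ 2 = (4 - x ^ 2) / 2 ^ 2 by ring, Real.sqrt_div' _ (by norm_num),
        Real.sqrt_sq (by norm_num)]
  simp only [h1]
  rw [intervalIntegral.integral_comp_div (fun x => √(1 - x ^ 2)) (two_ne_zero)]
  norm_num [integral_sqrt_one_sub_sq]
  ring

/-- In the angle variable the integrand has the explicit primitive sin((n+1)θ)/(n+1) -
sin((n+3)θ)/(n+3), which vanishes at both edges. -/
lemma integral_sinPow_succ (n : ℕ) : ∫ x in (-2 : ℝ)..2, sinPow (n + 1) x = 0 := by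
  have h := intervalIntegral.integral_eq_sub_of_hasDerivAt_of_le (a := -2) (b := 2) (by norm_num)
    (f := fun x => sinPow n x / (n + 1) - sinPow (n + 2) x / (n + 3)) (f' := sinPow (n + 1))
    (((continuous_sinPow n).div_const _).sub ((continuous_sinPow (n + 2)).div_const _)).continuousOn
    (fun x hx => ?_) ((continuous_sinPow (n + 1)).intervalIntegrable _ _)
  · rw [h]
    have h2 : ∀ k, sinPow k 2 = 0 := fun k => sinPow_eq_zero (by norm_num)
    have h3 : ∀ k, sinPow k (-2) = 0 := fun k => sinPow_eq_zero (by norm_num)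
    simp [h2, h3]
  · have h1 := ((hasDerivAt_sinPow n hx).div_const (n + 1)).sub
      ((hasDerivAt_sinPow (n + 2) hx).div_const (n + 3))
    refine h1.congr_deriv ?_
    have hs : 0 < √(4 - x ^ 2) := Real.sqrt_pos.2 (by nlinarith [hx.1, hx.2])
    have hx' := Set.Ioo_subset_Icc_self hx
    have hpp : sc x * (starRingEnd ℂ) (sc x) = 1 := by
      rw [Complex.mul_conj, Complex.normSq_eq_norm_sq, norm_sc_ofReal hx']; norm_num
    have hdiff : sc x - (starRingEnd ℂ) (sc x) = Complex.I * (√(4 - x ^ 2) : ℝ) := by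
      rw [Complex.sub_conj, sc_ofReal_im]; push_cast; ring
    have h4 : scPow n x - scPow (n + 2) x = (√(4 - x ^ 2) : ℝ) * (-Complex.I * scPow (n + 1) x) := by
      simp only [scPow]
      linear_combination (-sc x ^ (n + 1)) * hpp - sc x ^ (n + 2) * hdiff
    have h5 := congrArg Complex.re h4
    simp only [Complex.sub_re, Complex.re_ofReal_mul] at h5
    have h6 : (-Complex.I * scPow (n + 1) x).re = sinPow (n + 1) x := by simp [sinPow]
    rw [h6] at h5
    have h7 : cosPow n x - cosPow (n + 2) x = √(4 - x ^ 2) * sinPow (n + 1) x := h5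
    push_cast
    have e1 : (n : ℝ) + 1 ≠ 0 := by positivity
    have e2 : (n : ℝ) + 2 + 1 ≠ 0 := by positivity
    have e3 : (n : ℝ) + 3 ≠ 0 := by positivity
    field_simp
    rw [show (n : ℝ) + 2 + 1 = n + 3 by ring]
    linear_combination (n + 3) * h7

/-- Integrate the generating series of `hasSum_sinPow` over [-2,2] term by term; only n = 0
survives, with integral π. -/
lemma msc_eq_sc {w : ℂ} (hw : 0 < w.im) : msc w = sc w := by
  set κ : Measure ℝ := volume.restrict (Set.Icc (-2) 2) with hκ
  have hq1 : ‖sc w‖ < 1 := norm_sc_lt_one hw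
  have hF : ∀ n : ℕ, Integrable (fun t : ℝ => (sinPow n t : ℂ) * sc w ^ n) κ := fun n =>
    ((Complex.continuous_ofReal.comp (continuous_sinPow n)).mul continuous_const).continuousOn.integrableOn_Icc
  have hs : Summable fun n : ℕ => ∫ t, ‖(sinPow n t : ℂ) * sc w ^ n‖ ∂κ := by
    refine Summable.of_nonneg_of_le (fun n => integral_nonneg fun t => norm_nonneg _) (fun n => ?_)
      ((summable_geometric_of_lt_one (norm_nonneg _) hq1).mul_left 4)
    calc ∫ t, ‖(sinPow n t : ℂ) * sc w ^ n‖ ∂κ ≤ ∫ _t, ‖sc w‖ ^ n ∂κ := by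
          refine integral_mono (hF n).norm (integrable_const _) fun t => ?_
          simp only [norm_mul, norm_pow, Complex.norm_real]
          exact mul_le_of_le_one_left (by positivity) (abs_sinPow_le_one n t)
      _ = 4 * ‖sc w‖ ^ n := by
          rw [integral_const, hκ]; simp [Measure.real]; norm_num
  have hsum : ∀ᵐ t ∂κ, HasSum (fun n : ℕ => (sinPow n t : ℂ) * sc w ^ n)
      (((√(4 - t ^ 2) / 2 : ℝ) : ℂ) / (sc w * (t - w))) := by
    filter_upwards [ae_restrict_mem measurableSet_Icc] with t ht using hasSum_sinPow ht hw
  have h := (integrable_and_hasSum_integral hF hs hsum).2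
  have hterm : ∀ n : ℕ, ∫ t, (sinPow n t : ℂ) * sc w ^ n ∂κ = if n = 0 then (Real.pi : ℂ) else 0 := by
    intro n
    rw [integral_mul_const, integral_complex_ofReal]
    rw [hκ, integral_Icc_eq_integral_Ioc, ← intervalIntegral.integral_of_le (by norm_num)]
    cases n with
    | zero => simp [integral_sinPow_zero]
    | succ n => simp [integral_sinPow_succ]
  simp only [hterm] at h
  have h2 := h.unique (hasSum_ite_eq 0 (Real.pi : ℂ))
  have hq0 := sc_ne_zero w
  have hpi : (Real.pi : ℂ) ≠ 0 := by exact_mod_cast Real.pi_ne_zero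
  have h3 : msc w = sc w / Real.pi * ∫ t, ((√(4 - t ^ 2) / 2 : ℝ) : ℂ) / (sc w * (t - w)) ∂κ := by
    rw [msc, ← integral_const_mul]
    congr 1
    funext t
    push_cast
    field_simp
  rw [h3, h2]
  field_simp

lemma mscBoundary_eq_sc (x : ℝ) : mscBoundary x = sc x := by
  have h := continuousAt_sc_vertical (z := (x : ℂ)) (by simp)
  have h1 : Tendsto (fun t : ℝ => sc (x + t * Complex.I)) (𝓝[>] 0) (𝓝 (sc x)) := by
    have := h.tendsto.mono_left (nhdsWithin_le_nhds (s := Set.Ioi 0))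
    simpa using this
  refine Tendsto.limUnder_eq (h1.congr' ?_)
  filter_upwards [self_mem_nhdsWithin] with t ht
  rw [msc_eq_sc]
  simpa using ht

/-! ### Double integrals over the square -/

/-- Lebesgue measure on `[-2, 2]`. -/
noncomputable def specMeasure : Measure ℝ := volume.restrict (Set.Icc (-2) 2)

instance : IsFiniteMeasure specMeasure := by unfold specMeasure; infer_instance

lemma volume_restrict_square :
    (volume : Measure (ℝ × ℝ)).restrict square = specMeasure.prod specMeasure := by
  rw [specMeasure, Measure.volume_eq_prod, Measure.prod_restrict]; rfl

lemma measurableSet_square : MeasurableSet square := measurableSet_Icc.prod measurableSet_Icc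

lemma ae_mem_square : ∀ᵐ p ∂(specMeasure.prod specMeasure), p ∈ square := by
  rw [← volume_restrict_square]
  exact ae_restrict_mem measurableSet_square

lemma ae_mem_specMeasure : ∀ᵐ x ∂specMeasure, x ∈ Set.Icc (-2 : ℝ) 2 :=
  ae_restrict_mem measurableSet_Icc

lemma integral_specMeasure (u : ℝ → ℝ) : ∫ x, u x ∂specMeasure = ∫ x in (-2 : ℝ)..2, u x := by
  rw [specMeasure, integral_Icc_eq_integral_Ioc, intervalIntegral.integral_of_le (by norm_num)]

lemma integrable_specMeasure {u : ℝ → ℝ} (hu : Continuous u) : Integrable u specMeasure :=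
  hu.continuousOn.integrableOn_Icc

lemma integrable_weight : Integrable (fun p : ℝ × ℝ => 1 / √(4 - p.1 ^ 2))
    (specMeasure.prod specMeasure) := by
  have h : Integrable (fun x : ℝ => 1 / √(4 - x ^ 2)) specMeasure := integrableOn_inv_sqrt
  have h2 := h.mul_prod (integrable_const (1 : ℝ) (μ := specMeasure))
  simpa using h2

lemma integrable_div_weight {b : ℝ × ℝ → ℝ} {M : ℝ}
    (hb : AEStronglyMeasurable b (specMeasure.prod specMeasure))
    (hM : ∀ᵐ p ∂(specMeasure.prod specMeasure), |b p| ≤ M) :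
    Integrable (fun p => b p / √(4 - p.1 ^ 2)) (specMeasure.prod specMeasure) := by
  have := integrable_weight.bdd_mul (c := M) hb hM
  simpa [div_eq_mul_inv] using this

section

variable {f : ℝ → ℝ}

/-- Outside [-2,2] the boundary value of m is real, so only the spectrum contributes. -/
lemma Phi_zero_im (hf : ContDiff ℝ 2 f) (hc : HasCompactSupport f) (n : ℕ) :
    (Phi f n 0).im = ∫ x, deriv f x * sinPow n x ∂specMeasure := by
  have h1 : Phi f n 0 = ∫ x : ℝ, ((deriv f x : ℝ) : ℂ) * scPow n x := by simp [Phi, horiz]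
  have h2 : Integrable fun x : ℝ => ((deriv f x : ℝ) : ℂ) * scPow n x := by
    simpa using integrable_mul_scPow (integrable_deriv_test hf hc) n le_rfl
  have h3 : (Phi f n 0).im = ∫ x, deriv f x * sinPow n x := by
    rw [h1]
    have := integral_im h2
    simp only [RCLike.im_to_complex, Complex.im_ofReal_mul] at this
    exact this.symm
  rw [h3, specMeasure, setIntegral_eq_integral_of_forall_compl_eq_zero]
  intro x hx
  rw [sinPow_eq_zero, mul_zero]
  by_contra! h
  exact hx ⟨by nlinarith, by nlinarith⟩

/-- The kernel representing `(Phi f n 0).im ^ 2 / (n + 1)`. -/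
noncomputable def sqKernel (f : ℝ → ℝ) (n : ℕ) (p : ℝ × ℝ) : ℝ :=
  -((f p.1 - f p.2) * deriv f p.2 * (cosPow n p.1 * sinPow n p.2) / √(4 - p.1 ^ 2))

lemma abs_sub_le_of_deriv (hf : ContDiff ℝ 2 f) (hc : HasCompactSupport f) (x y : ℝ) :
    |f x - f y| ≤ (∫ t, |deriv (deriv f) t|) * |x - y| := by
  have := Convex.norm_image_sub_le_of_norm_deriv_le (f := f) (s := Set.univ)
    (C := ∫ t, |deriv (deriv f) t|) (x := y) (y := x)
    (fun z _ => (hasDerivAt_test hf z).differentiableAt)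
    (fun z _ => abs_deriv_le_integral hf hc z) convex_univ trivial trivial
  simpa using this

lemma abs_sub_mul_deriv_le (hf : ContDiff ℝ 2 f) (hc : HasCompactSupport f) {p : ℝ × ℝ}
    (hp : p ∈ square) :
    |(f p.1 - f p.2) * deriv f p.2| ≤ 4 * (∫ t, |deriv (deriv f) t|) ^ 2 := by
  have h1 := abs_sub_le_of_deriv hf hc p.1 p.2
  have h2 := abs_deriv_le_integral hf hc p.2
  have h0 : 0 ≤ ∫ t, |deriv (deriv f) t| := integral_nonneg fun t => abs_nonneg _
  have h3 : |p.1 - p.2| ≤ 4 := by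
    rw [abs_le]; constructor <;> linarith [hp.1.1, hp.1.2, hp.2.1, hp.2.2]
  rw [abs_mul]
  calc |f p.1 - f p.2| * |deriv f p.2|
      ≤ ((∫ t, |deriv (deriv f) t|) * 4) * ∫ t, |deriv (deriv f) t| := by
        gcongr
        exact h1.trans (by gcongr)
    _ = _ := by ring

lemma continuous_sub_mul_deriv (hf : ContDiff ℝ 2 f) :
    Continuous fun p : ℝ × ℝ => (f p.1 - f p.2) * deriv f p.2 := by
  have h1 := hf.continuous
  have h2 := continuous_deriv_test hf
  fun_prop

lemma integrable_sqKernel (hf : ContDiff ℝ 2 f) (hc : HasCompactSupport f) (n : ℕ) :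
    Integrable (sqKernel f n) (specMeasure.prod specMeasure) := by
  refine (integrable_div_weight (M := 4 * (∫ t, |deriv (deriv f) t|) ^ 2) ?_ ?_).neg
  · have h1 := continuous_sub_mul_deriv hf
    have h3 := continuous_sinPow n
    have h4 := continuous_cosPow n
    exact Continuous.aestronglyMeasurable (by fun_prop)
  · filter_upwards [ae_mem_square] with p hp
    rw [abs_mul]
    refine (mul_le_of_le_one_right (abs_nonneg _) ?_).trans (abs_sub_mul_deriv_le hf hc hp)
    rw [abs_mul]
    exact mul_le_one₀ (abs_cosPow_le_one _ _) (abs_nonneg _) (abs_sinPow_le_one _ _)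

/-- One factor q_n is recovered by integrating by parts in x, with f(y) as the free constant in the
primitive of f'; the y-integral supplies the other. -/
lemma integral_sqKernel (hf : ContDiff ℝ 2 f) (hc : HasCompactSupport f) (n : ℕ) :
    ∫ p, sqKernel f n p ∂(specMeasure.prod specMeasure) = (Phi f n 0).im ^ 2 / (n + 1) := by
  rw [integral_prod_symm _ (integrable_sqKernel hf hc n)]
  have hn : (n + 1 : ℝ) ≠ 0 := by positivity
  have h1 : ∀ y, ∫ x, sqKernel f n (x, y) ∂specMeasure
      = (Phi f n 0).im / (n + 1) * (deriv f y * sinPow n y) := by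
    intro y
    have h2 := integral_deriv_mul_sinPow (u := fun x => f x - f y) (u' := deriv f)
      (fun x => (hasDerivAt_test hf x).sub_const _) (continuous_deriv_test hf) n
    rw [← integral_specMeasure, ← Phi_zero_im hf hc, ← integral_specMeasure] at h2
    have h3 : ∀ x, sqKernel f n (x, y)
        = -(deriv f y * sinPow n y) * ((f x - f y) * cosPow n x / √(4 - x ^ 2)) := by
      intro x; simp only [sqKernel]; ring
    simp only [h3]
    rw [integral_const_mul, h2]
    field_simp
  simp only [h1]
  rw [integral_const_mul, ← Phi_zero_im hf hc]
  ring

/-! ### The main term by Abel summation -/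

lemma norm_one_sub_real_mul_sq (r : ℝ) {v : ℂ} (hv : ‖v‖ = 1) :
    ‖1 - r * v‖ ^ 2 = (1 - r) ^ 2 + r * ‖1 - v‖ ^ 2 := by
  have h1 : v.re * v.re + v.im * v.im = 1 := by
    have := Complex.normSq_eq_norm_sq v
    rw [hv, Complex.normSq_apply] at this
    linarith
  rw [← Complex.normSq_eq_norm_sq, ← Complex.normSq_eq_norm_sq, Complex.normSq_apply,
    Complex.normSq_apply]
  simp only [Complex.sub_re, Complex.one_re, Complex.re_ofReal_mul, Complex.sub_im, Complex.one_im,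
    Complex.im_ofReal_mul]
  linear_combination (r ^ 2 - r) * h1

/-- The conjugate Poisson kernel is bounded by the inverse distance to its singularity, uniformly in
r, because |1 - rv|² ≥ r|1 - v|² and |Im v| ≤ |1 - v|. -/
lemma abs_im_mul_norm_le {r : ℝ} (h0 : 0 < r) {v : ℂ} (hv : ‖v‖ = 1) :
    |(r * v / (1 - r * v)).im| * ‖1 - v‖ ≤ 1 := by
  by_cases hv1 : v = 1
  · simp [hv1]
  have hpos : 0 < ‖1 - v‖ := norm_pos_iff.2 (sub_ne_zero.2 (Ne.symm hv1))
  have h1 := norm_one_sub_real_mul_sq r hv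
  have h2 : 0 < ‖1 - r * v‖ ^ 2 := by rw [h1]; positivity
  have hvv : v.re * v.re + v.im * v.im = 1 := by
    have := Complex.normSq_eq_norm_sq v
    rw [hv, Complex.normSq_apply] at this
    linarith
  have h3 : (r * v / (1 - r * v)).im = r * v.im / ‖1 - r * v‖ ^ 2 := by
    rw [Complex.div_im, Complex.normSq_eq_norm_sq, ← sub_div]
    congr 1
    simp only [Complex.sub_re, Complex.one_re, Complex.re_ofReal_mul, Complex.sub_im,
      Complex.one_im, Complex.im_ofReal_mul]
    ring
  have h4 : |v.im| ≤ ‖1 - v‖ := by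
    have := Complex.abs_im_le_norm (1 - v)
    simpa using this
  rw [h3, abs_div, abs_of_pos h2, abs_mul, abs_of_pos h0, div_mul_eq_mul_div, div_le_one h2, h1]
  have : r * |v.im| * ‖1 - v‖ ≤ r * ‖1 - v‖ ^ 2 := by
    rw [pow_two, mul_assoc]; gcongr
  nlinarith [sq_nonneg (1 - r)]

/-- The Abel means of `∑ cosPow n x * sinPow n y`. -/
noncomputable def abelKernel (r x y : ℝ) : ℝ :=
  ((r * (sc x * sc y) / (1 - r * (sc x * sc y))).im
    + (r * ((starRingEnd ℂ) (sc x) * sc y) / (1 - r * ((starRingEnd ℂ) (sc x) * sc y))).im) / 2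

lemma hasSum_im_geometric {r : ℝ} (h0 : 0 ≤ r) (h1 : r < 1) {v : ℂ} (hv : ‖v‖ = 1) :
    HasSum (fun n : ℕ => r ^ (n + 1) * (v ^ (n + 1)).im) (r * v / (1 - r * v)).im := by
  have h2 : ‖(r : ℂ) * v‖ < 1 := by
    rw [norm_mul, hv, mul_one, Complex.norm_real, Real.norm_of_nonneg h0]; exact h1
  have h3 := Complex.imCLM.hasSum ((hasSum_geometric_of_norm_lt_one h2).mul_left (r * v))
  rw [← div_eq_mul_inv] at h3
  refine h3.congr_fun fun n => ?_
  simp only [Complex.imCLM_apply]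
  rw [← pow_succ', mul_pow, ← Complex.ofReal_pow, Complex.im_ofReal_mul]

/-- The product formula for cos · sin turns the sum into two geometric series, with ratios built
from m(x)m(y) and conj(m(x))m(y). -/
lemma hasSum_abelKernel {r x y : ℝ} (h0 : 0 ≤ r) (h1 : r < 1) (hx : x ∈ Set.Icc (-2 : ℝ) 2)
    (hy : y ∈ Set.Icc (-2 : ℝ) 2) :
    HasSum (fun n : ℕ => r ^ (n + 1) * (cosPow n x * sinPow n y)) (abelKernel r x y) := by
  have hv1 : ‖sc x * sc y‖ = 1 := by rw [norm_mul, norm_sc_ofReal hx, norm_sc_ofReal hy, one_mul]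
  have hv2 : ‖(starRingEnd ℂ) (sc x) * sc y‖ = 1 := by
    rw [norm_mul, Complex.norm_conj, norm_sc_ofReal hx, norm_sc_ofReal hy, one_mul]
  have h := ((hasSum_im_geometric h0 h1 hv1).add (hasSum_im_geometric h0 h1 hv2)).div_const 2
  refine h.congr_fun fun n => ?_
  rw [mul_pow, mul_pow, ← map_pow]
  simp only [Complex.mul_im, Complex.conj_re, Complex.conj_im, cosPow, sinPow, scPow]
  ring

lemma one_sub_mul_one_sub {x y : ℝ} (hx : x ∈ Set.Icc (-2 : ℝ) 2) :
    (1 - sc x * sc y) * (1 - (starRingEnd ℂ) (sc x) * sc y) = sc y * (x - y) := by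
  have hpp : sc x * (starRingEnd ℂ) (sc x) = 1 := by
    rw [Complex.mul_conj, Complex.normSq_eq_norm_sq, norm_sc_ofReal hx]; norm_num
  have hsum : sc x + (starRingEnd ℂ) (sc x) = -x := by
    rw [Complex.add_conj, sc_ofReal_re hx]; push_cast; ring
  linear_combination (sc y) ^ 2 * hpp - sc y * hsum + sc_quadratic y

/-- Each conjugate Poisson kernel is singular in only one of the two factors of |x - y| = |1 - v₁||1
- v₂|, and the other factor is at most 2. This uniform bound is the domination needed as r → 1. -/
lemma abs_sub_mul_abelKernel_le {r x y : ℝ} (h0 : 0 < r) (hx : x ∈ Set.Icc (-2 : ℝ) 2)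
    (hy : y ∈ Set.Icc (-2 : ℝ) 2) : |x - y| * |abelKernel r x y| ≤ 2 := by
  set v₁ := sc x * sc y with h_v1
  set v₂ := (starRingEnd ℂ) (sc x) * sc y with h_v2
  have hv1 : ‖v₁‖ = 1 := by rw [h_v1, norm_mul, norm_sc_ofReal hx, norm_sc_ofReal hy, one_mul]
  have hv2 : ‖v₂‖ = 1 := by
    rw [h_v2, norm_mul, Complex.norm_conj, norm_sc_ofReal hx, norm_sc_ofReal hy, one_mul]
  have hprod : |x - y| = ‖1 - v₁‖ * ‖1 - v₂‖ := by
    have := congrArg norm (one_sub_mul_one_sub (y := y) hx)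
    rw [norm_mul, norm_mul, norm_sc_ofReal hy, one_mul, ← Complex.ofReal_sub,
      Complex.norm_real] at this
    exact this.symm
  have b1 := abs_im_mul_norm_le h0 hv1
  have b2 := abs_im_mul_norm_le h0 hv2
  have n1 : ‖1 - v₁‖ ≤ 2 := (norm_sub_le _ _).trans (by rw [hv1, norm_one]; norm_num)
  have n2 : ‖1 - v₂‖ ≤ 2 := (norm_sub_le _ _).trans (by rw [hv2, norm_one]; norm_num)
  have hk : |abelKernel r x y| ≤ (|(r * v₁ / (1 - r * v₁)).im| + |(r * v₂ / (1 - r * v₂)).im|) / 2 := by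
    rw [abelKernel, abs_div, abs_two]
    gcongr
    exact abs_add_le _ _
  calc |x - y| * |abelKernel r x y|
      ≤ (‖1 - v₁‖ * ‖1 - v₂‖) * ((|(r * v₁ / (1 - r * v₁)).im| + |(r * v₂ / (1 - r * v₂)).im|) / 2) := by
        rw [hprod]; gcongr
    _ = ((|(r * v₁ / (1 - r * v₁)).im| * ‖1 - v₁‖) * ‖1 - v₂‖
          + (|(r * v₂ / (1 - r * v₂)).im| * ‖1 - v₂‖) * ‖1 - v₁‖) / 2 := by ring
    _ ≤ (1 * 2 + 1 * 2) / 2 := by gcongr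
    _ = 2 := by norm_num

lemma tendsto_abelKernel {x y : ℝ} (hx : x ∈ Set.Icc (-2 : ℝ) 2)
    (hy : y ∈ Set.Icc (-2 : ℝ) 2) (hxy : x ≠ y) :
    Tendsto (fun r => abelKernel r x y) (𝓝[<] 1) (𝓝 (-(√(4 - y ^ 2) / (2 * (x - y))))) := by
  set v₁ := sc x * sc y with h_v1
  set v₂ := (starRingEnd ℂ) (sc x) * sc y with h_v2
  have hprod := one_sub_mul_one_sub (y := y) hx
  have hne : sc y * ((x : ℂ) - y) ≠ 0 :=
    mul_ne_zero (sc_ne_zero _) (sub_ne_zero.2 (by exact_mod_cast hxy))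
  rw [← hprod] at hne
  have ne1 : 1 - v₁ ≠ 0 := left_ne_zero_of_mul hne
  have ne2 : 1 - v₂ ≠ 0 := right_ne_zero_of_mul hne
  have hcont : ∀ v : ℂ, 1 - v ≠ 0 →
      ContinuousAt (fun r : ℝ => ((r : ℂ) * v / (1 - r * v)).im) 1 := by
    intro v hv
    refine Complex.continuous_im.continuousAt.comp (ContinuousAt.div (by fun_prop) (by fun_prop) ?_)
    simpa using hv
  have h := (((hcont v₁ ne1).add (hcont v₂ ne2)).div_const 2).tendsto.mono_left
    (nhdsWithin_le_nhds (s := Set.Iio 1))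
  suffices heq : -(√(4 - y ^ 2) / (2 * (x - y))) = ((v₁ / (1 - v₁)).im + (v₂ / (1 - v₂)).im) / 2 by
    rw [heq]
    simp only [Complex.ofReal_one, one_mul, Pi.add_apply] at h
    exact h
  have hsum : v₁ + v₂ = -x * sc y := by
    rw [h_v1, h_v2, ← add_mul, Complex.add_conj, sc_ofReal_re hx]; push_cast; ring
  have hbb : sc y * (starRingEnd ℂ) (sc y) = 1 := by
    rw [Complex.mul_conj, Complex.normSq_eq_norm_sq, norm_sc_ofReal hy]; norm_num
  have hxyc : (x : ℂ) - y ≠ 0 := sub_ne_zero.2 (by exact_mod_cast hxy)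
  have h5 : v₁ / (1 - v₁) + v₂ / (1 - v₂)
      = ((1 / (x - y) : ℝ) : ℂ) * (2 * (starRingEnd ℂ) (sc y) + x) - 2 := by
    have h6 : v₁ / (1 - v₁) + v₂ / (1 - v₂) = (2 - (v₁ + v₂)) / ((1 - v₁) * (1 - v₂)) - 2 := by
      rw [div_add_div _ _ ne1 ne2, div_sub' hne]
      congr 1; ring
    rw [h6, hprod, hsum]
    have := sc_ne_zero y
    push_cast
    field_simp
    linear_combination (-2 : ℂ) * hbb
  rw [← Complex.add_im, h5, Complex.sub_im, Complex.im_ofReal_mul]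
  simp only [Complex.add_im, Complex.mul_im, Complex.conj_im,
    Complex.conj_re, Complex.re_ofNat, Complex.im_ofNat, Complex.ofReal_im, sc_ofReal_im]
  have : x - y ≠ 0 := sub_ne_zero.2 hxy
  field_simp
  ring

/-- Abel summation. For r < 1 the series is integrated termwise; as r → 1 the kernel tends to the
difference quotient kernel, dominated because |f(x) - f(y)| ≤ ‖f''‖₁|x - y| absorbs its singularity.
The coefficients are nonnegative, so bounded Abel means already give summability and the Abel limit
is the sum. -/
lemma hasSum_mainTerm (hf : ContDiff ℝ 2 f) (hc : HasCompactSupport f) :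
    HasSum (fun n : ℕ => 2 / Real.pi ^ 2 * ((Phi f n 0).im ^ 2 / (n + 1))) (mainTerm f) := by
  set M := ∫ t, |deriv (deriv f) t| with hM
  have hM0 : 0 ≤ M := integral_nonneg fun t => abs_nonneg _
  set κ₂ := specMeasure.prod specMeasure with hκ
  set q : ℕ → ℝ := fun n => (Phi f n 0).im ^ 2 / (n + 1) with hq
  have hq0 : ∀ n, 0 ≤ q n := fun n => by simp only [hq]; positivity
  set K : ℝ → ℝ × ℝ → ℝ := fun r p =>
    -((f p.1 - f p.2) * deriv f p.2 * abelKernel r p.1 p.2 / √(4 - p.1 ^ 2)) with hK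
  have hbound : ∀ r, 0 < r → ∀ᵐ p ∂κ₂, ‖K r p‖ ≤ 2 * M ^ 2 * (1 / √(4 - p.1 ^ 2)) := by
    intro r hr
    filter_upwards [ae_mem_square] with p hp
    have h1 := abs_sub_mul_abelKernel_le hr hp.1 hp.2
    have h2 := abs_sub_le_of_deriv hf hc p.1 p.2
    have h3 := abs_deriv_le_integral hf hc p.2
    simp only [hK]
    rw [norm_neg, Real.norm_eq_abs, abs_div, abs_mul, abs_mul, abs_of_nonneg (Real.sqrt_nonneg _),
      div_eq_mul_one_div]
    refine mul_le_mul_of_nonneg_right ?_ (by positivity)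
    calc |f p.1 - f p.2| * |deriv f p.2| * |abelKernel r p.1 p.2|
        ≤ (M * |p.1 - p.2|) * M * |abelKernel r p.1 p.2| := by gcongr
      _ = M ^ 2 * (|p.1 - p.2| * |abelKernel r p.1 p.2|) := by ring
      _ ≤ M ^ 2 * 2 := by gcongr
      _ = 2 * M ^ 2 := by ring
  have hsum : ∀ r, 0 < r → r < 1 → HasSum (fun n : ℕ => r ^ (n + 1) * q n) (∫ p, K r p ∂κ₂) ∧
      Integrable (K r) κ₂ := by
    intro r hr hr1
    have hs : Summable fun n : ℕ => ∫ p, ‖r ^ (n + 1) * sqKernel f n p‖ ∂κ₂ := by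
      refine Summable.of_nonneg_of_le (fun n => integral_nonneg fun p => norm_nonneg _) (fun n => ?_)
        ((summable_geometric_of_lt_one hr.le hr1).mul_left
          (∫ p : ℝ × ℝ, 4 * M ^ 2 * (1 / √(4 - p.1 ^ 2)) ∂κ₂))
      have hC0 : 0 ≤ ∫ p : ℝ × ℝ, 4 * M ^ 2 * (1 / √(4 - p.1 ^ 2)) ∂κ₂ :=
        integral_nonneg fun p => by positivity
      have hle : ∫ p, ‖sqKernel f n p‖ ∂κ₂ ≤ ∫ p : ℝ × ℝ, 4 * M ^ 2 * (1 / √(4 - p.1 ^ 2)) ∂κ₂ := by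
        refine integral_mono_ae (integrable_sqKernel hf hc n).norm (integrable_weight.const_mul _) ?_
        filter_upwards [ae_mem_square] with p hp
        simp only [sqKernel]
        rw [norm_neg, Real.norm_eq_abs, abs_div, abs_mul, abs_of_nonneg (Real.sqrt_nonneg _),
          div_eq_mul_one_div]
        refine mul_le_mul_of_nonneg_right ?_ (by positivity)
        refine (mul_le_of_le_one_right (abs_nonneg _) ?_).trans (abs_sub_mul_deriv_le hf hc hp)
        rw [abs_mul]
        exact mul_le_one₀ (abs_cosPow_le_one _ _) (abs_nonneg _) (abs_sinPow_le_one _ _)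
      simp only [norm_mul, norm_pow, Real.norm_of_nonneg hr.le]
      rw [integral_const_mul, mul_comm]
      have : r ^ (n + 1) ≤ r ^ n := pow_le_pow_of_le_one hr.le hr1.le (Nat.le_succ n)
      exact mul_le_mul hle this (by positivity) hC0
    have h := integrable_and_hasSum_integral (ν := κ₂) (G := K r)
      (fun n => (integrable_sqKernel hf hc n).const_mul (r ^ (n + 1))) hs ?_
    · refine ⟨h.2.congr_fun fun n => ?_, h.1⟩
      rw [integral_const_mul, integral_sqKernel hf hc]
    · filter_upwards [ae_mem_square] with p hp
      have h1 := (hasSum_abelKernel hr.le hr1 hp.1 hp.2).mul_left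
        (-((f p.1 - f p.2) * deriv f p.2 / √(4 - p.1 ^ 2)))
      have h2 : -((f p.1 - f p.2) * deriv f p.2 / √(4 - p.1 ^ 2)) * abelKernel r p.1 p.2
          = K r p := by simp only [hK]; ring
      rw [h2] at h1
      refine h1.congr_fun fun n => ?_
      simp only [sqKernel]; ring
  have hIbound : ∀ r, 0 < r → ∫ p, K r p ∂κ₂ ≤ ∫ p : ℝ × ℝ, 2 * M ^ 2 * (1 / √(4 - p.1 ^ 2)) ∂κ₂ := by
    intro r hr
    refine (le_abs_self _).trans ?_
    exact norm_integral_le_of_norm_le (integrable_weight.const_mul _) (hbound r hr)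
  have hqsum : Summable q := by
    refine summable_of_sum_range_le hq0 (c := ∫ p : ℝ × ℝ, 2 * M ^ 2 * (1 / √(4 - p.1 ^ 2)) ∂κ₂)
      fun k => ?_
    have hc1 : Tendsto (fun r : ℝ => ∑ n ∈ Finset.range k, r ^ (n + 1) * q n) (𝓝[<] 1)
        (𝓝 (∑ n ∈ Finset.range k, 1 ^ (n + 1) * q n)) := by
      refine Tendsto.mono_left (Continuous.tendsto ?_ 1) nhdsWithin_le_nhds
      fun_prop
    simp only [one_pow, one_mul] at hc1
    refine le_of_tendsto hc1 ?_
    filter_upwards [Ioo_mem_nhdsLT (show (0 : ℝ) < 1 by norm_num)] with r hr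
    refine le_trans ?_ (hIbound r hr.1)
    refine sum_le_hasSum _ (fun n _ => ?_) (hsum r hr.1 hr.2).1
    have := hr.1
    have := hq0 n
    positivity
  have hlim1 : Tendsto (fun r : ℝ => ∑' n, r ^ (n + 1) * q n) (𝓝[<] 1) (𝓝 (∑' n, q n)) := by
    refine tendsto_tsum_of_dominated_convergence hqsum (fun n => ?_) ?_
    · have : Tendsto (fun r : ℝ => r ^ (n + 1) * q n) (𝓝[<] 1) (𝓝 (1 ^ (n + 1) * q n)) := by
        refine Tendsto.mono_left (Continuous.tendsto ?_ 1) nhdsWithin_le_nhds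
        fun_prop
      simpa using this
    · filter_upwards [Ioo_mem_nhdsLT (show (0 : ℝ) < 1 by norm_num)] with r hr n
      rw [norm_mul, norm_pow, Real.norm_of_nonneg hr.1.le, Real.norm_of_nonneg (hq0 n)]
      exact mul_le_of_le_one_left (hq0 n) (pow_le_one₀ hr.1.le hr.2.le)
  have hlim2 : Tendsto (fun r : ℝ => ∫ p, K r p ∂κ₂) (𝓝[<] 1)
      (𝓝 (∫ p : ℝ × ℝ, 1 / 2 * ((f p.1 - f p.2) / (p.1 - p.2) * deriv f p.2 *
        (√(4 - p.2 ^ 2) / √(4 - p.1 ^ 2))) ∂κ₂)) := by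
    refine tendsto_integral_filter_of_dominated_convergence
      (fun p : ℝ × ℝ => 2 * M ^ 2 * (1 / √(4 - p.1 ^ 2))) ?_ ?_ (integrable_weight.const_mul _) ?_
    · filter_upwards [Ioo_mem_nhdsLT (show (0 : ℝ) < 1 by norm_num)] with r hr
      exact (hsum r hr.1 hr.2).2.aestronglyMeasurable
    · filter_upwards [Ioo_mem_nhdsLT (show (0 : ℝ) < 1 by norm_num)] with r hr
      exact hbound r hr.1
    · filter_upwards [ae_mem_square] with p hp
      -- On the diagonal both sides vanish through the factor f(x) - f(y), so the junk value of the
      -- division by zero does not matter.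
      by_cases hxy : p.1 = p.2
      · simp [hK, hxy]
      · have h1 := ((tendsto_abelKernel hp.1 hp.2 hxy).const_mul
          ((f p.1 - f p.2) * deriv f p.2)).div_const (√(4 - p.1 ^ 2)) |>.neg
        convert! h1 using 2
        have hd : p.1 - p.2 ≠ 0 := sub_ne_zero.2 hxy
        field_simp
  have hev : (fun r : ℝ => ∑' n, r ^ (n + 1) * q n) =ᶠ[𝓝[<] 1] fun r => ∫ p, K r p ∂κ₂ := by
    filter_upwards [Ioo_mem_nhdsLT (show (0 : ℝ) < 1 by norm_num)] with r hr
    exact (hsum r hr.1 hr.2).1.tsum_eq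
  have heq := tendsto_nhds_unique (hlim1.congr' hev) hlim2
  have hfinal := hqsum.hasSum.mul_left (2 / Real.pi ^ 2)
  rw [heq, integral_const_mul] at hfinal
  convert! hfinal using 1
  rw [mainTerm, volume_restrict_square]
  ring

end

/-! ### The kernel `h` -/

/-- The derivative in `x` of `sinPow n x * (a / (a + b)) / (n + 1)`, where `a = 4 - x ^ 2` and
`b = 4 - y ^ 2`. -/
noncomputable def corrDeriv (n : ℕ) (x y : ℝ) : ℝ :=
  cosPow n x * (√(4 - x ^ 2) / ((4 - x ^ 2) + (4 - y ^ 2)))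
    - 2 * x * (4 - y ^ 2) * sinPow n x / ((n + 1) * ((4 - x ^ 2) + (4 - y ^ 2)) ^ 2)

/-- The kernel whose integral against `(f x - f y) * f' y` is
`2 / π ^ 2 * (Phi f n 0).im ^ 2 / (n + 1)`. -/
noncomputable def corrKernel (n : ℕ) : ℝ × ℝ → ℝ :=
  square.indicator fun p => -(4 / Real.pi ^ 2) * (sinPow n p.2 * corrDeriv n p.1 p.2)

lemma measurable_corrKernel (n : ℕ) : Measurable (corrKernel n) := by
  refine Measurable.indicator ?_ measurableSet_square
  have h1 := (continuous_sinPow n).measurable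
  have h2 := (continuous_cosPow n).measurable
  unfold corrDeriv
  fun_prop

lemma sqrt_mul_sqrt_div_le {a b : ℝ} (ha : 0 ≤ a) (hb : 0 ≤ b) : √a * √b / (a + b) ≤ 1 / 2 := by
  rcases (add_nonneg ha hb).eq_or_lt with h | h
  · rw [← h]; norm_num
  · rw [div_le_iff₀ h]
    nlinarith [sq_nonneg (√a - √b), Real.sq_sqrt ha, Real.sq_sqrt hb]

/-- The kernel `sqKernel` has an inverse square root singularity at the edges and would not give a
bounded h. Here |sin((n+1)θ_y)| ≤ (n+1)√b/2 pairs with √a/(a+b), and √a√b ≤ (a+b)/2. Linear growth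
in n is harmless against ρ^n. -/
lemma abs_sinPow_mul_corrDeriv_le (n : ℕ) {x y : ℝ} (hx : x ∈ Set.Icc (-2 : ℝ) 2)
    (hy : y ∈ Set.Icc (-2 : ℝ) 2) : |sinPow n y * corrDeriv n x y| ≤ n + 1 := by
  set a := 4 - x ^ 2 with ha
  set b := 4 - y ^ 2 with hb
  have ha0 : 0 ≤ a := by rw [ha]; nlinarith [hx.1, hx.2]
  have hb0 : 0 ≤ b := by rw [hb]; nlinarith [hy.1, hy.2]
  have hx2 : |x| ≤ 2 := abs_le.2 hx
  have hab := sqrt_mul_sqrt_div_le ha0 hb0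
  have hab0 : 0 ≤ √a * √b / (a + b) := by positivity
  have hb1 : b / (a + b) ≤ 1 := div_le_one_of_le₀ (by linarith) (by positivity)
  have hs1 := abs_sinPow_le n x
  have hs2 := abs_sinPow_le n y
  rw [← ha] at hs1
  rw [← hb] at hs2
  have hc := abs_cosPow_le_one n x
  have h1 : |sinPow n y * (cosPow n x * (√a / (a + b)))| ≤ ((n : ℝ) + 1) * (1 / 4) := by
    rw [abs_mul, abs_mul, abs_of_nonneg (show 0 ≤ √a / (a + b) by positivity)]
    calc |sinPow n y| * (|cosPow n x| * (√a / (a + b)))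
        ≤ ((n + 1) * (√b / 2)) * (1 * (√a / (a + b))) := by gcongr
      _ = (n + 1) * ((√a * √b / (a + b)) / 2) := by ring
      _ ≤ (n + 1) * ((1 / 2) / 2) := by gcongr
      _ = _ := by ring
  have h2 : |sinPow n y * (2 * x * b * sinPow n x / ((n + 1) * (a + b) ^ 2))|
      ≤ ((n : ℝ) + 1) * (1 / 2) := by
    rw [abs_mul, abs_div, abs_mul, abs_mul, abs_mul, abs_two, abs_of_nonneg hb0,
      abs_of_nonneg (show 0 ≤ ((n : ℝ) + 1) * (a + b) ^ 2 by positivity)]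
    calc |sinPow n y| * (2 * |x| * b * |sinPow n x| / ((n + 1) * (a + b) ^ 2))
        ≤ ((n + 1) * (√b / 2)) * (2 * 2 * b * ((n + 1) * (√a / 2)) / ((n + 1) * (a + b) ^ 2)) := by
          gcongr
      _ = (n + 1) * ((b / (a + b)) * (√a * √b / (a + b))) := by
          have : (n + 1 : ℝ) ≠ 0 := by positivity
          field_simp
      _ ≤ (n + 1) * (1 * (1 / 2)) := by gcongr
      _ = _ := by ring
  have h3 : sinPow n y * corrDeriv n x y = sinPow n y * (cosPow n x * (√a / (a + b)))
      - sinPow n y * (2 * x * b * sinPow n x / ((n + 1) * (a + b) ^ 2)) := by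
    rw [corrDeriv]; ring
  rw [h3]
  refine (abs_sub _ _).trans ?_
  have : (0 : ℝ) ≤ n := n.cast_nonneg
  linarith

lemma abs_corrKernel_le (n : ℕ) (p : ℝ × ℝ) : |corrKernel n p| ≤ n + 1 := by
  unfold corrKernel
  by_cases hp : p ∈ square
  · rw [Set.indicator_of_mem hp, abs_mul, abs_neg]
    have h1 := abs_sinPow_mul_corrDeriv_le n hp.1 hp.2
    have h2 : |4 / Real.pi ^ 2| ≤ 1 := by
      rw [abs_of_nonneg (by positivity), div_le_one (by positivity)]
      nlinarith [Real.pi_gt_three]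
    calc |4 / Real.pi ^ 2| * |sinPow n p.2 * corrDeriv n p.1 p.2| ≤ 1 * (n + 1) := by gcongr
      _ = _ := one_mul _
  · rw [Set.indicator_of_notMem hp, abs_zero]; positivity

lemma hasDerivAt_corr (n : ℕ) {x y : ℝ} (hx : x ∈ Set.Ioo (-2 : ℝ) 2)
    (hy : y ∈ Set.Ioo (-2 : ℝ) 2) :
    HasDerivAt (fun x => sinPow n x * ((4 - x ^ 2) / ((4 - x ^ 2) + (4 - y ^ 2))))
      ((n + 1) * corrDeriv n x y) x := by
  have ha : 0 < 4 - x ^ 2 := by nlinarith [hx.1, hx.2]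
  have hb : 0 < 4 - y ^ 2 := by nlinarith [hy.1, hy.2]
  have h1 : HasDerivAt (fun x : ℝ => 4 - x ^ 2) (-(2 * x)) x := by
    simpa using (hasDerivAt_pow 2 x).const_sub 4
  have h2 := (hasDerivAt_sinPow n hx).mul (h1.div (h1.add_const (4 - y ^ 2)) (by positivity))
  refine h2.congr_deriv ?_
  simp only [corrDeriv, Pi.div_apply]
  have hsq : √(4 - x ^ 2) ^ 2 = 4 - x ^ 2 := Real.sq_sqrt ha.le
  have hs : √(4 - x ^ 2) ≠ 0 := (Real.sqrt_pos.2 ha).ne'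
  set a := 4 - x ^ 2
  set b := 4 - y ^ 2
  have hab : a + b ≠ 0 := by positivity
  have hn : (n + 1 : ℝ) ≠ 0 := by positivity
  have h3 : (n + 1) * cosPow n x / √a * (a / (a + b)) = (n + 1) * cosPow n x * (√a / (a + b)) := by
    nth_rewrite 2 [← hsq]
    field_simp
  rw [h3]
  field_simp
  ring

section

variable {f : ℝ → ℝ}

lemma integral_mul_corrDeriv (hf : ContDiff ℝ 2 f) (n : ℕ) {y : ℝ}
    (hy : y ∈ Set.Ioo (-2 : ℝ) 2) :
    ∫ x, (f x - f y) * ((n + 1) * corrDeriv n x y) ∂specMeasure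
      = -∫ x, deriv f x * (sinPow n x * ((4 - x ^ 2) / ((4 - x ^ 2) + (4 - y ^ 2))))
          ∂specMeasure := by
  have hb : 0 < 4 - y ^ 2 := by nlinarith [hy.1, hy.2]
  have hab : ∀ x ∈ Set.Icc (-2 : ℝ) 2, (4 - x ^ 2) + (4 - y ^ 2) ≠ 0 := by
    intro x hx
    have : 0 ≤ 4 - x ^ 2 := by nlinarith [hx.1, hx.2]
    positivity
  have h1 := continuous_sinPow n
  have h2 := continuous_cosPow n
  have hu : Set.uIcc (-2 : ℝ) 2 = Set.Icc (-2) 2 := Set.uIcc_of_le (by norm_num)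
  have h := intervalIntegral.integral_mul_deriv_eq_deriv_mul_of_hasDerivAt (a := -2) (b := 2)
    (u := fun x => f x - f y) (u' := deriv f)
    (v := fun x => sinPow n x * ((4 - x ^ 2) / ((4 - x ^ 2) + (4 - y ^ 2))))
    (v' := fun x => (n + 1) * corrDeriv n x y)
    (by have := hf.continuous; fun_prop) ?_ (fun x _ => (hasDerivAt_test hf x).sub_const _)
    (fun x hx => hasDerivAt_corr n (by norm_num at hx; exact hx) hy)
    ((continuous_deriv_test hf).intervalIntegrable _ _) ?_
  · rw [integral_specMeasure, integral_specMeasure, h, sinPow_eq_zero (by norm_num),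
      sinPow_eq_zero (by norm_num)]
    ring
  · rw [hu]
    exact h1.continuousOn.mul (ContinuousOn.div (by fun_prop) (by fun_prop) hab)
  · refine ContinuousOn.intervalIntegrable ?_
    rw [hu]
    unfold corrDeriv
    refine continuousOn_const.mul (ContinuousOn.sub
      (h2.continuousOn.mul (ContinuousOn.div (by fun_prop) (by fun_prop) hab))
      (ContinuousOn.div (by fun_prop) (by fun_prop) fun x hx => ?_))
    exact mul_ne_zero (by positivity) (pow_ne_zero _ (hab x hx))

lemma integrable_mul_corrKernel (hf : ContDiff ℝ 2 f) (n : ℕ) :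
    Integrable (fun p => (f p.1 - f p.2) * deriv f p.2 * corrKernel n p)
      (specMeasure.prod specMeasure) := by
  have h1 : Integrable (fun p : ℝ × ℝ => (f p.1 - f p.2) * deriv f p.2)
      (specMeasure.prod specMeasure) := by
    rw [← volume_restrict_square]
    exact (continuous_sub_mul_deriv hf).continuousOn.integrableOn_compact
      (isCompact_Icc.prod isCompact_Icc)
  exact h1.mul_bdd (c := n + 1) (measurable_corrKernel n).aestronglyMeasurable
    (ae_of_all _ fun p => abs_corrKernel_le n p)

/-- Integrating by parts in x yields the double integral of Ψ(x)Ψ(y)W(x,y). The weights W(x,y) and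
W(y,x) add up to 1, so by symmetry this is half of (∫Ψ)² = q_n². This symmetrization is the reason
for the weight a/(a+b). -/
lemma integral_mul_corrKernel (hf : ContDiff ℝ 2 f) (hc : HasCompactSupport f) (n : ℕ) :
    ∫ p, (f p.1 - f p.2) * deriv f p.2 * corrKernel n p ∂(specMeasure.prod specMeasure)
      = 2 / Real.pi ^ 2 * ((Phi f n 0).im ^ 2 / (n + 1)) := by
  set Ψ : ℝ → ℝ := fun x => deriv f x * sinPow n x with hΨ
  have hΨc : Continuous Ψ := (continuous_deriv_test hf).mul (continuous_sinPow n)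
  have hn : (n + 1 : ℝ) ≠ 0 := by positivity
  set W : ℝ × ℝ → ℝ := fun p => (4 - p.1 ^ 2) / ((4 - p.1 ^ 2) + (4 - p.2 ^ 2)) with hW
  have hWm : Measurable W := by simp only [hW]; fun_prop
  have hW1 : ∀ p ∈ square, |W p| ≤ 1 := by
    intro p hp
    have ha : 0 ≤ 4 - p.1 ^ 2 := by nlinarith [hp.1.1, hp.1.2]
    have hb : 0 ≤ 4 - p.2 ^ 2 := by nlinarith [hp.2.1, hp.2.2]
    rw [abs_of_nonneg (by simp only [hW]; positivity)]
    exact div_le_one_of_le₀ (by linarith) (by positivity)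
  have hΨi : Integrable (fun p : ℝ × ℝ => Ψ p.1 * Ψ p.2) (specMeasure.prod specMeasure) :=
    (integrable_specMeasure hΨc).mul_prod (integrable_specMeasure hΨc)
  have hJi : Integrable (fun p : ℝ × ℝ => Ψ p.1 * Ψ p.2 * W p) (specMeasure.prod specMeasure) := by
    refine hΨi.mul_bdd (c := 1) hWm.aestronglyMeasurable ?_
    filter_upwards [ae_mem_square] with p hp using hW1 p hp
  have hJi2 : Integrable (fun p : ℝ × ℝ => Ψ p.1 * Ψ p.2 * W p.swap)
      (specMeasure.prod specMeasure) := by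
    refine hJi.swap.congr (ae_of_all _ fun p => ?_)
    simp only [Function.comp, Prod.fst_swap, Prod.snd_swap]; ring
  have hswap : ∫ p : ℝ × ℝ, Ψ p.1 * Ψ p.2 * W p.swap ∂(specMeasure.prod specMeasure)
      = ∫ p : ℝ × ℝ, Ψ p.1 * Ψ p.2 * W p ∂(specMeasure.prod specMeasure) := by
    rw [← integral_prod_swap (μ := specMeasure) (ν := specMeasure)
      (fun p : ℝ × ℝ => Ψ p.1 * Ψ p.2 * W p)]
    refine integral_congr_ae (ae_of_all _ fun p => ?_)
    simp only [Prod.fst_swap, Prod.snd_swap]; ring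
  have hsymm : 2 * ∫ p : ℝ × ℝ, Ψ p.1 * Ψ p.2 * W p ∂(specMeasure.prod specMeasure)
      = (Phi f n 0).im ^ 2 := by
    have h1 : (Phi f n 0).im ^ 2
        = ∫ p : ℝ × ℝ, Ψ p.1 * Ψ p.2 ∂(specMeasure.prod specMeasure) := by
      rw [integral_prod_mul Ψ Ψ, Phi_zero_im hf hc, pow_two]
    rw [h1, two_mul]
    nth_rewrite 1 [← hswap]
    rw [← integral_add hJi2 hJi]
    refine integral_congr_ae ?_
    filter_upwards [ae_mem_square] with p hp
    have ha : 0 ≤ 4 - p.1 ^ 2 := by nlinarith [hp.1.1, hp.1.2]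
    have hb : 0 ≤ 4 - p.2 ^ 2 := by nlinarith [hp.2.1, hp.2.2]
    -- At the corners of the square both weights are 0/0 = 0, but there Ψ vanishes as well.
    by_cases h0 : (4 - p.1 ^ 2) + (4 - p.2 ^ 2) = 0
    · have : Ψ p.1 = 0 := by simp only [hΨ]; rw [sinPow_eq_zero (by linarith), mul_zero]
      simp [this]
    · simp only [hW, Prod.fst_swap, Prod.snd_swap]
      have h0' : (4 - p.2 ^ 2) + (4 - p.1 ^ 2) ≠ 0 := by rwa [add_comm]
      field_simp
      ring
  have hslice : ∀ᵐ y ∂specMeasure,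
      ∫ x, (f x - f y) * deriv f y * corrKernel n (x, y) ∂specMeasure
        = 4 / Real.pi ^ 2 / (n + 1) * ∫ x, Ψ x * Ψ y * W (x, y) ∂specMeasure := by
    filter_upwards [ae_mem_specMeasure] with y hy
    have hck : ∀ᵐ x ∂specMeasure, (f x - f y) * deriv f y * corrKernel n (x, y)
        = -(4 / Real.pi ^ 2 / (n + 1) * Ψ y) * ((f x - f y) * ((n + 1) * corrDeriv n x y)) := by
      filter_upwards [ae_mem_specMeasure] with x hx
      rw [corrKernel, Set.indicator_of_mem (show (x, y) ∈ square from ⟨hx, hy⟩)]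
      simp only [hΨ]
      field_simp
    rw [integral_congr_ae hck, integral_const_mul]
    by_cases hy' : 4 ≤ y ^ 2
    · have : Ψ y = 0 := by simp only [hΨ]; rw [sinPow_eq_zero hy', mul_zero]
      simp [this]
    · push Not at hy'
      have hyo : y ∈ Set.Ioo (-2 : ℝ) 2 := abs_lt.1 (abs_lt_of_sq_lt_sq (by linarith) (by norm_num))
      rw [integral_mul_corrDeriv hf n hyo]
      have : ∀ x, Ψ x * Ψ y * W (x, y) = Ψ y * (deriv f x * (sinPow n x *
          ((4 - x ^ 2) / ((4 - x ^ 2) + (4 - y ^ 2))))) := by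
        intro x; simp only [hΨ, hW]; ring
      simp only [this]
      rw [integral_const_mul]
      ring
  rw [integral_prod_symm _ (integrable_mul_corrKernel hf n), integral_congr_ae hslice,
    integral_const_mul, ← integral_prod_symm _ hJi, ← hsymm]
  ring

end

/-! ### Summing the kernels -/

section

variable {N : ℕ} {μ : Fin N → ℝ} {ρ : ℝ}

/-- Two of the n + 2 factors are kept as μ_k², the source of the bound by ∑ A_ij², and the rest pay
ρ each. -/
lemma abs_powerSum_succ_le (hρ : ∀ k, |μ k| ≤ ρ) (n : ℕ) :
    |powerSum μ (n + 1)| ≤ ρ ^ n * ∑ k, μ k ^ 2 := by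
  unfold powerSum
  refine (Finset.abs_sum_le_sum_abs _ _).trans ?_
  rw [Finset.mul_sum]
  refine Finset.sum_le_sum fun k _ => ?_
  rw [abs_pow, show n + 1 + 1 = n + 2 by ring, pow_add, sq_abs]
  have := hρ k
  gcongr

/-- The kernel attached to the moments of a spectrum. -/
noncomputable def momentKernel (μ : Fin N → ℝ) (p : ℝ × ℝ) : ℝ :=
  ∑' n, powerSum μ (n + 1) * corrKernel (n + 1) p

lemma summable_add_two_mul_pow (h0 : 0 ≤ ρ) (h1 : ρ < 1) :
    Summable fun n : ℕ => ((n : ℝ) + 2) * ρ ^ n := by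
  have h := (hasSum_coe_mul_geometric_of_norm_lt_one
    (show ‖ρ‖ < 1 by rwa [Real.norm_of_nonneg h0])).summable.add
    ((summable_geometric_of_lt_one h0 h1).mul_left 2)
  refine h.congr fun n => ?_
  ring

lemma abs_powerSum_mul_corrKernel_le (hρ : ∀ k, |μ k| ≤ ρ) (h0 : 0 ≤ ρ) (n : ℕ) (p : ℝ × ℝ) :
    ‖powerSum μ (n + 1) * corrKernel (n + 1) p‖ ≤ ((n + 2) * ρ ^ n) * ∑ k, μ k ^ 2 := by
  rw [norm_mul, Real.norm_eq_abs, Real.norm_eq_abs]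
  have h1 := abs_powerSum_succ_le hρ n
  have h2 := abs_corrKernel_le (n + 1) p
  push_cast at h2
  have hσ : 0 ≤ ∑ k, μ k ^ 2 := Finset.sum_nonneg fun k _ => sq_nonneg _
  calc |powerSum μ (n + 1)| * |corrKernel (n + 1) p|
      ≤ (ρ ^ n * ∑ k, μ k ^ 2) * (n + 1 + 1) := by gcongr
    _ = _ := by ring

lemma hasSum_momentKernel (hρ : ∀ k, |μ k| ≤ ρ) (h0 : 0 ≤ ρ) (h1 : ρ < 1) (p : ℝ × ℝ) :
    HasSum (fun n => powerSum μ (n + 1) * corrKernel (n + 1) p) (momentKernel μ p) :=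
  (Summable.of_norm_bounded ((summable_add_two_mul_pow h0 h1).mul_right _)
    (abs_powerSum_mul_corrKernel_le hρ h0 · p)).hasSum

lemma measurable_momentKernel (hρ : ∀ k, |μ k| ≤ ρ) (h0 : 0 ≤ ρ) (h1 : ρ < 1) :
    Measurable (momentKernel μ) := by
  refine measurable_of_tendsto_metrizable
    (f := fun k p => ∑ n ∈ Finset.range k, powerSum μ (n + 1) * corrKernel (n + 1) p)
    (fun k => ?_) (tendsto_pi_nhds.2 fun p => (hasSum_momentKernel hρ h0 h1 p).tendsto_sum_nat)
  exact Finset.measurable_fun_sum _ fun n _ => (measurable_corrKernel _).const_mul _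

lemma momentKernel_eq_zero {p : ℝ × ℝ} (hp : p ∉ square) : momentKernel μ p = 0 := by
  simp [momentKernel, corrKernel, hp]

lemma abs_momentKernel_le (hρ : ∀ k, |μ k| ≤ ρ) (h0 : 0 ≤ ρ) (h1 : ρ < 1) (p : ℝ × ℝ) :
    |momentKernel μ p| ≤ (∑' n : ℕ, ((n : ℝ) + 2) * ρ ^ n) * ∑ k, μ k ^ 2 :=
  tsum_of_norm_bounded ((summable_add_two_mul_pow h0 h1).hasSum.mul_right _)
    (abs_powerSum_mul_corrKernel_le hρ h0 · p)

variable {f : ℝ → ℝ}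

lemma hasSum_integral_momentKernel (hf : ContDiff ℝ 2 f) (hc : HasCompactSupport f)
    (hρ : ∀ k, |μ k| ≤ ρ) (h0 : 0 ≤ ρ) (h1 : ρ < 1) :
    HasSum (fun n : ℕ => powerSum μ (n + 1) *
        (2 / Real.pi ^ 2 * ((Phi f (n + 1) 0).im ^ 2 / ((n + 1 : ℕ) + 1))))
      (∫ p : ℝ × ℝ, (f p.1 - f p.2) * deriv f p.2 * momentKernel μ p) := by
  have hG : Integrable (fun p : ℝ × ℝ => (f p.1 - f p.2) * deriv f p.2)
      (specMeasure.prod specMeasure) := by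
    rw [← volume_restrict_square]
    exact (continuous_sub_mul_deriv hf).continuousOn.integrableOn_compact
      (isCompact_Icc.prod isCompact_Icc)
  have hres : ∫ p : ℝ × ℝ, (f p.1 - f p.2) * deriv f p.2 * momentKernel μ p
      = ∫ p, (f p.1 - f p.2) * deriv f p.2 * momentKernel μ p ∂(specMeasure.prod specMeasure) := by
    rw [← volume_restrict_square]
    refine (setIntegral_eq_integral_of_forall_compl_eq_zero fun p hp => ?_).symm
    rw [momentKernel_eq_zero hp, mul_zero]
  rw [hres]
  have h := integrable_and_hasSum_integral (ν := specMeasure.prod specMeasure)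
    (F := fun n p => powerSum μ (n + 1) *
      ((f p.1 - f p.2) * deriv f p.2 * corrKernel (n + 1) p))
    (G := fun p => (f p.1 - f p.2) * deriv f p.2 * momentKernel μ p)
    (fun n => (integrable_mul_corrKernel hf _).const_mul _) ?_ ?_
  · refine h.2.congr_fun fun n => ?_
    rw [integral_const_mul, integral_mul_corrKernel hf hc]
  · set σ := ∑ k, μ k ^ 2
    refine Summable.of_nonneg_of_le (fun n => integral_nonneg fun p => norm_nonneg _) (fun n => ?_)
      (((summable_add_two_mul_pow h0 h1).mul_right σ).mul_right
        (∫ p : ℝ × ℝ, ‖(f p.1 - f p.2) * deriv f p.2‖ ∂(specMeasure.prod specMeasure)))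
    rw [← integral_const_mul]
    refine integral_mono ((integrable_mul_corrKernel hf _).const_mul _).norm (hG.norm.const_mul _)
      fun p => ?_
    have h2 := abs_powerSum_mul_corrKernel_le hρ h0 n p
    calc ‖powerSum μ (n + 1) * ((f p.1 - f p.2) * deriv f p.2 * corrKernel (n + 1) p)‖
        = ‖powerSum μ (n + 1) * corrKernel (n + 1) p‖ * ‖(f p.1 - f p.2) * deriv f p.2‖ := by
          rw [← norm_mul]; congr 1; ring
      _ ≤ _ := mul_le_mul_of_nonneg_right h2 (norm_nonneg _)
  · refine ae_of_all _ fun p => ?_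
    refine ((hasSum_momentKernel hρ h0 h1 p).mul_left ((f p.1 - f p.2) * deriv f p.2)).congr_fun
      fun n => ?_
    ring

lemma trace_term_eq (hf : ContDiff ℝ 2 f) (hc : HasCompactSupport f) :
    -(1 / Real.pi ^ 2) * ∫ p in square, (f p.1 - f p.2) * deriv f p.2 * (mscBoundary p.1).re *
        (√(4 - p.2 ^ 2) / √(4 - p.1 ^ 2))
      = 2 / Real.pi ^ 2 * (Phi f 0 0).im ^ 2 := by
  have h := integral_sqKernel hf hc 0
  have h2 : ∀ p : ℝ × ℝ, (f p.1 - f p.2) * deriv f p.2 * (mscBoundary p.1).re *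
      (√(4 - p.2 ^ 2) / √(4 - p.1 ^ 2)) = -2 * sqKernel f 0 p := by
    intro p
    rw [mscBoundary_eq_sc]
    simp only [sqKernel, cosPow, sinPow, scPow, zero_add, pow_one, sc_ofReal_im]
    ring
  rw [volume_restrict_square]
  simp only [h2]
  rw [integral_const_mul, h]
  push_cast
  ring

lemma hasSum_main_add_error (hf : ContDiff ℝ 2 f) (hc : HasCompactSupport f)
    {A : Matrix (Fin N) (Fin N) ℝ} (hA : ∑ k, μ k = ∑ i, A i i)
    (hρ : ∀ k, |μ k| ≤ ρ) (h0 : 0 ≤ ρ) (h1 : ρ < 1) :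
    HasSum (fun n : ℕ => 2 / Real.pi ^ 2 * ((1 + powerSum μ n) / (n + 1) * (Phi f n 0).im ^ 2))
      (mainTerm f + errorTerm A (fun x y => momentKernel μ (x, y)) f) := by
  have h2 := hasSum_integral_momentKernel hf hc hρ h0 h1
  have h3 : HasSum (fun n : ℕ => powerSum μ n *
      (2 / Real.pi ^ 2 * ((Phi f n 0).im ^ 2 / (n + 1))))
      (errorTerm A (fun x y => momentKernel μ (x, y)) f) := by
    -- The index 0 is split off: its coefficient is the trace, which is not controlled by ∑ A_ij²
    -- and forms the explicit part of the error functional.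
    rw [← hasSum_nat_add_iff' 1]
    convert! h2 using 1
    rw [errorTerm, trace_term_eq hf hc, ← hA]
    simp [powerSum]
  refine ((hasSum_mainTerm hf hc).add h3).congr_fun fun n => ?_
  ring

end

/-! ### Inverse square root singularities -/

lemma integral_indicator_inv_sqrt {ℓ : ℝ} (hℓ : 0 < ℓ) :
    ∫ v : ℝ, (Set.Iio ℓ).indicator (fun v => 1 / √v) |v| = 4 * √ℓ := by
  rw [integral_comp_abs, setIntegral_indicator measurableSet_Iio, Set.Ioi_inter_Iio,
    ← integral_Ioc_eq_integral_Ioo, ← intervalIntegral.integral_of_le hℓ.le]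
  have h1 : ∀ v ∈ Set.uIcc 0 ℓ, 1 / √v = v ^ (-(1 / 2) : ℝ) := by
    intro v hv
    rw [Set.uIcc_of_le hℓ.le] at hv
    rw [Real.rpow_neg hv.1, Real.sqrt_eq_rpow, one_div]
  rw [intervalIntegral.integral_congr h1, integral_rpow (Or.inl (by norm_num)),
    Real.sqrt_eq_rpow]
  norm_num
  ring

/-- A non-integrable function has integral 0 by convention, whereas the computed value is positive.
-/
lemma integrable_indicator_inv_sqrt {ℓ : ℝ} (hℓ : 0 < ℓ) :
    Integrable fun v : ℝ => (Set.Iio ℓ).indicator (fun v => 1 / √v) |v| := by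
  by_contra h
  have h1 := integral_indicator_inv_sqrt hℓ
  rw [integral_undef h] at h1
  have := Real.sqrt_pos.2 hℓ
  linarith

section

variable {u : ℝ → ℝ} {M ℓ : ℝ}

lemma abs_div_sqrt_le (hM : ∀ t, |u t| ≤ M) (hℓ : 0 < ℓ) (x t : ℝ) :
    |u t| / √|t - x|
      ≤ M * (Set.Iio ℓ).indicator (fun v => 1 / √v) |t - x| + |u t| / √ℓ := by
  have hM0 : 0 ≤ M := (abs_nonneg _).trans (hM t)
  by_cases h : |t - x| < ℓ
  · rw [Set.indicator_of_mem (show |t - x| ∈ Set.Iio ℓ from h), div_eq_mul_one_div]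
    have h1 : |u t| * (1 / √|t - x|) ≤ M * (1 / √|t - x|) :=
      mul_le_mul_of_nonneg_right (hM t) (by positivity)
    have h2 : 0 ≤ |u t| / √ℓ := by positivity
    linarith
  · rw [Set.indicator_of_notMem (show |t - x| ∉ Set.Iio ℓ from h), mul_zero, zero_add]
    push Not at h
    have := Real.sqrt_pos.2 hℓ
    gcongr

lemma integrable_singular_majorant (hu : Integrable u) (hℓ : 0 < ℓ) (x : ℝ) :
    Integrable fun t => M * (Set.Iio ℓ).indicator (fun v => 1 / √v) |t - x| + |u t| / √ℓ :=
  (((integrable_indicator_inv_sqrt hℓ).comp_sub_right x).const_mul M).add (hu.abs.div_const _)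

lemma integrable_abs_div_sqrt (hu : Integrable u) (hM : ∀ t, |u t| ≤ M) (x : ℝ) :
    Integrable fun t => |u t| / √|t - x| := by
  refine (integrable_singular_majorant (M := M) hu one_pos x).mono' ?_
    (ae_of_all _ fun t => ?_)
  · have h1 : Measurable fun t : ℝ => √|t - x| := by fun_prop
    exact (hu.abs.aestronglyMeasurable.aemeasurable.div h1.aemeasurable).aestronglyMeasurable
  · rw [Real.norm_of_nonneg (by positivity)]
    exact abs_div_sqrt_le hM one_pos x t

lemma integral_abs_div_sqrt_le_add (hu : Integrable u) (hM : ∀ t, |u t| ≤ M) (hℓ : 0 < ℓ) (x : ℝ) :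
    ∫ t, |u t| / √|t - x| ≤ M * (4 * √ℓ) + (∫ t, |u t|) / √ℓ := by
  calc ∫ t, |u t| / √|t - x|
      ≤ ∫ t, (M * (Set.Iio ℓ).indicator (fun v => 1 / √v) |t - x| + |u t| / √ℓ) :=
        integral_mono (integrable_abs_div_sqrt hu hM x) (integrable_singular_majorant hu hℓ x)
          (abs_div_sqrt_le hM hℓ x)
    _ = _ := by
        rw [integral_add (((integrable_indicator_inv_sqrt hℓ).comp_sub_right x).const_mul M)
          (hu.abs.div_const _), integral_const_mul, integral_div,
          integral_sub_right_eq_self (fun v : ℝ => (Set.Iio ℓ).indicator (fun v => 1 / √v) |v|) x,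
          integral_indicator_inv_sqrt hℓ]

/-- Split at distance ℓ from x, bounding |u| by M inside and 1/√|t - x| by 1/√ℓ outside; ℓ = ‖u‖₁/M
balances the two parts. Degenerate cases are separate because of the quotient. -/
lemma integral_abs_div_sqrt_le (hu : Integrable u) (hM : ∀ t, |u t| ≤ M) (x : ℝ) :
    ∫ t, |u t| / √|t - x| ≤ 5 * √(M * ∫ t, |u t|) := by
  set L := ∫ t, |u t| with hL
  have hL0 : 0 ≤ L := integral_nonneg fun t => abs_nonneg _
  have hM0 : 0 ≤ M := (abs_nonneg _).trans (hM 0)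
  rcases hL0.eq_or_lt with h | h
  · have h0 : u =ᵐ[volume] 0 := by
      have := (integral_eq_zero_iff_of_nonneg (fun t => abs_nonneg (u t)) hu.abs).1 h.symm
      filter_upwards [this] with t ht using abs_eq_zero.1 ht
    have h1 : ∫ t, |u t| / √|t - x| = 0 := by
      refine integral_eq_zero_of_ae ?_
      filter_upwards [h0] with t ht
      simp [ht]
    rw [h1]; positivity
  rcases hM0.eq_or_lt with hm | hm
  · have h1 : ∀ t, u t = 0 := fun t => abs_nonpos_iff.1 ((hM t).trans hm.symm.le)
    simp only [h1]
    simp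
  have h2 := integral_abs_div_sqrt_le_add hu hM (show 0 < L / M by positivity) x
  rw [← hL] at h2
  refine h2.trans (le_of_eq ?_)
  rw [Real.sqrt_mul hM0, Real.sqrt_div hL0]
  have h3 : √L * √L = L := Real.mul_self_sqrt hL0
  have h4 : √M * √M = M := Real.mul_self_sqrt hM0
  have h5 := Real.sqrt_pos.2 h
  have h6 := Real.sqrt_pos.2 hm
  have e1 : M * (4 * (√L / √M)) = 4 * (√M * √L) := by
    nth_rewrite 1 [← h4]; field_simp
  have e2 : L / (√L / √M) = √M * √L := by
    nth_rewrite 1 [← h3]; field_simp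
  rw [e1, e2]; ring

end

/-! ### Pointwise bounds near the spectrum -/

/-- For |w| ≤ 4 this is 2 Im w ≤ |w² - 4|; for larger w the quadratic growth of w² - 4 takes over.
-/
lemma im_mul_two_add_norm_le {w : ℂ} (h0 : 0 < w.im) (h1 : w.im ≤ 1) :
    w.im * (2 + ‖w‖) ≤ 3 * ‖w ^ 2 - 4‖ := by
  have h2 := two_mul_im_le_norm h0.le
  by_cases h : ‖w‖ ≤ 4
  · nlinarith [norm_nonneg w]
  · push Not at h
    have h3 : ‖w‖ ^ 2 - 4 ≤ ‖w ^ 2 - 4‖ := by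
      have := norm_sub_norm_le (w ^ 2) 4
      rw [norm_pow] at this
      simpa using this
    nlinarith

lemma norm_scDeriv_div_sc {w : ℂ} (h0 : 0 < w.im) :
    ‖scDeriv w / sc w‖ = 1 / √‖w ^ 2 - 4‖ := by
  have h1 := norm_scDeriv_sq_mul h0
  have h2 : 0 < ‖w ^ 2 - 4‖ := by have := two_mul_im_le_norm h0.le; linarith
  have h3 : 0 < ‖sc w‖ := norm_pos_iff.2 (sc_ne_zero w)
  rw [norm_div, div_eq_div_iff h3.ne' (Real.sqrt_pos.2 h2).ne', one_mul]
  refine (pow_left_inj₀ (by positivity) h3.le two_ne_zero).1 ?_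
  rw [mul_pow, Real.sq_sqrt h2.le, h1]

/-- The edge singularity of m'/m, of size |w² - 4|^(-1/2), is compensated by √(4 - t²): writing 4 -
t² = -(w² - 4) - (t - w)(t + w) gives y(4 - t²) ≤ 4|w² - 4||t - w|. What remains is uniform over the
spectrum, edges included. -/
lemma im_mul_norm_mul_sqrt_le {x y t : ℝ} (h0 : 0 < y) (h1 : y ≤ 1)
    (ht : t ∈ Set.Icc (-2 : ℝ) 2) (htx : t ≠ x) :
    y * ‖scDeriv (pt x y) / sc (pt x y)‖ * (√(4 - t ^ 2) / ‖(t : ℂ) - pt x y‖)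
      ≤ 2 * √y / √|t - x| := by
  set w := pt x y with hw
  have hwi : w.im = y := by simp [hw]
  have hwr : w.re = x := by simp [hw]
  rw [norm_scDeriv_div_sc (by rwa [hwi])]
  set D := ‖w ^ 2 - 4‖ with hD
  set δ := ‖(t : ℂ) - w‖ with hδ
  have hD2 : 2 * y ≤ D := by simpa [hwi] using two_mul_im_le_norm (z := w) (by rw [hwi]; exact h0.le)
  have hDpos : 0 < D := by linarith
  have hδ1 : y ≤ δ := by
    have := Complex.abs_im_le_norm ((t : ℂ) - w)
    rw [Complex.sub_im, hwi, Complex.ofReal_im, zero_sub, abs_neg, abs_of_pos h0] at this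
    exact this
  have hδ2 : |t - x| ≤ δ := by
    have := Complex.abs_re_le_norm ((t : ℂ) - w)
    rwa [Complex.sub_re, hwr, Complex.ofReal_re] at this
  have hδpos : 0 < δ := h0.trans_le hδ1
  have hτ : 0 < |t - x| := abs_pos.2 (sub_ne_zero.2 htx)
  have ha : 0 ≤ 4 - t ^ 2 := by nlinarith [ht.1, ht.2]
  have h3 : y * (2 + ‖w‖) ≤ 3 * D := by
    simpa [hwi] using im_mul_two_add_norm_le (w := w) (by rwa [hwi]) (by rwa [hwi])
  have h4 : 4 - t ^ 2 ≤ D + δ * (2 + ‖w‖) := by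
    have e : ((4 - t ^ 2 : ℝ) : ℂ) = -(w ^ 2 - 4) - ((t : ℂ) - w) * (t + w) := by push_cast; ring
    have e2 := congrArg norm e
    rw [Complex.norm_real, Real.norm_of_nonneg ha] at e2
    rw [e2]
    refine (norm_sub_le _ _).trans ?_
    rw [norm_neg, norm_mul]
    have : ‖(t : ℂ) + w‖ ≤ 2 + ‖w‖ := by
      refine (norm_add_le _ _).trans ?_
      rw [Complex.norm_real]
      have : |t| ≤ 2 := abs_le.2 ht
      gcongr
      exact this
    gcongr
  have h5 : y * (4 - t ^ 2) ≤ 4 * D * δ := by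
    calc y * (4 - t ^ 2) ≤ y * (D + δ * (2 + ‖w‖)) := by gcongr
      _ = D * y + δ * (y * (2 + ‖w‖)) := by ring
      _ ≤ D * δ + δ * (3 * D) := by gcongr
      _ = _ := by ring
  refine (pow_le_pow_iff_left₀ (by positivity) (by positivity) two_ne_zero).1 ?_
  have e1 : (y * (1 / √D) * (√(4 - t ^ 2) / δ)) ^ 2 = y * (y * (4 - t ^ 2)) / (D * δ ^ 2) := by
    rw [mul_pow, mul_pow, div_pow, div_pow, Real.sq_sqrt hDpos.le, Real.sq_sqrt ha]
    field_simp
  have e2 : (2 * √y / √|t - x|) ^ 2 = 4 * y / |t - x| := by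
    rw [div_pow, mul_pow, Real.sq_sqrt h0.le, Real.sq_sqrt hτ.le]; norm_num
  rw [e1, e2]
  calc y * (y * (4 - t ^ 2)) / (D * δ ^ 2) ≤ y * (4 * D * δ) / (D * δ ^ 2) := by gcongr
    _ = 4 * y / δ := by field_simp
    _ ≤ 4 * y / |t - x| := by gcongr

/-! ### Resummation of the boundary coefficients -/

section

variable {f : ℝ → ℝ}

/-- The Cauchy transform of `f' √(4 - t²)` over `[-2, 2]`, through which `∑ qₙ sc(w)ⁿ` is
expressed, where `qₙ = (Phi f n 0).im`. -/
noncomputable def cauchyTransform (f : ℝ → ℝ) (w : ℂ) : ℂ :=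
  ∫ t : ℝ, ((deriv f t : ℝ) : ℂ) * ((√(4 - t ^ 2) / 2 : ℝ) / (sc w * (t - w))) ∂specMeasure

/-- Integrates the generating series of `hasSum_sinPow` against f', which is possible since |m(w)| <
1. -/
lemma hasSum_cauchyTransform (hf : ContDiff ℝ 2 f) (hc : HasCompactSupport f) {w : ℂ}
    (hw : 0 < w.im) :
    HasSum (fun n : ℕ => ((Phi f n 0).im : ℂ) * sc w ^ n) (cauchyTransform f w) := by
  have hi : ∀ n, Integrable (fun t => deriv f t * sinPow n t) specMeasure := fun n =>
    integrable_specMeasure ((continuous_deriv_test hf).mul (continuous_sinPow n))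
  have hi0 : Integrable (fun t => |deriv f t|) specMeasure :=
    integrable_specMeasure (continuous_deriv_test hf).abs
  have hsc := norm_sc_lt_one hw
  have h := integrable_and_hasSum_integral (ν := specMeasure)
    (F := fun (n : ℕ) (t : ℝ) => ((deriv f t * sinPow n t : ℝ) : ℂ) * sc w ^ n)
    (G := fun t : ℝ => ((deriv f t : ℝ) : ℂ) * ((√(4 - t ^ 2) / 2 : ℝ) / (sc w * (t - w))))
    (fun n => (hi n).ofReal.mul_const _) ?_ ?_
  · refine h.2.congr_fun fun n => ?_
    rw [integral_mul_const, integral_complex_ofReal, ← Phi_zero_im hf hc]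
  · refine Summable.of_nonneg_of_le (fun n => integral_nonneg fun t => norm_nonneg _) (fun n => ?_)
      ((summable_geometric_of_lt_one (norm_nonneg _) hsc).mul_left
        (∫ t, |deriv f t| ∂specMeasure))
    simp only [norm_mul, norm_pow, Complex.norm_real]
    rw [integral_mul_const]
    refine mul_le_mul_of_nonneg_right ?_ (by positivity)
    refine integral_mono ?_ hi0 fun t => ?_
    · simpa using (hi n).norm
    · exact mul_le_of_le_one_right (abs_nonneg _) (abs_sinPow_le_one n t)
  · filter_upwards [ae_mem_specMeasure] with t ht
    refine ((hasSum_sinPow ht hw).mul_left ((deriv f t : ℝ) : ℂ)).congr_fun fun n => ?_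
    push_cast; ring

lemma norm_cauchyTransform_le (hf : ContDiff ℝ 2 f) (hc : HasCompactSupport f) {x y : ℝ}
    (h0 : 0 < y) (h1 : y ≤ 1) :
    y * ‖scDeriv (pt x y)‖ * ‖cauchyTransform f (pt x y)‖
      ≤ 5 * √y * √((∫ t, |deriv (deriv f) t|) * ∫ t, |deriv f t|) := by
  have hu := integrable_deriv_test hf hc
  have hM := abs_deriv_le_integral hf hc
  have hint := integrable_abs_div_sqrt hu hM x
  have hnorm : y * ‖scDeriv (pt x y)‖ * ‖cauchyTransform f (pt x y)‖
      ≤ ∫ t, √y * (|deriv f t| / √|t - x|) ∂specMeasure := by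
    rw [cauchyTransform, ← Real.norm_of_nonneg (show 0 ≤ y * ‖scDeriv (pt x y)‖ by positivity),
      ← norm_smul]
    rw [← integral_smul]
    refine norm_integral_le_of_norm_le (hint.const_mul _).restrict ?_
    have hae : ∀ᵐ t ∂specMeasure, t ≠ x := by
      refine ae_restrict_of_ae ?_
      simp [ae_iff]
    filter_upwards [ae_mem_specMeasure, hae] with t ht htx
    have h2 := im_mul_norm_mul_sqrt_le h0 h1 ht htx
    rw [norm_smul, Real.norm_of_nonneg (show 0 ≤ y * ‖scDeriv (pt x y)‖ by positivity),
      norm_mul ((deriv f t : ℝ) : ℂ), norm_div, norm_mul, Complex.norm_real, Complex.norm_real,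
      Real.norm_of_nonneg (show 0 ≤ √(4 - t ^ 2) / 2 by positivity), Real.norm_eq_abs]
    rw [norm_div] at h2
    calc y * ‖scDeriv (pt x y)‖ * (|deriv f t| * (√(4 - t ^ 2) / 2 /
          (‖sc (pt x y)‖ * ‖(t : ℂ) - pt x y‖)))
        = |deriv f t| / 2 * (y * (‖scDeriv (pt x y)‖ / ‖sc (pt x y)‖) *
          (√(4 - t ^ 2) / ‖(t : ℂ) - pt x y‖)) := by
            rw [← div_div (√(4 - t ^ 2) / 2)]; ring
      _ ≤ |deriv f t| / 2 * (2 * √y / √|t - x|) := by gcongr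
      _ = √y * (|deriv f t| / √|t - x|) := by ring
  refine hnorm.trans ?_
  rw [integral_const_mul]
  have h3 : ∫ t, |deriv f t| / √|t - x| ∂specMeasure ≤ ∫ t, |deriv f t| / √|t - x| :=
    setIntegral_le_integral hint (ae_of_all _ fun t => by positivity)
  have h4 := integral_abs_div_sqrt_le hu hM x
  calc √y * ∫ t, |deriv f t| / √|t - x| ∂specMeasure
      ≤ √y * (5 * √((∫ t, |deriv (deriv f) t|) * ∫ t, |deriv f t|)) := by
        gcongr
        exact h3.trans h4
    _ = _ := by ring

end

/-! ### Integrals over a strip above the real axis -/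

lemma measurable_sc : Measurable sc := by
  unfold sc scRoot
  fun_prop

lemma measurable_scDeriv : Measurable scDeriv := by
  have := measurable_sc
  unfold scDeriv
  fun_prop

lemma measurable_pt_swap : Measurable fun p : ℝ × ℝ => pt p.2 p.1 := by
  unfold pt
  fun_prop

/-- Lebesgue measure on the strip of all `(y, x)` with `0 < y ≤ η`. -/
noncomputable def stripMeasure (η : ℝ) : Measure (ℝ × ℝ) :=
  (volume.restrict (Set.Ioc 0 η)).prod volume

lemma ae_mem_strip (η : ℝ) : ∀ᵐ p ∂stripMeasure η, p.1 ∈ Set.Ioc 0 η :=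
  Measure.quasiMeasurePreserving_fst.ae (ae_restrict_mem measurableSet_Ioc)

lemma integrable_strip {w : ℝ → ℝ} (hw : Integrable w) (η : ℝ) :
    Integrable (fun p : ℝ × ℝ => w p.2) (stripMeasure η) := by
  have := (integrable_const (μ := volume.restrict (Set.Ioc 0 η)) (1 : ℝ)).mul_prod hw
  simpa [stripMeasure] using this

lemma integral_strip (w : ℝ → ℝ) {η : ℝ} (hη : 0 ≤ η) :
    ∫ p : ℝ × ℝ, w p.2 ∂stripMeasure η = η * ∫ x, w x := by
  have := integral_prod_mul (μ := volume.restrict (Set.Ioc 0 η)) (ν := volume)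
    (fun _ : ℝ => (1 : ℝ)) w
  simp only [one_mul] at this
  rw [stripMeasure, this]
  simp [hη]

/-- Weighted Cauchy-Schwarz through the discriminant of c ↦ ∫ w(G - c)². -/
lemma sq_integral_mul_le {α : Type*} [MeasurableSpace α] {κ : Measure α} {w G : α → ℝ} {B : ℝ}
    (hw : ∀ a, 0 ≤ w a) (hwi : Integrable w κ) (hG : AEStronglyMeasurable G κ)
    (hB : ∀ᵐ a ∂κ, |G a| ≤ B) :
    (∫ a, w a * G a ∂κ) ^ 2 ≤ (∫ a, w a ∂κ) * ∫ a, w a * G a ^ 2 ∂κ := by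
  have h1 : Integrable (fun a => w a * G a) κ := hwi.mul_bdd hG hB
  have h2 : Integrable (fun a => w a * G a ^ 2) κ := by
    refine hwi.mul_bdd (c := B ^ 2) (hG.pow 2) ?_
    filter_upwards [hB] with a ha
    rw [norm_pow]
    exact pow_le_pow_left₀ (norm_nonneg _) ha 2
  have key : ∀ c : ℝ, 0 ≤ (∫ a, w a ∂κ) * (c * c) + (-2 * ∫ a, w a * G a ∂κ) * c
      + ∫ a, w a * G a ^ 2 ∂κ := by
    intro c
    have h3 : 0 ≤ ∫ a, (w a * (c * c) + -2 * (w a * G a) * c + w a * G a ^ 2) ∂κ := by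
      refine integral_nonneg fun a => ?_
      have : w a * (c * c) + -2 * (w a * G a) * c + w a * G a ^ 2 = w a * (G a - c) ^ 2 := by ring
      simp only [this]
      exact mul_nonneg (hw a) (sq_nonneg _)
    have i1 : Integrable (fun a => w a * (c * c)) κ := hwi.mul_const _
    have i2 : Integrable (fun a => -2 * (w a * G a) * c) κ := (h1.const_mul _).mul_const _
    have i3 : Integrable (fun a => w a * (c * c) + -2 * (w a * G a) * c) κ := i1.add i2
    rwa [integral_add i3 h2, integral_add i1 i2, integral_mul_const, integral_mul_const,
      integral_const_mul] at h3
  have := discrim_le_zero key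
  rw [discrim] at this
  nlinarith

/-- The size of the `n`-th power of `sc` in the strip, apart from the factor `n + 1`. -/
noncomputable def stripPow (n : ℕ) (p : ℝ × ℝ) : ℝ :=
  p.1 * ‖sc (pt p.2 p.1)‖ ^ n * ‖scDeriv (pt p.2 p.1)‖

lemma measurable_stripPow (n : ℕ) : Measurable (stripPow n) := by
  have h1 := (measurable_sc.comp measurable_pt_swap).norm
  have h2 := (measurable_scDeriv.comp measurable_pt_swap).norm
  exact (measurable_fst.mul (h1.pow_const n)).mul h2

/-- With u = |m|², the sum ∑ (n+1)u^n = (1 - u)⁻² exactly cancels the square of y|m'| ≤ (1 - u)/2.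
-/
lemma sum_mul_stripPow_sq_le (k : ℕ) {p : ℝ × ℝ} (hp : 0 < p.1) :
    ∑ n ∈ Finset.range k, (n + 1) * stripPow n p ^ 2 ≤ 1 / 4 := by
  set w := pt p.2 p.1 with hw
  have hwi : 0 < w.im := by simpa [hw] using hp
  have h1 := im_mul_norm_scDeriv_le hwi
  have h2 := norm_sc_lt_one hwi
  rw [show w.im = p.1 by simp [hw]] at h1
  set u := ‖sc w‖ ^ 2 with hu
  have hu0 : 0 ≤ u := by positivity
  have hu1 : u < 1 := by rw [hu]; exact pow_lt_one₀ (norm_nonneg _) h2 two_ne_zero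
  have hs := hasSum_choose_mul_geometric_of_norm_lt_one (𝕜 := ℝ) 1
    (show ‖u‖ < 1 by rwa [Real.norm_of_nonneg hu0])
  have h3 : ∑ n ∈ Finset.range k, ((n : ℝ) + 1) * u ^ n ≤ 1 / (1 - u) ^ 2 := by
    have := sum_le_hasSum (Finset.range k) (fun n _ => by positivity) hs
    simpa using this
  have h4 : ∀ n : ℕ, ((n : ℝ) + 1) * stripPow n p ^ 2
      = (p.1 * ‖scDeriv w‖) ^ 2 * ((n + 1) * u ^ n) := by
    intro n
    simp only [stripPow, hu]
    ring
  simp only [h4]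
  rw [← Finset.mul_sum]
  have h5 : (p.1 * ‖scDeriv w‖) ^ 2 ≤ ((1 - u) / 2) ^ 2 :=
    pow_le_pow_left₀ (by positivity) h1 2
  have h6 : 0 < 1 - u := by linarith
  calc (p.1 * ‖scDeriv w‖) ^ 2 * ∑ n ∈ Finset.range k, ((n : ℝ) + 1) * u ^ n
      ≤ ((1 - u) / 2) ^ 2 * (1 / (1 - u) ^ 2) := by gcongr
    _ = 1 / 4 := by field_simp; norm_num

lemma stripPow_nonneg (n : ℕ) {p : ℝ × ℝ} (hp : 0 < p.1) : 0 ≤ stripPow n p := by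
  unfold stripPow; positivity

lemma stripPow_le_half (n : ℕ) {p : ℝ × ℝ} (hp : 0 < p.1) : stripPow n p ≤ 1 / 2 := by
  have hwi : 0 < (pt p.2 p.1).im := by simpa using hp
  have h1 := im_mul_norm_scDeriv_le hwi
  rw [pt_im] at h1
  have h2 : ‖sc (pt p.2 p.1)‖ ^ n ≤ 1 := pow_le_one₀ (norm_nonneg _) (norm_sc_lt_one hwi).le
  calc stripPow n p = ‖sc (pt p.2 p.1)‖ ^ n * (p.1 * ‖scDeriv (pt p.2 p.1)‖) := by
        unfold stripPow; ring
    _ ≤ 1 * ((1 - ‖sc (pt p.2 p.1)‖ ^ 2) / 2) := by gcongr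
    _ ≤ 1 / 2 := by nlinarith [sq_nonneg ‖sc (pt p.2 p.1)‖]

lemma abs_stripPow_le (n : ℕ) (η : ℝ) : ∀ᵐ p ∂stripMeasure η, |stripPow n p| ≤ 1 / 2 := by
  filter_upwards [ae_mem_strip η] with p hp
  rw [abs_of_nonneg (stripPow_nonneg n hp.1)]
  exact stripPow_le_half n hp.1

lemma stripPow_le_sqrt (n : ℕ) {p : ℝ × ℝ} {η : ℝ} (hp : p.1 ∈ Set.Ioc 0 η) :
    stripPow n p ≤ √η := by
  have hwi : 0 < (pt p.2 p.1).im := by simpa using hp.1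
  have h1 := norm_scDeriv_le hwi
  rw [pt_im] at h1
  have h2 : ‖sc (pt p.2 p.1)‖ ^ n ≤ 1 := pow_le_one₀ (norm_nonneg _) (norm_sc_lt_one hwi).le
  have h0 := hp.1
  calc stripPow n p ≤ p.1 * 1 * (1 / √(2 * p.1)) := by
        unfold stripPow; gcongr
    _ = √p.1 * (√p.1 / √(2 * p.1)) := by
        rw [← mul_div_assoc √p.1, Real.mul_self_sqrt h0.le, mul_one, mul_one_div]
    _ ≤ √η * 1 := by
        have := Real.sqrt_pos.2 h0
        gcongr
        · exact hp.2
        · exact div_le_one_of_le₀ (Real.sqrt_le_sqrt (by linarith)) (Real.sqrt_nonneg _)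
    _ = √η := mul_one _

section

variable {f : ℝ → ℝ}

/-- The integral of `|f''|` against `stripPow n` over the strip. -/
noncomputable def stripMoment (f : ℝ → ℝ) (η : ℝ) (n : ℕ) : ℝ :=
  ∫ p, |deriv (deriv f) p.2| * stripPow n p ∂stripMeasure η

lemma integrable_mul_stripPow (hf : ContDiff ℝ 2 f) (hc : HasCompactSupport f) (η : ℝ) (n : ℕ) :
    Integrable (fun p : ℝ × ℝ => |deriv (deriv f) p.2| * stripPow n p) (stripMeasure η) :=
  (integrable_strip (integrable_deriv_deriv_test hf hc).abs η).mul_bdd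
    (measurable_stripPow n).aestronglyMeasurable (abs_stripPow_le n η)

lemma stripMoment_nonneg (η : ℝ) (n : ℕ) : 0 ≤ stripMoment f η n := by
  refine integral_nonneg_of_ae ?_
  filter_upwards [ae_mem_strip η] with p hp
  exact mul_nonneg (abs_nonneg _) (stripPow_nonneg n hp.1)

lemma stripMoment_le (hf : ContDiff ℝ 2 f) (hc : HasCompactSupport f) {η : ℝ} (hη : 0 ≤ η) (n : ℕ) :
    stripMoment f η n ≤ √η * (η * ∫ x, |deriv (deriv f) x|) := by
  rw [← integral_strip (fun x => |deriv (deriv f) x|) hη, ← integral_const_mul]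
  refine integral_mono_ae (integrable_mul_stripPow hf hc η n)
    ((integrable_strip (integrable_deriv_deriv_test hf hc).abs η).const_mul _) ?_
  filter_upwards [ae_mem_strip η] with p hp
  rw [mul_comm]
  exact mul_le_mul_of_nonneg_right (stripPow_le_sqrt n hp) (abs_nonneg _)

/-- Cauchy-Schwarz with weight |f''| on the strip, followed by the pointwise bound on the sum of
squares. Each application costs one factor η‖f''‖₁, the mass of the weight. -/
lemma sum_mul_stripMoment_sq_le (hf : ContDiff ℝ 2 f) (hc : HasCompactSupport f) {η : ℝ}
    (hη : 0 ≤ η) (k : ℕ) :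
    ∑ n ∈ Finset.range k, (n + 1) * stripMoment f η n ^ 2
      ≤ (η * ∫ x, |deriv (deriv f) x|) ^ 2 / 4 := by
  have hwi := integrable_strip (integrable_deriv_deriv_test hf hc).abs η
  set W := η * ∫ x, |deriv (deriv f) x| with hW
  have hW0 : 0 ≤ W := mul_nonneg hη (integral_nonneg fun x => abs_nonneg _)
  have hWi : ∫ p : ℝ × ℝ, |deriv (deriv f) p.2| ∂stripMeasure η = W :=
    integral_strip (fun x => |deriv (deriv f) x|) hη
  have hi : ∀ n, Integrable (fun p : ℝ × ℝ => |deriv (deriv f) p.2| * stripPow n p ^ 2)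
      (stripMeasure η) := by
    intro n
    refine hwi.mul_bdd (c := (1 / 2) ^ 2) ((measurable_stripPow n).pow_const 2).aestronglyMeasurable
      ?_
    filter_upwards [abs_stripPow_le n η] with p hp
    rw [norm_pow]
    exact pow_le_pow_left₀ (norm_nonneg _) hp 2
  have h1 : ∀ n, stripMoment f η n ^ 2
      ≤ W * ∫ p, |deriv (deriv f) p.2| * stripPow n p ^ 2 ∂stripMeasure η := by
    intro n
    rw [← hWi]
    exact sq_integral_mul_le (fun p => abs_nonneg _) hwi
      (measurable_stripPow n).aestronglyMeasurable (abs_stripPow_le n η)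
  calc ∑ n ∈ Finset.range k, (n + 1) * stripMoment f η n ^ 2
      ≤ ∑ n ∈ Finset.range k, ((n : ℝ) + 1) *
          (W * ∫ p, |deriv (deriv f) p.2| * stripPow n p ^ 2 ∂stripMeasure η) :=
        Finset.sum_le_sum fun n _ => mul_le_mul_of_nonneg_left (h1 n) (by positivity)
    _ = W * ∫ p, ∑ n ∈ Finset.range k, ((n : ℝ) + 1) *
          (|deriv (deriv f) p.2| * stripPow n p ^ 2) ∂stripMeasure η := by
        rw [integral_finsetSum _ fun n _ => (hi n).const_mul _, Finset.mul_sum]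
        refine Finset.sum_congr rfl fun n _ => ?_
        rw [integral_const_mul]; ring
    _ ≤ W * ∫ p, (1 / 4) * |deriv (deriv f) p.2| ∂stripMeasure η := by
        refine mul_le_mul_of_nonneg_left ?_ hW0
        refine integral_mono_ae (integrable_finsetSum _ fun n _ => (hi n).const_mul _)
          (hwi.const_mul _) ?_
        filter_upwards [ae_mem_strip η] with p hp
        have h2 := sum_mul_stripPow_sq_le k hp.1
        calc ∑ n ∈ Finset.range k, ((n : ℝ) + 1) * (|deriv (deriv f) p.2| * stripPow n p ^ 2)
            = (∑ n ∈ Finset.range k, (n + 1) * stripPow n p ^ 2) * |deriv (deriv f) p.2| := by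
              rw [Finset.sum_mul]
              exact Finset.sum_congr rfl fun n _ => by ring
          _ ≤ _ := mul_le_mul_of_nonneg_right h2 (abs_nonneg _)
    _ = W ^ 2 / 4 := by rw [integral_const_mul, hWi]; ring

lemma norm_mul_scPowDeriv (n : ℕ) (a : ℝ) {p : ℝ × ℝ} (hp : 0 < p.1) :
    ‖(p.1 : ℂ) * ((a : ℂ) * scPowDeriv n (pt p.2 p.1))‖ = (n + 1) * (|a| * stripPow n p) := by
  rw [norm_mul, norm_mul, norm_scPowDeriv, Complex.norm_real, Complex.norm_real,
    Real.norm_of_nonneg hp.le, Real.norm_eq_abs, stripPow]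
  ring

lemma integrable_strip_scPowDeriv (hf : ContDiff ℝ 2 f) (hc : HasCompactSupport f) (η : ℝ) (n : ℕ) :
    Integrable (fun p : ℝ × ℝ => (p.1 : ℂ) *
      (((deriv (deriv f) p.2 : ℝ) : ℂ) * scPowDeriv n (pt p.2 p.1))) (stripMeasure η) := by
  refine ((integrable_mul_stripPow hf hc η n).const_mul (n + 1)).mono' ?_ ?_
  · have h1 := (continuous_deriv_deriv_test hf).measurable
    have h2 := measurable_sc.comp measurable_pt_swap
    have h3 := measurable_scDeriv.comp measurable_pt_swap
    have h4 : Measurable fun p : ℝ × ℝ => scPowDeriv n (pt p.2 p.1) :=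
      (measurable_const.mul (h2.pow_const n)).mul h3
    exact Measurable.aestronglyMeasurable (by fun_prop)
  · filter_upwards [ae_mem_strip η] with p hp
    exact (norm_mul_scPowDeriv n _ hp.1).le

/-- Integrates `hasDerivAt_Phi` from the axis to height η; continuity of Φ down to 0 allows the
endpoint on the axis. -/
lemma Phi_sub (hf : ContDiff ℝ 2 f) (hc : HasCompactSupport f) {η : ℝ} (hη : 0 ≤ η) (n : ℕ) :
    Phi f n η - Phi f n 0 = -∫ p : ℝ × ℝ, (p.1 : ℂ) *
      (((deriv (deriv f) p.2 : ℝ) : ℂ) * scPowDeriv n (pt p.2 p.1)) ∂stripMeasure η := by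
  have hint := integrable_strip_scPowDeriv hf hc η n
  have h1 := hint.integral_prod_left
  have h2 : ∀ y : ℝ, ∫ x : ℝ, (y : ℂ) * (((deriv (deriv f) x : ℝ) : ℂ) * scPowDeriv n (pt x y))
      = y * horizDeriv (deriv (deriv f)) n y := fun y => by rw [integral_const_mul, horizDeriv]
  simp only [h2] at h1
  have h3 := intervalIntegral.integral_eq_sub_of_hasDerivAt_of_le hη
    ((continuousOn_Phi hf hc n).mono Set.Icc_subset_Ici_self)
    (fun y hy => hasDerivAt_Phi hf hc n hy.1)
    ((intervalIntegrable_iff_integrableOn_Ioc_of_le hη).2 h1.neg)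
  rw [← h3, intervalIntegral.integral_of_le hη, integral_neg, stripMeasure, integral_prod _ hint]
  simp only [h2]

/-- The increment of `(Phi f n ·).im` across the strip. -/
noncomputable def phiIncr (f : ℝ → ℝ) (η : ℝ) (n : ℕ) : ℝ := (Phi f n η).im - (Phi f n 0).im

lemma abs_phiIncr_le (hf : ContDiff ℝ 2 f) (hc : HasCompactSupport f) {η : ℝ} (hη : 0 ≤ η) (n : ℕ) :
    |phiIncr f η n| ≤ (n + 1) * stripMoment f η n := by
  rw [phiIncr, ← Complex.sub_im]
  refine (Complex.abs_im_le_norm _).trans ?_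
  rw [Phi_sub hf hc hη, norm_neg, stripMoment, ← integral_const_mul]
  refine norm_integral_le_of_norm_le ((integrable_mul_stripPow hf hc η n).const_mul _) ?_
  filter_upwards [ae_mem_strip η] with p hp
  exact (norm_mul_scPowDeriv n _ hp.1).le

/-- The geometric mean of the bounds ‖f'‖₁ and 4‖f''‖₁, the 4 being the length of the spectrum. -/
lemma abs_Phi_zero_im_le (hf : ContDiff ℝ 2 f) (hc : HasCompactSupport f) (n : ℕ) :
    |(Phi f n 0).im| ≤ 2 * √((∫ x, |deriv (deriv f) x|) * ∫ x, |deriv f x|) := by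
  set M := ∫ x, |deriv (deriv f) x|
  set L := ∫ x, |deriv f x|
  have hM0 : 0 ≤ M := integral_nonneg fun x => abs_nonneg _
  have hL0 : 0 ≤ L := integral_nonneg fun x => abs_nonneg _
  have hb : ∀ t, |deriv f t * sinPow n t| ≤ |deriv f t| := fun t => by
    rw [abs_mul]; exact mul_le_of_le_one_right (abs_nonneg _) (abs_sinPow_le_one n t)
  have hi : Integrable (fun t => |deriv f t|) specMeasure :=
    integrable_specMeasure (continuous_deriv_test hf).abs
  have h0 : |(Phi f n 0).im| ≤ ∫ t, |deriv f t| ∂specMeasure := by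
    rw [Phi_zero_im hf hc]
    exact norm_integral_le_of_norm_le (f := fun t => deriv f t * sinPow n t) hi (ae_of_all _ hb)
  have h1 : |(Phi f n 0).im| ≤ L :=
    h0.trans (setIntegral_le_integral (integrable_deriv_test hf hc).abs
      (ae_of_all _ fun t => abs_nonneg _))
  have h2 : |(Phi f n 0).im| ≤ 4 * M := by
    refine h0.trans ((integral_mono hi (integrable_const M)
      fun t => abs_deriv_le_integral hf hc t).trans (le_of_eq ?_))
    rw [integral_const, specMeasure, smul_eq_mul]
    simp [Measure.real]
    norm_num
  refine abs_le_of_sq_le_sq' ?_ (by positivity) |> abs_le.2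
  rw [mul_pow, Real.sq_sqrt (by positivity), ← sq_abs]
  nlinarith [abs_nonneg (Phi f n 0).im]

lemma summable_mul_stripMoment_sq (hf : ContDiff ℝ 2 f) (hc : HasCompactSupport f) {η : ℝ}
    (hη : 0 ≤ η) : Summable fun n : ℕ => ((n : ℝ) + 1) * stripMoment f η n ^ 2 :=
  summable_of_sum_range_le (fun n => by positivity) (sum_mul_stripMoment_sq_le hf hc hη)

lemma tsum_mul_stripMoment_sq_le (hf : ContDiff ℝ 2 f) (hc : HasCompactSupport f) {η : ℝ}
    (hη : 0 ≤ η) : ∑' n : ℕ, ((n : ℝ) + 1) * stripMoment f η n ^ 2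
      ≤ (η * ∫ x, |deriv (deriv f) x|) ^ 2 / 4 :=
  Real.tsum_le_of_sum_range_le (fun n => by positivity) (sum_mul_stripMoment_sq_le hf hc hη)

/-- By AM-GM against q_n²/(n+1), summable by the main term identity, and (n+1) times the squared
moment. It justifies the termwise integration of the cross term. -/
lemma summable_mul_stripMoment (hf : ContDiff ℝ 2 f) (hc : HasCompactSupport f) {η : ℝ}
    (hη : 0 ≤ η) : Summable fun n : ℕ => |(Phi f n 0).im| * stripMoment f η n := by
  have h1 : Summable fun n : ℕ => (Phi f n 0).im ^ 2 / (n + 1) := by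
    have h := (hasSum_mainTerm hf hc).summable.mul_left (Real.pi ^ 2 / 2)
    refine h.congr fun n => ?_
    field_simp
  refine Summable.of_nonneg_of_le
    (fun n => mul_nonneg (abs_nonneg _) (stripMoment_nonneg η n)) (fun n => ?_)
    (h1.add (summable_mul_stripMoment_sq hf hc hη))
  have hn : (0 : ℝ) < n + 1 := by positivity
  set q := (Phi f n 0).im
  set E := stripMoment f η n
  have e : |q| ^ 2 / (n + 1) + (n + 1) * E ^ 2 - 2 * (|q| * E)
      = (|q| - (n + 1) * E) ^ 2 / (n + 1) := by field_simp; ring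
  have h2 : 0 ≤ (|q| - (n + 1) * E) ^ 2 / (n + 1) := by positivity
  have h3 : 0 ≤ |q| * E := mul_nonneg (abs_nonneg _) (stripMoment_nonneg η n)
  rw [← sq_abs q]
  linarith

/-- The cross term between the boundary values and the increments over the strip. -/
lemma exists_hasSum_cross (hf : ContDiff ℝ 2 f) (hc : HasCompactSupport f) {η : ℝ} (hη : 0 ≤ η)
    (hη1 : η ≤ 1) :
    ∃ X : ℝ, HasSum (fun n : ℕ => (Phi f n 0).im * phiIncr f η n / (n + 1)) X ∧
      |X| ≤ 5 * √η * √((∫ x, |deriv (deriv f) x|) * ∫ x, |deriv f x|) *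
        (η * ∫ x, |deriv (deriv f) x|) := by
  set c := 5 * √η * √((∫ x, |deriv (deriv f) x|) * ∫ x, |deriv f x|) with hcdef
  have hn : ∀ n : ℕ, (n : ℂ) + 1 ≠ 0 := fun n => by exact_mod_cast n.succ_ne_zero
  have hF : ∀ n, Integrable (fun p : ℝ × ℝ => (((Phi f n 0).im / (n + 1) : ℝ) : ℂ) *
      ((p.1 : ℂ) * (((deriv (deriv f) p.2 : ℝ) : ℂ) * scPowDeriv n (pt p.2 p.1))))
      (stripMeasure η) := fun n => (integrable_strip_scPowDeriv hf hc η n).const_mul _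
  have hFn : ∀ n, ∫ p : ℝ × ℝ, ‖(((Phi f n 0).im / (n + 1) : ℝ) : ℂ) *
      ((p.1 : ℂ) * (((deriv (deriv f) p.2 : ℝ) : ℂ) * scPowDeriv n (pt p.2 p.1)))‖ ∂stripMeasure η
      = |(Phi f n 0).im| * stripMoment f η n := by
    intro n
    rw [stripMoment, ← integral_const_mul]
    refine integral_congr_ae ?_
    filter_upwards [ae_mem_strip η] with p hp
    rw [norm_mul, norm_mul_scPowDeriv n _ hp.1, Complex.norm_real, Real.norm_eq_abs, abs_div,
      abs_of_pos (by positivity : (0 : ℝ) < n + 1)]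
    have : (n : ℝ) + 1 ≠ 0 := by positivity
    field_simp
  -- The factor n + 1 in (m^(n+1))' cancels the weight 1/(n+1), so the integrands sum to m' · ∑ q_n
  -- m^n, that is, m' times the Cauchy transform.
  have h := integrable_and_hasSum_integral (ν := stripMeasure η)
    (G := fun p : ℝ × ℝ => (p.1 : ℂ) * (((deriv (deriv f) p.2 : ℝ) : ℂ) *
      (scDeriv (pt p.2 p.1) * cauchyTransform f (pt p.2 p.1)))) hF
    (by simp only [hFn]; exact summable_mul_stripMoment hf hc hη) ?_
  · set Z := ∫ p : ℝ × ℝ, (p.1 : ℂ) * (((deriv (deriv f) p.2 : ℝ) : ℂ) *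
      (scDeriv (pt p.2 p.1) * cauchyTransform f (pt p.2 p.1))) ∂stripMeasure η with hZ
    refine ⟨-Z.im, ?_, ?_⟩
    · refine (Complex.imCLM.hasSum h.2).neg.congr_fun fun n => ?_
      simp only [Complex.imCLM_apply]
      rw [integral_const_mul, Complex.im_ofReal_mul]
      have := congrArg Complex.im (Phi_sub hf hc hη n)
      rw [Complex.sub_im, Complex.neg_im] at this
      rw [phiIncr, this]
      ring
    · rw [abs_neg]
      refine (Complex.abs_im_le_norm _).trans ?_
      rw [← integral_strip (fun x => |deriv (deriv f) x|) hη, ← integral_const_mul]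
      refine norm_integral_le_of_norm_le
        ((integrable_strip (integrable_deriv_deriv_test hf hc).abs η).const_mul _) ?_
      filter_upwards [ae_mem_strip η] with p hp
      have h1 := norm_cauchyTransform_le hf hc (x := p.2) hp.1 (hp.2.trans hη1)
      have h2 : √p.1 ≤ √η := Real.sqrt_le_sqrt hp.2
      rw [norm_mul, norm_mul, norm_mul, Complex.norm_real, Complex.norm_real,
        Real.norm_of_nonneg hp.1.le, Real.norm_eq_abs]
      calc p.1 * (|deriv (deriv f) p.2| * (‖scDeriv (pt p.2 p.1)‖ *
            ‖cauchyTransform f (pt p.2 p.1)‖))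
          = (p.1 * ‖scDeriv (pt p.2 p.1)‖ * ‖cauchyTransform f (pt p.2 p.1)‖) *
              |deriv (deriv f) p.2| := by ring
        _ ≤ c * |deriv (deriv f) p.2| := by
            refine mul_le_mul_of_nonneg_right (h1.trans ?_) (abs_nonneg _)
            rw [hcdef]
            gcongr
  · filter_upwards [ae_mem_strip η] with p hp
    have h1 := (hasSum_cauchyTransform hf hc (w := pt p.2 p.1) (by simpa using hp.1)).mul_left
      ((p.1 : ℂ) * (((deriv (deriv f) p.2 : ℝ) : ℂ) * scDeriv (pt p.2 p.1)))
    convert! h1 using 1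
    · funext n
      rw [scPowDeriv]
      push_cast
      have := hn n
      field_simp
    · ring

end

/-! ### The remainder -/

section

variable {f : ℝ → ℝ} {N : ℕ} {μ : Fin N → ℝ} {B : ℝ}

lemma sqrt_mul_sqrt_mul_eq {η M L : ℝ} (hη : 0 ≤ η) (hM : 0 ≤ M) :
    √η * √(M * L) * (η * M) = (η * M) ^ (3 / 2 : ℝ) * L ^ (1 / 2 : ℝ) := by
  have hW : 0 ≤ η * M := mul_nonneg hη hM
  rw [show (3 / 2 : ℝ) = 1 + 1 / 2 by norm_num, Real.rpow_add_of_nonneg hW (by norm_num)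
    (by norm_num), Real.rpow_one, ← Real.sqrt_eq_rpow, ← Real.sqrt_eq_rpow, Real.sqrt_mul hM,
    Real.sqrt_mul hη]
  ring

/-- With d_n the increment, the difference of squares is d_n² + 2q_n d_n, split into three series.
The d_n² part uses the square-summed strip moments. The part 2T_n q_n d_n/(n+1) needs only termwise
bounds, since T_n is summable. The part without T_n has no such help and uses the resummed cross
term. -/
lemma exists_hasSum_remainder (hf : ContDiff ℝ 2 f) (hc : HasCompactSupport f) {η : ℝ}
    (hη : 0 ≤ η) (hη1 : η ≤ 1) (hTs : Summable fun n => |powerSum μ n|)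
    (hTB : ∑' n, |powerSum μ n| ≤ B) :
    ∃ R : ℝ, HasSum (fun n : ℕ => (1 + powerSum μ n) / (n + 1) *
        ((Phi f n η).im ^ 2 - (Phi f n 0).im ^ 2)) R ∧
      |R| ≤ (1 + B) * (η * ∫ x, |deriv (deriv f) x|) ^ 2 + (10 + 4 * B) *
        ((η * ∫ x, |deriv (deriv f) x|) ^ (3 / 2 : ℝ) * (∫ x, |deriv f x|) ^ (1 / 2 : ℝ)) := by
  obtain ⟨X, hX, hXle⟩ := exists_hasSum_cross hf hc hη hη1
  have hM0 : 0 ≤ ∫ x, |deriv (deriv f) x| := integral_nonneg fun x => abs_nonneg _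
  have hL0 : 0 ≤ ∫ x, |deriv f x| := integral_nonneg fun x => abs_nonneg _
  have hd := fun n => abs_phiIncr_le hf hc hη n
  have hq := fun n => abs_Phi_zero_im_le hf hc n
  have hE0 := fun n => stripMoment_nonneg (f := f) η n
  have hE := fun n => stripMoment_le hf hc hη n
  have hY := sqrt_mul_sqrt_mul_eq (L := ∫ x, |deriv f x|) hη hM0
  have hEs := summable_mul_stripMoment_sq hf hc hη
  have hEt := tsum_mul_stripMoment_sq_le hf hc hη
  set M := ∫ x, |deriv (deriv f) x|
  set L := ∫ x, |deriv f x|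
  set Y := (η * M) ^ (3 / 2 : ℝ) * L ^ (1 / 2 : ℝ)
  set E := stripMoment f η
  have hY0 : 0 ≤ Y := by rw [← hY]; positivity
  have hT : ∀ n, |powerSum μ n| ≤ B := fun n =>
    (hTs.le_tsum n fun _ _ => abs_nonneg _).trans hTB
  have hB0 : 0 ≤ B := (abs_nonneg _).trans (hT 0)
  have ha : ∀ n : ℕ, ‖(1 + powerSum μ n) / (n + 1) * phiIncr f η n ^ 2‖
      ≤ (1 + B) * ((n + 1) * E n ^ 2) := by
    intro n
    have h1 : |1 + powerSum μ n| ≤ 1 + B := by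
      refine (abs_add_le _ _).trans ?_
      rw [abs_one]
      linarith [hT n]
    have hn : (0 : ℝ) < n + 1 := by positivity
    rw [norm_mul, norm_div, norm_pow, Real.norm_eq_abs, Real.norm_eq_abs, Real.norm_eq_abs,
      abs_of_pos hn]
    calc |1 + powerSum μ n| / (n + 1) * |phiIncr f η n| ^ 2
        ≤ (1 + B) / (n + 1) * ((n + 1) * E n) ^ 2 := by
          have := hd n
          gcongr
      _ = _ := by field_simp
  have hb : ∀ n : ℕ, ‖2 * powerSum μ n * ((Phi f n 0).im * phiIncr f η n / (n + 1))‖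
      ≤ 4 * Y * |powerSum μ n| := by
    intro n
    have hn : (0 : ℝ) < n + 1 := by positivity
    rw [norm_mul, norm_mul, norm_div, norm_mul, Real.norm_eq_abs, Real.norm_eq_abs,
      Real.norm_eq_abs, Real.norm_eq_abs, Real.norm_eq_abs, abs_of_pos hn, abs_two]
    have h1 : |phiIncr f η n| / (n + 1) ≤ √η * (η * M) := by
      rw [div_le_iff₀ hn]
      calc |phiIncr f η n| ≤ (n + 1) * E n := hd n
        _ ≤ (n + 1) * (√η * (η * M)) := mul_le_mul_of_nonneg_left (hE n) hn.le
        _ = _ := mul_comm _ _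
    calc 2 * |powerSum μ n| * (|(Phi f n 0).im| * |phiIncr f η n| / (n + 1))
        = 2 * |powerSum μ n| * (|(Phi f n 0).im| * (|phiIncr f η n| / (n + 1))) := by ring
      _ ≤ 2 * |powerSum μ n| * ((2 * √(M * L)) * (√η * (η * M))) := by
          have := hq n
          gcongr
      _ = 4 * Y * |powerSum μ n| := by rw [← hY]; ring
  have ha2 := Summable.of_norm_bounded (hEs.mul_left (1 + B)) ha
  have hb2 := Summable.of_norm_bounded (hTs.mul_left (4 * Y)) hb
  have ha3 : |∑' n : ℕ, (1 + powerSum μ n) / (n + 1) * phiIncr f η n ^ 2|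
      ≤ (1 + B) * ((η * M) ^ 2 / 4) :=
    (tsum_of_norm_bounded (hEs.hasSum.mul_left (1 + B)) ha).trans
      (mul_le_mul_of_nonneg_left hEt (by positivity))
  have hb3 : |∑' n : ℕ, 2 * powerSum μ n * ((Phi f n 0).im * phiIncr f η n / (n + 1))|
      ≤ 4 * Y * B :=
    (tsum_of_norm_bounded (hTs.hasSum.mul_left (4 * Y)) hb).trans
      (mul_le_mul_of_nonneg_left hTB (by positivity))
  refine ⟨_, ((ha2.hasSum.add hb2.hasSum).add (hX.mul_left 2)).congr_fun fun n => ?_, ?_⟩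
  · have h1 : (Phi f n η).im = (Phi f n 0).im + phiIncr f η n := by rw [phiIncr]; ring
    rw [h1]
    ring
  · have h2 : |2 * X| ≤ 10 * Y := by
      rw [abs_mul, abs_two, ← hY]
      linarith
    have h3 : 0 ≤ (1 + B) * (η * M) ^ 2 := by positivity
    calc _ ≤ |∑' n : ℕ, (1 + powerSum μ n) / (n + 1) * phiIncr f η n ^ 2|
          + |∑' n : ℕ, 2 * powerSum μ n * ((Phi f n 0).im * phiIncr f η n / (n + 1))| + |2 * X| :=
          (abs_add_le _ _).trans (by gcongr; exact abs_add_le _ _)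
      _ ≤ (1 + B) * ((η * M) ^ 2 / 4) + 4 * Y * B + 10 * Y := by gcongr
      _ ≤ _ := by linarith

lemma summable_abs_powerSum {ρ : ℝ} (hρ : ∀ k, |μ k| ≤ ρ) (h0 : 0 ≤ ρ) (h1 : ρ < 1) :
    Summable (fun n => |powerSum μ n|) ∧
      ∑' n, |powerSum μ n| ≤ |∑ k, μ k| + (∑ k, μ k ^ 2) / (1 - ρ) := by
  have hg := (hasSum_geometric_of_lt_one h0 h1).mul_right (∑ k, μ k ^ 2)
  have hs : Summable fun n => |powerSum μ (n + 1)| :=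
    Summable.of_nonneg_of_le (fun n => abs_nonneg _) (abs_powerSum_succ_le hρ) hg.summable
  have hs' : Summable fun n => |powerSum μ n| := (summable_nat_add_iff 1).1 hs
  refine ⟨hs', ?_⟩
  rw [hs'.tsum_eq_zero_add]
  have h2 : ∑' n, |powerSum μ (n + 1)| ≤ (1 - ρ)⁻¹ * ∑ k, μ k ^ 2 := by
    rw [← hg.tsum_eq]
    exact hs.tsum_le_tsum (abs_powerSum_succ_le hρ) hg.summable
  have h3 : |powerSum μ 0| = |∑ k, μ k| := by simp [powerSum]
  rw [h3, div_eq_inv_mul]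
  gcongr

end

end GenWigner

/-! ### Assembly and choice of the constant -/

open GenWigner in
theorem mainTheorem6 (C₀ : ℝ) (hC₀ : 0 < C₀) :
    ∃ K : ℝ, 0 < K ∧
      ∀ (N : ℕ), 2 ≤ N → ∀ S : Matrix (Fin N) (Fin N) ℝ, GenWigner.IsVarianceProfile C₀ S →
        ∃ A : Matrix (Fin N) (Fin N) ℝ,
          (∀ x ∈ Set.Icc (-2 : ℝ) 2, ∀ y ∈ Set.Icc (-2 : ℝ) 2,
            Tendsto (fun p : ℂ × ℂ => GenWigner.gapPart S p.1 p.2)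
              (𝓝[{p : ℂ × ℂ | p.1.im ≠ 0 ∧ p.2.im ≠ 0}] ((x : ℂ), (y : ℂ))) (𝓝 A)) ∧
          ∃ h : ℝ → ℝ → ℝ,
            Measurable (Function.uncurry h) ∧
            (∀ x y, (x, y) ∉ GenWigner.square → h x y = 0) ∧
            (∀ x y, |h x y| ≤ K) ∧
            (∀ x y, |h x y| ≤ K * ∑ i, ∑ j, A i j ^ 2) ∧
            ∀ (χ : ℝ → ℝ), GenWigner.IsCutoff χ →
            ∀ (𝔞 : ℝ), 0 < 𝔞 → 𝔞 < 1 →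
            ∀ (f : ℝ → ℝ), ContDiff ℝ 2 f → HasCompactSupport f →
              Real.log N * (N : ℝ) ^ (-1 + 𝔞) * (∫ x, |deriv (deriv f) x|) ≤ 1 →
              IntegrableOn (GenWigner.integrand S χ f)
                (GenWigner.Omega N 𝔞 ×ˢ GenWigner.Omega N 𝔞) ∧
              ∃ r : ℝ,
                (2 / (Real.pi : ℂ) ^ 2) *
                    ∫ p in GenWigner.Omega N 𝔞 ×ˢ GenWigner.Omega N 𝔞,
                      GenWigner.integrand S χ f p
                  = ((GenWigner.mainTerm f + GenWigner.errorTerm A h f + r : ℝ) : ℂ) ∧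
                |r| ≤ K *
                  (Real.log N * ((N : ℝ) ^ (-1 + 𝔞) * ∫ x, |deriv (deriv f) x|) ^ 2
                    + ((N : ℝ) ^ (-1 + 𝔞) * ∫ x, |deriv (deriv f) x|) ^ (3 / 2 : ℝ)
                      * (∫ x, |deriv f x|) ^ (1 / 2 : ℝ)) := by
  set ρ := 1 - 1 / C₀ with hρdef
  -- The absolute value keeps the constant nonnegative before any profile is given: only the
  -- existence of a profile forces C₀ ≥ 1 and 0 ≤ ρ < 1.
  set K₁ := |∑' n : ℕ, ((n : ℝ) + 2) * ρ ^ n|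
  -- Bounds ∑ |T_n|: |Tr A| ≤ C₀ for n = 0, and ∑ A_ij² ≤ C₀² divided by 1 - ρ = 1/C₀ for the
  -- geometric tail.
  set B := C₀ + C₀ ^ 2 * C₀
  have hB0 : 0 ≤ B := by positivity
  refine ⟨K₁ + K₁ * C₀ ^ 2 + (10 + 4 * B), by positivity, fun N hN S hS => ?_⟩
  have hN0 : 0 < N := by omega
  have hC1 : 1 ≤ C₀ := hS.one_le hN0
  have hρ0 : 0 ≤ ρ := by
    rw [hρdef, sub_nonneg, div_le_one hC₀]; exact hC1
  have hρ1 : ρ < 1 := by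
    rw [hρdef]; have : 0 < 1 / C₀ := by positivity
    linarith
  obtain ⟨μ, hμ, hsum, hsq, hg⟩ := exists_eigenvalues_g_eq hN0 hC₀ hS
  have hσ := sum_centered_sq_le hN0 hC₀ hS
  have hσ0 : 0 ≤ ∑ i, ∑ j, centered S i j ^ 2 :=
    Finset.sum_nonneg fun i _ => Finset.sum_nonneg fun j _ => sq_nonneg _
  have hh : ∀ x y, |momentKernel μ (x, y)| ≤ K₁ * ∑ i, ∑ j, centered S i j ^ 2 := by
    intro x y
    refine (abs_momentKernel_le hμ hρ0 hρ1 (x, y)).trans ?_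
    rw [hsq]
    exact mul_le_mul_of_nonneg_right (le_abs_self _) hσ0
  refine ⟨centered S, fun x hx y hy => tendsto_gapPart hN0 hC₀ hS hx hy,
    fun x y => momentKernel μ (x, y), measurable_momentKernel hμ hρ0 hρ1,
    fun x y hxy => momentKernel_eq_zero hxy, fun x y => ?_, fun x y => ?_,
    fun χ hχ 𝔞 h𝔞 h𝔞1 f hf hc _ => ?_⟩
  · refine (hh x y).trans ?_
    have h1 : K₁ * ∑ i, ∑ j, centered S i j ^ 2 ≤ K₁ * C₀ ^ 2 := by gcongr
    have h2 : 0 ≤ K₁ := abs_nonneg _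
    linarith
  · refine (hh x y).trans (mul_le_mul_of_nonneg_right ?_ hσ0)
    have h2 : 0 ≤ K₁ := abs_nonneg _
    have h3 : 0 ≤ K₁ * C₀ ^ 2 := by positivity
    linarith
  set η := (N : ℝ) ^ (-1 + 𝔞) with hη
  have hη0 : 0 ≤ η := by positivity
  have hη1 : η < 1 := Real.rpow_lt_one_of_one_lt_of_neg (by exact_mod_cast hN) (by linarith)
  have hμ1 : ∀ k, |μ k| ≤ 1 := fun k => (hμ k).trans hρ1.le
  obtain ⟨hint, hLHS⟩ := integrableOn_integrand_and_hasSum hf hc hχ hN0 hη1 hμ1 hg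
  refine ⟨hint, ?_⟩
  have hA : ∑ k, μ k = ∑ i, centered S i i := hsum
  obtain ⟨hTs, hTB⟩ := summable_abs_powerSum hμ hρ0 hρ1
  have hTB' : ∑' n, |powerSum μ n| ≤ B := by
    refine hTB.trans ?_
    rw [hA, hsq, show 1 - ρ = 1 / C₀ by rw [hρdef]; ring, div_div_eq_mul_div, div_one]
    exact add_le_add (abs_trace_centered_le hN0 hC₀ hS) (mul_le_mul_of_nonneg_right hσ hC₀.le)
  obtain ⟨R, hR, hRle⟩ := exists_hasSum_remainder hf hc hη0 hη1.le hTs hTB'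
  have hmain := hasSum_main_add_error hf hc hA hμ hρ0 hρ1
  refine ⟨2 / Real.pi ^ 2 * R, ?_, ?_⟩
  · have h1 := hmain.add (hR.mul_left (2 / Real.pi ^ 2))
    have h2 := Complex.ofRealCLM.hasSum h1
    have h3 := hLHS.mul_left (2 / (Real.pi : ℂ) ^ 2)
    refine h3.unique (h2.congr_fun fun n => ?_)
    simp only [Complex.ofRealCLM_apply]
    push_cast
    ring
  · have hlog : 1 / 2 ≤ Real.log N := by
      have h1 : Real.log 2 ≤ Real.log N := Real.log_le_log (by norm_num) (by exact_mod_cast hN)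
      linarith [Real.log_two_gt_d9]
    have hπ : 2 / Real.pi ^ 2 ≤ 1 := by
      rw [div_le_one (by positivity)]
      nlinarith [Real.pi_gt_three]
    set W := η * ∫ x, |deriv (deriv f) x|
    have hL0 : 0 ≤ ∫ x, |deriv f x| := integral_nonneg fun x => abs_nonneg _
    have hW0 : 0 ≤ W := mul_nonneg hη0 (integral_nonneg fun x => abs_nonneg _)
    set Y := W ^ (3 / 2 : ℝ) * (∫ x, |deriv f x|) ^ (1 / 2 : ℝ)
    have hY0 : 0 ≤ Y := by positivity
    have hK : 0 ≤ K₁ + K₁ * C₀ ^ 2 := by positivity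
    rw [abs_mul, abs_of_nonneg (show 0 ≤ 2 / Real.pi ^ 2 by positivity)]
    have h2 : (1 + B) * W ^ 2 ≤ (10 + 4 * B) * (Real.log N * W ^ 2) := by
      nlinarith [mul_le_mul_of_nonneg_right hlog (sq_nonneg W), sq_nonneg W,
        mul_nonneg hB0 (mul_nonneg (sub_nonneg.2 hlog) (sq_nonneg W)),
        mul_nonneg hB0 (sq_nonneg W)]
    have h3 : 0 ≤ Real.log N * W ^ 2 := mul_nonneg (by linarith) (sq_nonneg W)
    calc 2 / Real.pi ^ 2 * |R| ≤ 1 * ((1 + B) * W ^ 2 + (10 + 4 * B) * Y) := by gcongr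
      _ ≤ (10 + 4 * B) * (Real.log N * W ^ 2 + Y) := by linarith
      _ ≤ _ := by
        refine mul_le_mul_of_nonneg_right ?_ (by positivity)
        linarith
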